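/- **Biquandles.** A biquandle is a set $X$ with two operations $\underline{\triangleright},\overline{\triangleright}:X\times X\to X$ such that (i) $x\,\underline{\triangleright}\,x=x\,\overline{\triangleright}\,x$ for all $x$; (ii) the maps $x\mapsto x\,\overline{\triangleright}\,y$ and $x\mapsto x\,\underline{\triangleright}\,y$ (for each $y$) and $(x,y)\mapsto(y\,\overline{\triangleright}\,x,\;x\,\underline{\triangleright}\,y)$ are bijective; (iii) for all $x,y,z$ $$(x\underline{\triangleright}y)\underline{\triangleright}(z\underline{\triangleright}y)=(x\underline{\triangleright}z)\underline{\triangleright}(y\overline{\triangleright}z),\quad (x\overline{\triangleright}y)\underline{\triangleright}(z\overline{\triangleright}y)=(x\underline{\triangleright}z)\overline{\triangleright}(y\underline{\triangleright}z),\quad (x\overline{\triangleright}y)\overline{\triangleright}(z\overline{\triangleright}y)=(x\overline{\triangleright}z)\overline{\triangleright}(y\underline{\triangleright}z).$$ **Brackets.** Let $R$ be a commutative ring with identity. An $X$-bracket $\beta$ over $R$ consists of maps $A,B:X\times X\to R^\times$, written $A_{x,y},B_{x,y}$, such that $-A_{x,x}^2B_{x,x}^{-1}$ has the same value $w$ for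 all $x$; $-A_{x,y}B_{x,y}^{-1}-A_{x,y}^{-1}B_{x,y}$ has the same value $\delta$ for all $x,y$; and for all $x,y,z$, writing $C_1=C_{x,y}$, $C_2=C_{y,z}$, $C_3=C_{x\underline{\triangleright}y,\,z\overline{\triangleright}y}$, $C_1'=C_{x,z}$, $C_2'=C_{y\overline{\triangleright}x,\,z\overline{\triangleright}x}$, $C_3'=C_{x\underline{\triangleright}z,\,y\underline{\triangleright}z}$ for $C\in\{A,B\}$, $$A_1A_2A_3=A_1'A_2'A_3',\qquad A_1B_2B_3=B_1'B_2'A_3',\qquad B_1A_2B_3=B_1'A_2'B_3',$$ $$A_1A_2B_3=A_1'B_2'A_3'+A_1'A_2'B_3'+\delta A_1'B_2'B_3'+B_1'B_2'B_3',$$ $$B_1A_2A_3+A_1B_2A_3+\delta B_1B_2A_3+B_1B_2B_3=B_1'A_2'A_3'.$$ **Knotoids.** Let $\Sigma$ be an oriented smooth surface. A knotoid diagram $K$ in $\Sigma$ is a smooth immersion of $[0,1]$ in $\Sigma$ whose only multiple points are finitely many transversal double points (the crossings), each endowed with over/under information; the images of $0$ (the tail) and $1$ (the head) are distinct from each other and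 are not crossings. Diagrams are oriented from tail to head. Two diagrams are equivalent if they are related by a finite sequence of orientation-preserving reparametrizations, isotopies of $\Sigma$, and Reidemeister moves I, II, III performed in disks in $\Sigma$ free of endpoints; a knotoid in $\Sigma$ is an equivalence class of diagrams. **Colorings.** The parameters of the crossings divide $[0,1]$ into semiarcs. Draw a crossing with both strands pointing upwards (so that the over-strand of a positive crossing runs from bottom left to top right), and let $x$ and $y$ be the colors of the under-semiarc and of the over-semiarc on its right-hand side. An $X$-coloring of $K$ is an assignment of elements of $X$ to the semiarcs such that at every crossing, of either sign, the under-semiarc and the over-semiarc on the left-hand side are colored $x\,\underline{\triangleright}\,y$ and $y\,\overline{\triangleright}\,x$. **Bracket value.** Let $f$ be an $X$-coloring of $K$. A state is a choice, at each crossing, of the oriented smoothing or of the other one. At a positive crossing with labels $x,y$ as above these have coefficients $A_{x,y}$ and $B_{x,y}$ respectively, at a negative crossing $A_{x,y}^{-1}$ and $B_{x,y}^{-1}$. Let $p$ and $n$ be the numbers of positive and of negative crossings. Put $$\beta(f)=\sum_{S}\Big(\prod_{\text{crossings}}\text{coefficient of the smoothing in }S\Big)\,\delta^{c(S)}\,w^{n-p}\in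 R,$$ the sum being over all states $S$, where $c(S)$ is the number of components of the smoothed curve, the open-ended component being counted in the same way as the closed ones. **Proposition.** Let $X$ be a finite biquandle, $R$ a commutative ring with identity, and $\beta$ an $X$-bracket over $R$. For a knotoid diagram $K$ in an oriented surface $\Sigma$ let $\Phi_X^\beta(K)$ be the $X\times X$ matrix whose $(j,k)$ entry is $$\beta_{jk}=\sum_{f\in H_{jk}}u^{\beta(f)},$$ a finite formal sum of powers of $u$ with exponents in $R$ (an element of the group ring $\mathbb Z[R]$ of the additive group of $R$), where $H_{jk}$ is the set of $X$-colorings of $K$ whose tail semiarc is colored $j$ and whose head semiarc is colored $k$. If $K$ and $K'$ are equivalent knotoid diagrams in $\Sigma$, then $\Phi_X^\beta(K)=\Phi_X^\beta(K')$; that is, $\Phi_X^\beta$ is an invariant of knotoids. -/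

import Mathlib

open Set Filter
open scoped Manifold ContDiff Topology

/-! ### Biquandles and biquandle brackets -/

/-- A biquandle: `utri x y` is `x` with the underlined triangle operation applied to `y`,
`otri x y` is `x` with the overlined one. -/
class Biquandle (X : Type*) where
  utri : X → X → X
  otri : X → X → X
  under_self : ∀ x, utri x x = otri x x
  over_bijective : ∀ y, Function.Bijective fun x => otri x y
  under_bijective : ∀ y, Function.Bijective fun x => utri x y
  sideways_bijective :
    Function.Bijective fun p : X × X => ((otri p.2 p.1, utri p.1 p.2) : X × X)
  exchange_under_under : ∀ x y z,
    utri (utri x y) (utri z y) = utri (utri x z) (otri y z)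
  exchange_over_under : ∀ x y z,
    utri (otri x y) (otri z y) = otri (utri x z) (utri y z)
  exchange_over_over : ∀ x y z,
    otri (otri x y) (otri z y) = otri (otri x z) (utri y z)

open Biquandle in
/-- An `X`-bracket over `R`. The fields `w` and `δ` record the common values in the first two
axioms (they are determined by `A` and `B` as soon as `X` is nonempty). -/
structure BiquandleBracket (X R : Type*) [Biquandle X] [CommRing R] where
  A : X → X → Rˣ
  B : X → X → Rˣ
  w : Rˣ
  δ : R
  w_eq : ∀ x, -((A x x) ^ 2 * (B x x)⁻¹) = w
  δ_eq : ∀ x y, -((A x y : R) * ((B x y)⁻¹ : Rˣ)) - ((A x y)⁻¹ : Rˣ) * (B x y : R) = δ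
  triple₁ : ∀ x y z,
    (A x y * A y z * A (utri x y) (otri z y) : R)
      = A x z * A (otri y x) (otri z x) * A (utri x z) (utri y z)
  triple₂ : ∀ x y z,
    (A x y * B y z * B (utri x y) (otri z y) : R)
      = B x z * B (otri y x) (otri z x) * A (utri x z) (utri y z)
  triple₃ : ∀ x y z,
    (B x y * A y z * B (utri x y) (otri z y) : R)
      = B x z * A (otri y x) (otri z x) * B (utri x z) (utri y z)
  triple₄ : ∀ x y z,
    (A x y * A y z * B (utri x y) (otri z y) : R)
      = A x z * B (otri y x) (otri z x) * A (utri x z) (utri y z)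
        + A x z * A (otri y x) (otri z x) * B (utri x z) (utri y z)
        + δ * A x z * B (otri y x) (otri z x) * B (utri x z) (utri y z)
        + B x z * B (otri y x) (otri z x) * B (utri x z) (utri y z)
  triple₅ : ∀ x y z,
    (B x y * A y z * A (utri x y) (otri z y)
        + A x y * B y z * A (utri x y) (otri z y)
        + δ * B x y * B y z * A (utri x y) (otri z y)
        + B x y * B y z * B (utri x y) (otri z y) : R)
      = B x z * A (otri y x) (otri z x) * A (utri x z) (utri y z)

/-! ### Oriented surfaces -/

section Surface

variable (M : Type*) [TopologicalSpace M] [ChartedSpace (EuclideanSpace ℝ (Fin 2)) M]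

/-- An orientation of a surface. Mathlib identifies the tangent plane at `p` with `ℝ²` through the
preferred chart at `p`; `sign p` says whether the standard orientation of `ℝ²` corresponds under
this identification to the chosen orientation of the tangent plane (`1`) or to the opposite one
(`-1`). The choice is locally constant: for `q` near `p`, the derivative at `q` of the change from
the preferred chart at `q` to the preferred chart at `p` carries the orientation chosen at `q` to
the one chosen at `p`. -/
structure SurfaceOrientation [IsManifold (𝓡 2) ∞ M] where
  sign : M → ℤˣ
  coherent : ∀ p, ∀ᶠ q in 𝓝 p,
    0 < ((sign p : ℤ) : ℝ) * ((sign q : ℤ) : ℝ) * (tangentCoordChange (𝓡 2) q p q).det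

variable {M}

/-- The velocity at time `t` of a curve `γ : [0,1] → M`, read in the preferred chart at `γ t`. -/
noncomputable def curveVelocity (γ : ℝ → M) (t : ℝ) : EuclideanSpace ℝ (Fin 2) :=
  derivWithin (fun s => chartAt (EuclideanSpace ℝ (Fin 2)) (γ t) (γ s)) (Icc 0 1) t

/-! ### Knotoid diagrams -/

variable (M) in
/-- A knotoid diagram on the surface `M`: a generic smooth immersion of `[0,1]` (only the values of
`curve` on `[0,1]` matter) with over/under information. A crossing is recorded as the pair
`(s, t)` of its two parameters, `s` on the overpassing and `t` on the underpassing branch. -/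
structure KnotoidDiagram where
  curve : ℝ → M
  smooth : ContMDiffOn 𝓘(ℝ, ℝ) (𝓡 2) ∞ curve (Icc 0 1)
  immersion : ∀ t ∈ Icc (0 : ℝ) 1, curveVelocity curve t ≠ 0
  crossings : Finset (ℝ × ℝ)
  crossings_subset : ∀ c ∈ crossings, c.1 ∈ Icc (0 : ℝ) 1 ∧ c.2 ∈ Icc (0 : ℝ) 1
  double_iff : ∀ s ∈ Icc (0 : ℝ) 1, ∀ t ∈ Icc (0 : ℝ) 1,
    (s ≠ t ∧ curve s = curve t) ↔ ((s, t) ∈ crossings ∨ (t, s) ∈ crossings)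
  over_or_under : ∀ s t, (s, t) ∈ crossings → (t, s) ∉ crossings
  no_triple : ∀ r ∈ Icc (0 : ℝ) 1, ∀ s ∈ Icc (0 : ℝ) 1, ∀ t ∈ Icc (0 : ℝ) 1,
    curve r = curve s → curve s = curve t → r = s ∨ s = t ∨ r = t
  transversal : ∀ c ∈ crossings,
    LinearIndependent ℝ ![curveVelocity curve c.1, curveVelocity curve c.2]
  tail_simple : ∀ t ∈ Icc (0 : ℝ) 1, curve t = curve 0 → t = 0
  head_simple : ∀ t ∈ Icc (0 : ℝ) 1, curve t = curve 1 → t = 1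

namespace KnotoidDiagram

/-- The crossing `c` is positive: rotating counterclockwise by less than a half turn takes the
direction of the overpassing branch to that of the underpassing branch. -/
def IsPositive [IsManifold (𝓡 2) ∞ M] (o : SurfaceOrientation M) (D : KnotoidDiagram M)
    (c : ℝ × ℝ) : Prop :=
  0 < ((o.sign (D.curve c.1) : ℤ) : ℝ) *
    (curveVelocity D.curve c.1 0 * curveVelocity D.curve c.2 1
      - curveVelocity D.curve c.1 1 * curveVelocity D.curve c.2 0)

/-- The finite set of parameters at which the curve passes through a crossing. -/
noncomputable def passages (D : KnotoidDiagram M) : Finset ℝ :=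
  D.crossings.image Prod.fst ∪ D.crossings.image Prod.snd

/-- The semiarcs, i.e. the pieces into which the passages divide `[0,1]`, numbered from tail to
head: semiarc `i` comes right after exactly `i` passages. -/
abbrev Semiarc (D : KnotoidDiagram M) : Type := Fin (D.passages.card + 1)

/-- The semiarc that ends at the passage `t`. -/
noncomputable def before (D : KnotoidDiagram M) (t : ℝ) : D.Semiarc :=
  ⟨(D.passages.filter (· < t)).card, Nat.lt_succ_of_le (Finset.card_filter_le _ _)⟩

/-- The semiarc that starts at the passage `t`. -/
noncomputable def after (D : KnotoidDiagram M) (t : ℝ) : D.Semiarc :=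
  ⟨(D.passages.filter (· ≤ t)).card, Nat.lt_succ_of_le (Finset.card_filter_le _ _)⟩

/-! ### Colorings and the bracket -/

variable [IsManifold (𝓡 2) ∞ M] {X R : Type*} [Biquandle X] [CommRing R]
  (o : SurfaceOrientation M) (D : KnotoidDiagram M)

open Classical in
/-- The label `x` of the crossing `c`. Draw the crossing with both strands pointing upwards (so
that a positive crossing has its over-strand running from bottom left to top right); `x` is the
color of the under-semiarc on the right-hand side. -/
noncomputable def labelX (f : D.Semiarc → X) (c : ℝ × ℝ) : X :=
  if D.IsPositive o c then f (D.before c.2) else f (D.after c.2)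

open Classical in
/-- The label `y` of the crossing `c`: with both strands drawn pointing upwards, the color of the
over-semiarc on the right-hand side. -/
noncomputable def labelY (f : D.Semiarc → X) (c : ℝ × ℝ) : X :=
  if D.IsPositive o c then f (D.after c.1) else f (D.before c.1)

/-- `f` is a biquandle coloring: when both strands point upwards and the two semiarcs on the
right-hand side of a crossing are colored `x` (under) and `y` (over), the semiarcs on the left-hand
side are colored `utri x y` (under) and `otri y x` (over). -/
def IsColoring (f : D.Semiarc → X) : Prop :=
  ∀ c ∈ D.crossings,
    (D.IsPositive o c →
      f (D.after c.2) = Biquandle.utri (D.labelX o f c) (D.labelY o f c) ∧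
      f (D.before c.1) = Biquandle.otri (D.labelY o f c) (D.labelX o f c)) ∧
    (¬ D.IsPositive o c →
      f (D.before c.2) = Biquandle.utri (D.labelX o f c) (D.labelY o f c) ∧
      f (D.after c.1) = Biquandle.otri (D.labelY o f c) (D.labelX o f c))

/-- A state is given by the set `σ` of the crossings that receive the smoothing not respecting the
orientation; the others receive the oriented one. `D.Joined σ a b` says that the smoothing of some
crossing connects an end of the semiarc `a` with an end of the semiarc `b`. -/
def Joined (σ : Finset (ℝ × ℝ)) (a b : D.Semiarc) : Prop :=
  ∃ c ∈ D.crossings,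
    (c ∉ σ ∧ ((a = D.before c.1 ∧ b = D.after c.2) ∨ (a = D.before c.2 ∧ b = D.after c.1))) ∨
    (c ∈ σ ∧ ((a = D.before c.1 ∧ b = D.before c.2) ∨ (a = D.after c.1 ∧ b = D.after c.2)))

/-- The number of components, closed or open-ended, of a state (traces deleted): classes of
semiarcs under the equivalence relation generated by `Joined`. -/
noncomputable def stateComponents (σ : Finset (ℝ × ℝ)) : ℕ := Nat.card (Quot (D.Joined σ))

open Classical in
/-- The coefficient of the crossing `c` in the state `σ`. -/
noncomputable def smoothingCoeff (β : BiquandleBracket X R) (f : D.Semiarc → X)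
    (σ : Finset (ℝ × ℝ)) (c : ℝ × ℝ) : Rˣ :=
  let u : Rˣ := if c ∈ σ then β.B (D.labelX o f c) (D.labelY o f c)
    else β.A (D.labelX o f c) (D.labelY o f c)
  if D.IsPositive o c then u else u⁻¹

open Classical in
/-- The value `β(f)` of the bracket on the colored diagram. -/
noncomputable def bracketValue (β : BiquandleBracket X R) (f : D.Semiarc → X) : R :=
  ∑ σ ∈ D.crossings.powerset,
    ((∏ c ∈ D.crossings, D.smoothingCoeff o β f σ c : Rˣ) : R) * β.δ ^ D.stateComponents σ *
      ((β.w ^ (((D.crossings.filter fun c => ¬ D.IsPositive o c).card : ℤ)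
        - ((D.crossings.filter fun c => D.IsPositive o c).card : ℤ)) : Rˣ) : R)

open Classical in
/-- The biquandle bracket matrix. Its entries are finite formal sums of powers `u ^ r` with
exponents `r ∈ R`, i.e. elements of the group ring `ℤ[R]` of the additive group of `R`;
`u ^ r` is `single r 1`. -/
noncomputable def bracketMatrix [Fintype X] (β : BiquandleBracket X R) :
    Matrix X X (AddMonoidAlgebra ℤ R) :=
  Matrix.of fun j k =>
    ∑ f : D.Semiarc → X with D.IsColoring o f ∧ f 0 = j ∧ f (Fin.last _) = k,
      AddMonoidAlgebra.single (D.bracketValue o β f) 1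

end KnotoidDiagram

end Surface

/-! ### Equivalence of knotoid diagrams -/

namespace KnotoidDiagram

variable {M : Type*} [TopologicalSpace M] [ChartedSpace (EuclideanSpace ℝ (Fin 2)) M]

/-- `D'` is an orientation-preserving reparametrization of `D`. -/
def Reparametrization (D D' : KnotoidDiagram M) : Prop :=
  ∃ φ : ℝ → ℝ, ContDiffOn ℝ ∞ φ (Icc 0 1) ∧ (∀ t ∈ Icc (0 : ℝ) 1, 0 < derivWithin φ (Icc 0 1) t) ∧
    φ 0 = 0 ∧ φ 1 = 1 ∧ (∀ t ∈ Icc (0 : ℝ) 1, D'.curve t = D.curve (φ t)) ∧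
    ∀ s ∈ Icc (0 : ℝ) 1, ∀ t ∈ Icc (0 : ℝ) 1,
      (s, t) ∈ D'.crossings ↔ (φ s, φ t) ∈ D.crossings

/-- `D'` is the image of `D` under an isotopy of the surface. -/
def Isotopy (D D' : KnotoidDiagram M) : Prop :=
  ∃ F : ℝ → Diffeomorph (𝓡 2) (𝓡 2) M M ∞,
    ContMDiff (𝓘(ℝ, ℝ).prod (𝓡 2)) (𝓡 2) ∞ (fun p : ℝ × M => F p.1 p.2) ∧
    (∀ p, F 0 p = p) ∧ (∀ t ∈ Icc (0 : ℝ) 1, D'.curve t = F 1 (D.curve t)) ∧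
    D'.crossings = D.crossings

/-- The point `p` lies in the local disk which the chart `e` identifies with the square
`[-1,1] × [-1,1]`. -/
def InDisk (e : OpenPartialHomeomorph M (EuclideanSpace ℝ (Fin 2))) (p : M) : Prop :=
  p ∈ e.source ∧ ∀ i, e p i ∈ Icc (-1 : ℝ) 1

/-- `D` and `D'` agree outside the disk given by the chart `e`, which both meet exactly in the `n`
strands with parameters in the disjoint intervals `[a i, b i]`. The disk contains neither the tail
nor the head, since `0 < a i` and `b i < 1`. -/
structure AgreeOutside {n : ℕ} (D D' : KnotoidDiagram M)
    (e : OpenPartialHomeomorph M (EuclideanSpace ℝ (Fin 2))) (a b : Fin n → ℝ) : Prop where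
  chart : e ∈ IsManifold.maximalAtlas (𝓡 2) ∞ M
  square : {v : EuclideanSpace ℝ (Fin 2) | ∀ i, v i ∈ Icc (-1 : ℝ) 1} ⊆ e.target
  interval : ∀ i, 0 < a i ∧ a i < b i ∧ b i < 1
  disjoint : ∀ i j, i ≠ j → Disjoint (Icc (a i) (b i)) (Icc (a j) (b j))
  inDisk_left : ∀ t ∈ Icc (0 : ℝ) 1, InDisk e (D.curve t) ↔ ∃ i, t ∈ Icc (a i) (b i)
  inDisk_right : ∀ t ∈ Icc (0 : ℝ) 1, InDisk e (D'.curve t) ↔ ∃ i, t ∈ Icc (a i) (b i)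
  curve_eq : ∀ t ∈ Icc (0 : ℝ) 1, (∀ i, t ∉ Icc (a i) (b i)) → D.curve t = D'.curve t
  crossings_iff : ∀ c : ℝ × ℝ, (∀ i, c.1 ∉ Icc (a i) (b i)) →
    (c ∈ D.crossings ↔ c ∈ D'.crossings)

/-- In the coordinates of the chart `e`, the strand of `D` with parameters in `[a, b]` runs along
the graph of the smooth function `f : [-1,1] → (-1,1)`, from one vertical side of the square
to the other. -/
structure IsGraph (D : KnotoidDiagram M)
    (e : OpenPartialHomeomorph M (EuclideanSpace ℝ (Fin 2))) (a b : ℝ) (f : ℝ → ℝ) : Prop where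
  smooth : ContDiffOn ℝ ∞ f (Icc (-1) 1)
  mem_Ioo : ∀ x ∈ Icc (-1 : ℝ) 1, f x ∈ Ioo (-1 : ℝ) 1
  graph : ∀ t ∈ Icc a b, e (D.curve t) 1 = f (e (D.curve t) 0)
  direction :
    (StrictMonoOn (fun t => e (D.curve t) 0) (Icc a b) ∧
      e (D.curve a) 0 = -1 ∧ e (D.curve b) 0 = 1) ∨
    (StrictAntiOn (fun t => e (D.curve t) 0) (Icc a b) ∧
      e (D.curve a) 0 = 1 ∧ e (D.curve b) 0 = -1)

/-- First Reidemeister move: inside a disk, an arc without crossings is replaced by an arc with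
exactly one self-crossing (of any kind). -/
def ReidemeisterOne (D D' : KnotoidDiagram M) : Prop :=
  ∃ (e : OpenPartialHomeomorph M (EuclideanSpace ℝ (Fin 2))) (a b : Fin 1 → ℝ) (f : ℝ → ℝ),
    AgreeOutside D D' e a b ∧ IsGraph D e (a 0) (b 0) f ∧
    (∀ t ∈ Ioo (a 0) (b 0), ∀ i, e (D'.curve t) i ∈ Ioo (-1 : ℝ) 1) ∧
    ∃! c, c ∈ D'.crossings ∧ c.1 ∈ Icc (a 0) (b 0)

/-- Second Reidemeister move: inside a disk, two disjoint arcs are replaced by two arcs that cross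
exactly twice, arc `0` being over arc `1` both times. -/
def ReidemeisterTwo (D D' : KnotoidDiagram M) : Prop :=
  ∃ (e : OpenPartialHomeomorph M (EuclideanSpace ℝ (Fin 2))) (a b : Fin 2 → ℝ)
    (f f' : Fin 2 → ℝ → ℝ),
    AgreeOutside D D' e a b ∧
    (∀ i, IsGraph D e (a i) (b i) (f i)) ∧ (∀ i, IsGraph D' e (a i) (b i) (f' i)) ∧
    (∀ x ∈ Icc (-1 : ℝ) 1, f 0 x ≠ f 1 x) ∧
    {x | x ∈ Icc (-1 : ℝ) 1 ∧ f' 0 x = f' 1 x}.ncard = 2 ∧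
    ∀ c ∈ D'.crossings, ¬ (c.1 ∈ Icc (a 1) (b 1) ∧ c.2 ∈ Icc (a 0) (b 0))

/-- Third Reidemeister move: inside a disk, three arcs at three different levels (arc `0` on top,
arc `1` in the middle, arc `2` at the bottom), any two of which cross exactly once, are replaced by
three arcs of the same kind which meet each other in the opposite order; `p i j` and `p' i j` are
the horizontal coordinates of the crossing of the arcs `i` and `j` before and after the move. -/
def ReidemeisterThree (D D' : KnotoidDiagram M) : Prop :=
  ∃ (e : OpenPartialHomeomorph M (EuclideanSpace ℝ (Fin 2))) (a b : Fin 3 → ℝ)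
    (f f' : Fin 3 → ℝ → ℝ) (p p' : Fin 3 → Fin 3 → ℝ),
    AgreeOutside D D' e a b ∧
    (∀ i, IsGraph D e (a i) (b i) (f i)) ∧ (∀ i, IsGraph D' e (a i) (b i) (f' i)) ∧
    (∀ i j, i ≠ j → {x | x ∈ Icc (-1 : ℝ) 1 ∧ f i x = f j x} = {p i j}) ∧
    (∀ i j, i ≠ j → {x | x ∈ Icc (-1 : ℝ) 1 ∧ f' i x = f' j x} = {p' i j}) ∧
    (∀ i j k, i ≠ j → j ≠ k → i ≠ k → (p i j < p i k ↔ p' i k < p' i j)) ∧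
    (∀ i j, i < j →
      ∀ c ∈ D.crossings, ¬ (c.1 ∈ Icc (a j) (b j) ∧ c.2 ∈ Icc (a i) (b i))) ∧
    (∀ i j, i < j →
      ∀ c ∈ D'.crossings, ¬ (c.1 ∈ Icc (a j) (b j) ∧ c.2 ∈ Icc (a i) (b i)))

/-- One elementary step between knotoid diagrams. -/
def Step (D D' : KnotoidDiagram M) : Prop :=
  Reparametrization D D' ∨ Isotopy D D' ∨
    ReidemeisterOne D D' ∨ ReidemeisterTwo D D' ∨ ReidemeisterThree D D'

/-- Two knotoid diagrams are equivalent if they are related by a finite sequence of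
reparametrizations, isotopies of the surface, and Reidemeister moves (in either direction) in local
disks free of endpoints. -/
def Equivalent : KnotoidDiagram M → KnotoidDiagram M → Prop := Relation.EqvGen Step

end KnotoidDiagram

/-! The matrix depends only on combinatorial data: which semiarcs meet at each crossing, on which
side of it, and with which sign. These data form a `Circuit`; a state becomes an equivalence
relation on the semiarcs, and the exponent of `δ` is its number of classes. Trivial junctions may be
inserted freely (`Circuit.matrix_eq_of_collapse`), so diagrams with different numbers of passages
can be compared over one common set of semiarcs.

Reparametrizations and isotopies do not change the circuit. The only point is the sign of a
crossing: a reparametrization multiplies velocities by positive numbers, and along an isotopy the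
orientation sign of a continuous family of local frames is constant
(`SurfaceOrientation.sign_mul_det_pos_iff`).

In a Reidemeister move both diagrams are the same outer circuit with a hole, filled in two ways. The
pieces inside the hole touch nothing outside. Hence a coloring of the other pieces extends into the
hole uniquely, if at all, and equally well on both sides (`Circuit.matrix_eq_of_agree`), and the
state sum factors, for each outer state, through a local sum over the crossings in the hole
(`Circuit.value_add`). Only local sums remain to be compared.

For the first move, the diagonal map `x ↦ utri x x` is bijective on a finite biquandle, so the two
ends of a kink have equal colors, and `A * δ + B = w` removes the kink (`Circuit.signed_kink`). For
the second move, the two crossings have inverse weights; the loop of one state cancels against the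
two mixed states, and the last state runs straight through.

For the third move, the colors near the triangle are the edges of a cube spanned by three elements
`x`, `y`, `z`, and the triangles before and after the move sit at opposite corners
(`hexagon_colored_iff`). The eight states realize the five noncrossing pairings of the six boundary
points, whose coefficients have to agree. The bracket axioms give this for one arrangement of the
strands only. All other orientations follow by passing to the ratios `B / A` (`ratio_id`,
`hexagon_identities`).

The geometric part reads signs off a chart: the sign of a crossing of two graphs is that of the
difference of slopes, up to the directions and one constant of the chart. Two consecutive zeros have
opposite slopes (second move), and for curves crossing once the slope is governed by their order at
the left edge, which the third move does not change. -/

/-! ### Counting classes of setoids generated by pairs -/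

namespace Setoid

variable {E : Type*}

/-- The smallest setoid relating `a` and `b`. -/
def pair (a b : E) : Setoid E := Relation.EqvGen.setoid fun x y => x = a ∧ y = b

theorem eqvGen_le_iff {r : E → E → Prop} {s : Setoid E} :
    Relation.EqvGen.setoid r ≤ s ↔ ∀ a b, r a b → s a b := by
  constructor
  · intro h a b hab
    exact h (Relation.EqvGen.rel a b hab)
  · intro h a b hab
    exact Setoid.eqvGen_le h hab

theorem pair_le_iff {a b : E} {s : Setoid E} : pair a b ≤ s ↔ s a b := by
  unfold pair
  rw [eqvGen_le_iff]
  constructor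
  · intro h
    exact h a b ⟨rfl, rfl⟩
  · rintro h x y ⟨rfl, rfl⟩
    exact h

theorem pair_le_iff_mk {a b : E} {s : Setoid E} :
    pair a b ≤ s ↔ Quotient.mk s a = Quotient.mk s b := by
  rw [pair_le_iff, Quotient.eq]

/-- The number of classes. -/
noncomputable def numClasses (s : Setoid E) : ℕ := Nat.card (Quotient s)

/-- `m` is only related to itself. -/
def Isolated (m : E) (s : Setoid E) : Prop := ∀ a, s m a → a = m

/-- Isolation of `m` means refining the partition into `m` and everything else, and refinements of a
fixed partition are closed under joins. -/
theorem Isolated.sup {m : E} {s t : Setoid E} (hs : Isolated m s) (ht : Isolated m t) :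
    Isolated m (s ⊔ t) := by
  classical
  let u : Setoid E := Setoid.ker fun x => x = m
  have hle : ∀ {r : Setoid E}, Isolated m r → r ≤ u := by
    intro r hr x y hxy
    rw [Setoid.ker_def]
    by_cases hx : x = m
    · subst hx
      simp [hr _ hxy]
    · by_cases hy : y = m
      · subst hy
        exact absurd (hr _ (r.symm hxy)) hx
      · simp [hx, hy]
  intro a ha
  have h : u m a := sup_le (hle hs) (hle ht) ha
  rw [Setoid.ker_def] at h
  simpa using h

theorem Isolated.of_forall {m : E} {s : Setoid E} {r : E → E → Prop}
    (hs : s = Relation.EqvGen.setoid r) (h : ∀ a b, r a b → a ≠ m ∧ b ≠ m) : Isolated m s := by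
  subst hs
  have hle : Relation.EqvGen.setoid r ≤ Setoid.ker fun x => x = m := by
    rw [eqvGen_le_iff]
    intro a b hab
    rw [Setoid.ker_def]
    simp [h a b hab]
  intro a ha
  have h := hle ha
  rw [Setoid.ker_def] at h
  simpa using h

theorem Isolated.iSup {ι : Sort*} {m : E} {s : ι → Setoid E} (h : ∀ i, Isolated m (s i)) :
    Isolated m (⨆ i, s i) := by
  have hle : (⨆ i, s i) ≤ Setoid.ker fun x => x = m := by
    refine iSup_le fun i x y hxy => ?_
    rw [Setoid.ker_def]
    by_cases hx : x = m
    · subst hx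
      simp [h i _ hxy]
    · by_cases hy : y = m
      · subst hy
        exact absurd (h i _ ((s i).symm hxy)) hx
      · simp [hx, hy]
  intro a ha
  have h := hle ha
  rw [Setoid.ker_def] at h
  simpa using h

theorem isolated_pair {m a b : E} (ha : m ≠ a) (hb : m ≠ b) : Isolated m (pair a b) :=
  Isolated.of_forall rfl (by rintro x y ⟨rfl, rfl⟩; exact ⟨ha.symm, hb.symm⟩)

/-- Since `m` is a class by itself, gluing it to `a` is the same as pulling `s` back along the map
that sends `m` to `a` and fixes the rest. The classes of this pullback are the classes of `s` other
than that of `m`. -/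
theorem numClasses_sup_pair [Finite E] {m a : E} {s : Setoid E} (hs : Isolated m s) (ha : m ≠ a) :
    (s ⊔ pair m a).numClasses + 1 = s.numClasses := by
  classical
  let ρ : E → E := fun x => if x = m then a else x
  have hρ : ∀ x, ρ x ≠ m := by
    intro x
    simp only [ρ]
    split_ifs with h
    · exact ha.symm
    · exact h
  have ht : s ⊔ pair m a = Setoid.comap ρ s := by
    apply le_antisymm
    · refine sup_le ?_ (pair_le_iff.2 ?_)
      · intro x y hxy
        rw [Setoid.comap_rel]
        by_cases hx : x = m
        · subst hx
          rw [hs _ hxy]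
        · by_cases hy : y = m
          · subst hy
            exact absurd (hs _ (s.symm hxy)) hx
          · simpa [ρ, hx, hy] using hxy
      · rw [Setoid.comap_rel]
        simp [ρ]
    · intro x y hxy
      rw [Setoid.comap_rel] at hxy
      have key : ∀ z, (s ⊔ pair m a) z (ρ z) := by
        intro z
        simp only [ρ]
        split_ifs with h
        · subst h
          exact pair_le_iff.1 le_sup_right
        · exact Setoid.refl' _ _
      exact Setoid.trans' _ (key x) (Setoid.trans' _ ((le_sup_left : s ≤ s ⊔ pair m a) hxy)
        (Setoid.symm' _ (key y)))
  rw [ht]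
  have e : Quotient (Setoid.comap ρ s) ≃ {q : Quotient s // q ≠ Quotient.mk s m} := by
    refine Equiv.ofBijective (fun q => Quotient.liftOn' q
      (fun x => ⟨Quotient.mk s (ρ x), fun h => hρ x (hs _ (s.symm (Quotient.exact h)))⟩)
      (fun x y hxy => ?_)) ⟨?_, ?_⟩
    · exact Subtype.ext (Quotient.sound hxy)
    · intro q q'
      refine Quotient.inductionOn₂' q q' fun x y h => ?_
      exact Quotient.sound (s := Setoid.comap ρ s) (Quotient.exact (s := s) (congrArg Subtype.val h))
    · rintro ⟨q, hq⟩
      revert hq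
      refine Quotient.inductionOn q fun x hx => ⟨Quotient.mk _ x, Subtype.ext ?_⟩
      have hxm : x ≠ m := fun h => hx (by rw [h])
      change Quotient.mk s (ρ x) = _
      simp [ρ, hxm]
  unfold numClasses
  rw [Nat.card_congr e]
  have := Fintype.ofFinite (Quotient s)
  rw [Nat.card_eq_fintype_card, Nat.card_eq_fintype_card, Fintype.card_subtype_compl,
    Fintype.card_subtype_eq]
  -- The complement is counted by a truncated difference, so at least one class has to be exhibited.
  have : 0 < Fintype.card (Quotient s) := Fintype.card_pos_iff.2 ⟨Quotient.mk s m⟩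
  omega

theorem numClasses_eq_of_surjective {E' : Type*} {s' : Setoid E'} {s : Setoid E} (κ : E' → E)
    (hκ : Function.Surjective κ) (h : ∀ a b, s' a b ↔ s (κ a) (κ b)) : s'.numClasses = s.numClasses := by
  refine Nat.card_congr (Equiv.ofBijective (Quotient.map' κ fun a b hab => (h a b).1 hab) ⟨?_, ?_⟩)
  · intro q q'
    refine Quotient.inductionOn₂' q q' fun x y hxy => ?_
    exact Quotient.sound ((h x y).2 (Quotient.exact hxy))
  · intro q
    refine Quotient.inductionOn' q fun y => ?_
    obtain ⟨x, rfl⟩ := hκ y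
    exact ⟨Quotient.mk _ x, rfl⟩

theorem card_quot (r : E → E → Prop) :
    Nat.card (Quot r) = (Relation.EqvGen.setoid r).numClasses := by
  refine Nat.card_congr (Equiv.ofBijective (Quot.map id fun a b h => Relation.EqvGen.rel a b h)
    ⟨?_, ?_⟩)
  · intro q q'
    refine Quot.induction_on₂ q q' fun x y hxy => ?_
    exact Quot.eqvGen_sound (Quotient.exact (s := Relation.EqvGen.setoid r) hxy)
  · intro q
    refine Quotient.inductionOn' q fun y => ⟨Quot.mk _ y, rfl⟩

end Setoid

/-! ### Abstract circuits with crossings -/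

/-- A crossing with the under- and over-semiarcs to its right (`ru`, `ro`) and to its left
(`lu`, `lo`), drawn with both strands pointing upwards. -/
@[ext]
structure Xing (E : Type*) where
  ru : E
  ro : E
  lu : E
  lo : E
  pos : Bool

namespace Xing

variable {E E' X R : Type*} [Biquandle X] [CommRing R]

def map (κ : E → E') (c : Xing E) : Xing E' := ⟨κ c.ru, κ c.ro, κ c.lu, κ c.lo, c.pos⟩

/-- The oriented smoothing is `smoothing false`. -/
def smoothing (c : Xing E) : Bool → Setoid E
  | false => Setoid.pair c.ru c.ro ⊔ Setoid.pair c.lu c.lo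
  | true => Setoid.pair c.ru c.lo ⊔ Setoid.pair c.ro c.lu

/-- The rule ignores the sign because the semiarcs are named by their side and not by their
direction. -/
def Colored (c : Xing E) (f : E → X) : Prop :=
  f c.lu = Biquandle.utri (f c.ru) (f c.ro) ∧ f c.lo = Biquandle.otri (f c.ro) (f c.ru)

/-- The coefficient of a smoothing, including the contribution of the crossing to the writhe
factor. -/
def weight (β : BiquandleBracket X R) (f : E → X) (c : Xing E) (b : Bool) : Rˣ :=
  let u : Rˣ := if b then β.B (f c.ru) (f c.ro) else β.A (f c.ru) (f c.ro)
  if c.pos then u * β.w⁻¹ else u⁻¹ * β.w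

theorem isolated_smoothing {c : Xing E} {m : E} (h : m ≠ c.ru ∧ m ≠ c.ro ∧ m ≠ c.lu ∧ m ≠ c.lo)
    (b : Bool) : Setoid.Isolated m (c.smoothing b) := by
  obtain ⟨h1, h2, h3, h4⟩ := h
  cases b
  · exact (Setoid.isolated_pair h1 h2).sup (Setoid.isolated_pair h3 h4)
  · exact (Setoid.isolated_pair h1 h4).sup (Setoid.isolated_pair h2 h3)

end Xing

/-- Semiarcs `E` and crossings `C`; `bond` relates consecutive semiarcs separated by a trivial
junction. -/
@[ext]
structure Circuit (E C : Type*) where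
  cr : C → Xing E
  bond : E → E → Prop
  tail : E
  head : E

namespace Circuit

variable {E E' C C' X R : Type*} [Biquandle X] [CommRing R]

def IsColoring (G : Circuit E C) (f : E → X) : Prop :=
  (∀ c, (G.cr c).Colored f) ∧ ∀ a b, G.bond a b → f a = f b

def stateSetoid (G : Circuit E C) (σ : C → Bool) : Setoid E :=
  Relation.EqvGen.setoid G.bond ⊔ ⨆ c, (G.cr c).smoothing (σ c)

/-- The writhe factor is spread over the crossings inside `weight`; this makes the value
multiplicative when crossings are added. -/
noncomputable def value [Fintype C] [DecidableEq C] (β : BiquandleBracket X R)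
    (G : Circuit E C) (f : E → X) : R :=
  ∑ σ : C → Bool, ((∏ c, (G.cr c).weight β f (σ c) : Rˣ) : R) * β.δ ^ (G.stateSetoid σ).numClasses

open Classical in
noncomputable def matrix [Fintype E] [Fintype C] [DecidableEq C] [Fintype X] (β : BiquandleBracket X R)
    (G : Circuit E C) : Matrix X X (AddMonoidAlgebra ℤ R) :=
  Matrix.of fun j k =>
    ∑ f : E → X with G.IsColoring f ∧ f G.tail = j ∧ f G.head = k,
      AddMonoidAlgebra.single (G.value β f) 1

/-- Matrices agree if colorings and values correspond. -/
theorem matrix_eq_of_bij [Fintype E] [Fintype C] [DecidableEq C] [Fintype E']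
    [Fintype C'] [DecidableEq C'] [Fintype X]
    (β : BiquandleBracket X R) {G : Circuit E C} {G' : Circuit E' C'} (T : (E → X) → (E' → X))
    (hT : ∀ f, G.IsColoring f → G'.IsColoring (T f) ∧ T f G'.tail = f G.tail ∧
      T f G'.head = f G.head ∧ G'.value β (T f) = G.value β f)
    (hinj : ∀ f g, G.IsColoring f → G.IsColoring g → T f = T g → f = g)
    (hsurj : ∀ f', G'.IsColoring f' → ∃ f, G.IsColoring f ∧ T f = f') :
    G.matrix β = G'.matrix β := by
  classical
  ext1 j k
  simp only [matrix, Matrix.of_apply]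
  refine Finset.sum_bij (fun f _ => T f) ?_ ?_ ?_ ?_
  · intro f hf
    simp only [Finset.mem_filter, Finset.mem_univ, true_and] at hf ⊢
    obtain ⟨h1, h2, h3, -⟩ := hT f hf.1
    exact ⟨h1, h2.trans hf.2.1, h3.trans hf.2.2⟩
  · intro f hf g hg h
    simp only [Finset.mem_filter, Finset.mem_univ, true_and] at hf hg
    exact hinj f g hf.1 hg.1 h
  · intro f' hf'
    simp only [Finset.mem_filter, Finset.mem_univ, true_and] at hf'
    obtain ⟨f, hf, rfl⟩ := hsurj f' hf'.1
    obtain ⟨-, h2, h3, -⟩ := hT f hf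
    refine ⟨f, ?_, rfl⟩
    simp only [Finset.mem_filter, Finset.mem_univ, true_and]
    exact ⟨hf, h2.symm.trans hf'.2.1, h3.symm.trans hf'.2.2⟩
  · intro f hf
    simp only [Finset.mem_filter, Finset.mem_univ, true_and] at hf
    rw [(hT f hf.1).2.2.2]

/-- Matrices agree if colorings off a set of semiarcs extend uniquely on both sides. -/
theorem matrix_eq_of_agree [Fintype E] [Fintype C] [DecidableEq C]
    [Fintype C'] [DecidableEq C'] [Fintype X]
    (β : BiquandleBracket X R) {G : Circuit E C} {G' : Circuit E C'} (m : Set E)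
    (ht : G'.tail = G.tail) (hh : G'.head = G.head) (htm : G.tail ∉ m) (hhm : G.head ∉ m)
    (hex : ∀ f : E → X, G.IsColoring f → ∃ f' : E → X, (∀ e, e ∉ m → f' e = f e) ∧
      G'.IsColoring f')
    (hex' : ∀ f' : E → X, G'.IsColoring f' → ∃ f : E → X, (∀ e, e ∉ m → f e = f' e) ∧
      G.IsColoring f)
    (huniq : ∀ f g : E → X, G.IsColoring f → G.IsColoring g → (∀ e, e ∉ m → f e = g e) → f = g)
    (huniq' : ∀ f g : E → X, G'.IsColoring f → G'.IsColoring g → (∀ e, e ∉ m → f e = g e) → f = g)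
    (hval : ∀ f f' : E → X, G.IsColoring f → G'.IsColoring f' → (∀ e, e ∉ m → f' e = f e) →
      G'.value β f' = G.value β f) :
    G.matrix β = G'.matrix β := by
  classical
  choose T hT using hex
  -- Uniqueness on both sides turns the chosen extensions into a bijection. The default value off
  -- the colorings plays no role.
  refine matrix_eq_of_bij β (fun f => if h : G.IsColoring f then T f h else f) ?_ ?_ ?_
  · intro f hf
    simp only [dif_pos hf]
    refine ⟨(hT f hf).2, ?_, ?_, hval _ _ hf (hT f hf).2 (hT f hf).1⟩
    · rw [ht, (hT f hf).1 _ htm]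
    · rw [hh, (hT f hf).1 _ hhm]
  · intro f g hf hg h
    simp only [dif_pos hf, dif_pos hg] at h
    refine huniq f g hf hg fun e he => ?_
    rw [← (hT f hf).1 e he, ← (hT g hg).1 e he, h]
  · intro f' hf'
    obtain ⟨f, hff, hf⟩ := hex' f' hf'
    refine ⟨f, hf, ?_⟩
    simp only [dif_pos hf]
    refine huniq' _ _ (hT f hf).2 hf' fun e he => ?_
    rw [(hT f hf).1 e he, hff e he]

/-- The kernel of `κ` is generated by the bonds and so lies in every state setoid of `G'`. Each of
these is therefore the pullback of the corresponding state setoid of `G` and has equally many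
classes. -/
theorem value_eq_of_collapse [Fintype C] [DecidableEq C] [Fintype C'] [DecidableEq C']
    (β : BiquandleBracket X R)
    {G' : Circuit E' C'} {G : Circuit E C} (κ : E' → E) (hκ : Function.Surjective κ) (e : C' ≃ C)
    (hcr : ∀ c, G.cr (e c) = (G'.cr c).map κ) (hb : ∀ a b, ¬ G.bond a b)
    (hker : ∀ a b, κ a = κ b ↔ Relation.EqvGen G'.bond a b) (f : E → X) :
    G'.value β (f ∘ κ) = G.value β f := by
  unfold value
  refine Fintype.sum_equiv (e.arrowCongr (Equiv.refl Bool)) _ _ fun σ => ?_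
  have hw : ∏ c, (G'.cr c).weight β (f ∘ κ) (σ c)
      = ∏ c, (G.cr c).weight β f ((e.arrowCongr (Equiv.refl Bool)) σ c) := by
    refine Fintype.prod_equiv e _ _ fun c => ?_
    rw [hcr]
    simp [Xing.weight, Xing.map]
  rw [hw]
  congr 2
  refine Setoid.numClasses_eq_of_surjective κ hκ ?_
  have hsm : ∀ c b, (G'.cr c).smoothing b ≤ Setoid.comap κ ((G.cr (e c)).smoothing b) := by
    intro c b
    rw [hcr]
    cases b <;> refine sup_le ?_ ?_ <;> rw [Setoid.pair_le_iff, Setoid.comap_rel]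
    · exact Setoid.pair_le_iff.1 le_sup_left
    · exact Setoid.pair_le_iff.1 le_sup_right
    · exact Setoid.pair_le_iff.1 le_sup_left
    · exact Setoid.pair_le_iff.1 le_sup_right
  intro a b
  constructor
  · intro h
    have hle : G'.stateSetoid σ ≤
        Setoid.comap κ (G.stateSetoid ((e.arrowCongr (Equiv.refl Bool)) σ)) := by
      refine sup_le ?_ (iSup_le fun c => ?_)
      · rw [Setoid.eqvGen_le_iff]
        intro a b hab
        rw [Setoid.comap_rel, (hker a b).2 (Relation.EqvGen.rel a b hab)]
      · refine (hsm c _).trans ?_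
        intro x y hxy
        rw [Setoid.comap_rel] at hxy ⊢
        have hc : (G.cr (e c)).smoothing (σ c)
            ≤ G.stateSetoid ((e.arrowCongr (Equiv.refl Bool)) σ) := by
          refine le_sup_of_le_right (le_iSup_of_le (e c) ?_)
          simp
        exact hc hxy
    exact hle h
  · intro h
    have hkle : Setoid.ker κ ≤ G'.stateSetoid σ := by
      intro x y hxy
      exact (le_sup_left : _ ≤ G'.stateSetoid σ) ((hker x y).1 hxy)
    -- For the converse inclusion the state setoid of `G'` is pushed forward, which is possible
    -- because it contains the kernel.
    have hle : G.stateSetoid ((e.arrowCongr (Equiv.refl Bool)) σ)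
        ≤ Setoid.mapOfSurjective (G'.stateSetoid σ) κ hkle hκ := by
      have hpair : ∀ x y, G'.stateSetoid σ x y →
          Setoid.pair (κ x) (κ y) ≤ Setoid.mapOfSurjective (G'.stateSetoid σ) κ hkle hκ := by
        intro x y hxy
        rw [Setoid.pair_le_iff]
        exact ⟨x, y, hxy, rfl, rfl⟩
      refine sup_le ?_ (iSup_le fun c => ?_)
      · rw [Setoid.eqvGen_le_iff]
        intro a b hab
        exact absurd hab (hb a b)
      · obtain ⟨c, rfl⟩ := e.surjective c
        rw [hcr]
        have hle' : (G'.cr c).smoothing (σ c) ≤ G'.stateSetoid σ :=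
          le_sup_of_le_right (le_iSup (fun c => (G'.cr c).smoothing (σ c)) c)
        simp only [Equiv.arrowCongr_apply, Equiv.coe_refl, Function.comp_apply,
          Equiv.symm_apply_apply, id]
        cases hσ : σ c <;> rw [hσ] at hle' <;> refine sup_le ?_ ?_ <;> refine hpair _ _ (hle' ?_)
        · exact Setoid.pair_le_iff.1 le_sup_left
        · exact Setoid.pair_le_iff.1 le_sup_right
        · exact Setoid.pair_le_iff.1 le_sup_left
        · exact Setoid.pair_le_iff.1 le_sup_right
    obtain ⟨x, y, hxy, hx, hy⟩ := hle h
    exact Setoid.trans' _ (hkle hx.symm) (Setoid.trans' _ hxy (hkle hy))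

/-- Collapsing the trivial junctions does not change the matrix. -/
theorem matrix_eq_of_collapse [Fintype E] [Fintype C] [DecidableEq C] [Fintype E']
    [Fintype C'] [DecidableEq C'] [Fintype X]
    (β : BiquandleBracket X R) {G' : Circuit E' C'} {G : Circuit E C} (κ : E' → E)
    (hκ : Function.Surjective κ) (e : C' ≃ C)
    (hcr : ∀ c, G.cr (e c) = (G'.cr c).map κ) (hb : ∀ a b, ¬ G.bond a b)
    (hker : ∀ a b, κ a = κ b ↔ Relation.EqvGen G'.bond a b)
    (ht : κ G'.tail = G.tail) (hh : κ G'.head = G.head) : G.matrix β = G'.matrix β := by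
  refine matrix_eq_of_bij β (fun f => f ∘ κ) ?_ ?_ ?_
  · intro f hf
    refine ⟨⟨fun c => ?_, fun a b hab => ?_⟩, ?_, ?_, value_eq_of_collapse β κ hκ e hcr hb hker f⟩
    · have h := hf.1 (e c)
      rw [hcr] at h
      exact h
    · exact congrArg f ((hker a b).2 (Relation.EqvGen.rel a b hab))
    · exact congrArg f ht
    · exact congrArg f hh
  · intro f g _ _ h
    exact hκ.injective_comp_right h
  · intro f' hf'
    have hk : ∀ a b, κ a = κ b → f' a = f' b := by
      intro a b hab
      have hle : Relation.EqvGen.setoid G'.bond ≤ Setoid.ker f' :=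
        Setoid.eqvGen_le_iff.2 fun a b hab => hf'.2 a b hab
      exact hle ((hker a b).1 hab)
    have hs : ∀ a, f' (Function.surjInv hκ (κ a)) = f' a := fun a =>
      hk _ _ (Function.surjInv_eq hκ (κ a))
    refine ⟨f' ∘ Function.surjInv hκ, ⟨fun c => ?_, fun a b hab => absurd hab (hb a b)⟩, ?_⟩
    · obtain ⟨c, rfl⟩ := e.surjective c
      have h := hf'.1 c
      rw [hcr]
      simpa [Xing.Colored, Xing.map, hs] using h
    · ext a
      exact hs a

/-- Adding a family of crossings. -/
def add {ι : Type*} (G : Circuit E C) (L : ι → Xing E) : Circuit E (C ⊕ ι) :=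
  ⟨Sum.elim G.cr L, G.bond, G.tail, G.head⟩

/-- Adding trivial junctions. -/
def addBond (G : Circuit E C) (r : E → E → Prop) : Circuit E C :=
  ⟨G.cr, fun a b => G.bond a b ∨ r a b, G.tail, G.head⟩

/-- `m` touches no crossing and no junction, and is neither the first nor the last semiarc. -/
def Avoids (G : Circuit E C) (m : E) : Prop :=
  (∀ c, m ≠ (G.cr c).ru ∧ m ≠ (G.cr c).ro ∧ m ≠ (G.cr c).lu ∧ m ≠ (G.cr c).lo) ∧
    (∀ a b, G.bond a b → a ≠ m ∧ b ≠ m) ∧ G.tail ≠ m ∧ G.head ≠ m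

theorem Avoids.isolated {G : Circuit E C} {m : E} (h : G.Avoids m) (σ : C → Bool) :
    Setoid.Isolated m (G.stateSetoid σ) :=
  (Setoid.Isolated.of_forall rfl h.2.1).sup
    (Setoid.Isolated.iSup fun c => Xing.isolated_smoothing (h.1 c) _)

theorem IsColoring.congr {G : Circuit E C} {m : Set E} (hm : ∀ e ∈ m, G.Avoids e) {f g : E → X}
    (hf : G.IsColoring f) (h : ∀ e, e ∉ m → g e = f e) : G.IsColoring g := by
  constructor
  · intro c
    have h1 := h (G.cr c).ru fun he => ((hm _ he).1 c).1 rfl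
    have h2 := h (G.cr c).ro fun he => ((hm _ he).1 c).2.1 rfl
    have h3 := h (G.cr c).lu fun he => ((hm _ he).1 c).2.2.1 rfl
    have h4 := h (G.cr c).lo fun he => ((hm _ he).1 c).2.2.2 rfl
    have := hf.1 c
    simpa only [Xing.Colored, h1, h2, h3, h4] using this
  · intro a b hab
    rw [h a fun he => ((hm _ he).2.1 a b hab).1 rfl, h b fun he => ((hm _ he).2.1 a b hab).2 rfl]
    exact hf.2 a b hab

theorem weight_congr {G : Circuit E C} {m : Set E} (hm : ∀ e ∈ m, G.Avoids e) {f g : E → X}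
    (β : BiquandleBracket X R) (h : ∀ e, e ∉ m → g e = f e) (c : C) (b : Bool) :
    (G.cr c).weight β g b = (G.cr c).weight β f b := by
  have h1 := h (G.cr c).ru fun he => ((hm _ he).1 c).1 rfl
  have h2 := h (G.cr c).ro fun he => ((hm _ he).1 c).2.1 rfl
  simp only [Xing.weight, h1, h2]

/-- The state sum of a family of crossings over a base setoid. -/
noncomputable def localSum {ι : Type*} [Fintype ι] [DecidableEq ι] (β : BiquandleBracket X R)
    (L : ι → Xing E) (f : E → X) (s : Setoid E) : R :=
  ∑ σ : ι → Bool, ((∏ i, (L i).weight β f (σ i) : Rˣ) : R) *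
    β.δ ^ (s ⊔ ⨆ i, (L i).smoothing (σ i)).numClasses

/-- A state of the enlarged circuit is a pair of states, weights multiply, and state setoids are
joined. A local move thus reduces to comparing `localSum` over each outer setoid. -/
theorem value_add {ι : Type*} [Fintype ι] [DecidableEq ι] [Fintype C] [DecidableEq C]
    (β : BiquandleBracket X R) (G : Circuit E C) (L : ι → Xing E) (f : E → X) :
    (G.add L).value β f = ∑ σ : C → Bool, ((∏ c, (G.cr c).weight β f (σ c) : Rˣ) : R) *
      localSum β L f (G.stateSetoid σ) := by
  unfold value
  rw [Fintype.sum_equiv (Equiv.sumArrowEquivProdArrow C ι Bool) _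
    (fun p : (C → Bool) × (ι → Bool) => ((∏ c, (G.cr c).weight β f (p.1 c) : Rˣ) : R) *
      (((∏ i, (L i).weight β f (p.2 i) : Rˣ) : R) *
    β.δ ^ (G.stateSetoid p.1 ⊔ ⨆ i, (L i).smoothing (p.2 i)).numClasses))]
  · rw [Fintype.sum_prod_type]
    refine Finset.sum_congr rfl fun σ _ => ?_
    rw [localSum, Finset.mul_sum]
  · intro σ
    rw [Fintype.prod_sum_type, Units.val_mul, mul_assoc]
    congr 3
    simp only [stateSetoid, add, iSup_sum, Sum.elim_inl, Sum.elim_inr, sup_assoc]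
    rfl

theorem value_addBond [Fintype C] [DecidableEq C]
    (β : BiquandleBracket X R) (G : Circuit E C) (r : E → E → Prop) (f : E → X) :
    (G.addBond r).value β f = ∑ σ : C → Bool, ((∏ c, (G.cr c).weight β f (σ c) : Rˣ) : R) *
      β.δ ^ (G.stateSetoid σ ⊔ Relation.EqvGen.setoid r).numClasses := by
  unfold value
  refine Finset.sum_congr rfl fun σ _ => ?_
  congr 3
  have h : Relation.EqvGen.setoid (G.addBond r).bond
      = Relation.EqvGen.setoid G.bond ⊔ Relation.EqvGen.setoid r := by
    apply le_antisymm
    · rw [Setoid.eqvGen_le_iff]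
      rintro a b (hab | hab)
      · exact (le_sup_left : _ ≤ _ ⊔ Relation.EqvGen.setoid r) (Relation.EqvGen.rel a b hab)
      · exact (le_sup_right : _ ≤ Relation.EqvGen.setoid G.bond ⊔ _) (Relation.EqvGen.rel a b hab)
    · refine sup_le ?_ ?_ <;> rw [Setoid.eqvGen_le_iff] <;> intro a b hab
      · exact Relation.EqvGen.rel a b (Or.inl hab)
      · exact Relation.EqvGen.rel a b (Or.inr hab)
  rw [stateSetoid, h, stateSetoid]
  simp only [addBond]
  rw [sup_right_comm]

end Circuit

/-! ### Coefficient identities -/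

/-- The letters `a`, `b`, `c` are the ratios `B / A` at the three crossings before the move, and
`q*a`, `q*b`, `qi*c` those after it. Comparing `e4` with `q` times `e5` gives `(q-1)*δ = 0`, and the
formulas for `δ` then make `q-1` annihilate `a^2+1` and `q+1`. So `q` need not be `1`, but
multiplication by `q-1` kills `2` and identifies `a`, `b`, `c`, which is what disposes of the
correction terms. -/
theorem ratio_facts {R : Type*} [CommRing R] {a ai b bi c ci q qi δ : R}
    (ha : a*ai=1) (hb : b*bi=1) (hc: c*ci=1)
  (hq : q*qi=1) (da : δ = -a-ai) (db : δ = -b-bi) (dc : δ = -c-ci) (da' : δ = -(q*a)-qi*ai)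
  (e4 : c = q*a+q*b+δ*(q*a)*(q*b)+(q*a)*(q*b)*(qi*c)) (e5 : a+b+δ*a*b+a*b*c=qi*c) :
  qi = q ∧ q^2=1 ∧ (q-1)*δ=0 ∧ (q-1)*(a^2+1)=0  ∧ (q-1)*(c-a)=0 ∧ (q-1)*(c-b)=0 ∧
    (q-1)*2=0 ∧ c*(1-q*a*b)=q*a*(1-a*b) ∧ c*(1-q*a*b)=q*b*(1-a*b) := by
  have h1 : (q-1)*δ=0 := by grind
  have h2 : (q-1)*(a^2+1)=0 := by grind
  have h3 : (q-1)*(q+1) = 0 := by grind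
  have h6 : c*(1-q*a*b)=q*a*(1-a*b) := by grind
  have h7 : c*(1-q*a*b)=q*b*(1-a*b) := by grind
  have h4 : (q-1)*(c-a)=0 := by grind
  have h5 : (q-1)*(c-b)=0 := by grind
  have h8 : (q-1)*2=0 := by grind
  have h9 : q^2=1 := by grind
  have h0 : qi = q := by grind
  exact ⟨h0,h9, h1,h2,h4,h5,h8,h6,h7⟩
-- The letters `k` and `l` are the coefficients of the smoothing that cuts off a corner of the
-- triangle and of the other one, divided by the factor coming from `A`. One of the two is therefore
-- `1` and the other a ratio or the inverse of one. Each of the sixteen sign patterns is a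
-- polynomial consequence of `ratio_facts`.
theorem ratio_id {R : Type*} [CommRing R] {a ai b bi c ci q qi δ : R}
    (ha : a*ai=1) (hb : b*bi=1) (hc: c*ci=1)
  (hq : q*qi=1) (da : δ = -a-ai) (db : δ = -b-bi) (dc : δ = -c-ci) (da' : δ = -(q*a)-qi*ai)
  (e4 : c = q*a+q*b+δ*(q*a)*(q*b)+(q*a)*(q*b)*(qi*c)) (e5 : a+b+δ*a*b+a*b*c=qi*c) 
  (u1 u2 u3 s : Bool) (r1 r2 r3 r1' r2' r3' k1 k2 k3 l1 l2 l3 k1' k2' k3' l1' l2' l3' : R)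
  (hr1 : r1 = bif u1 then (bif u1 == s then a else ai) else (bif u1 == s then q*a else qi*ai))
  (hr1' : r1' = bif !u1 then (bif u1 == s then a else ai) else (bif u1 == s then q*a else qi*ai))
  (hr2 : r2 = bif u2 then (bif u2 == s then b else bi) else (bif u2 == s then q*b else qi*bi))
  (hr2' : r2' = bif !u2 then (bif u2 == s then b else bi) else (bif u2 == s then q*b else qi*bi))
  (hr3 : r3 = bif u3 then (bif u3 == s then c else ci) else (bif u3 == s then qi*c else q*ci))
  (hr3' : r3' = bif !u3 then (bif u3 == s then c else ci) else (bif u3 == s then qi*c else q*ci))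
  (hk1 : k1 = bif u2 != u3 then 1 else r1) (hl1 : l1 = bif u2 != u3 then r1 else 1)
  (hk2 : k2 = bif u1 != u3 then 1 else r2) (hl2 : l2 = bif u1 != u3 then r2 else 1)
  (hk3 : k3 = bif u1 == u2 then 1 else r3) (hl3 : l3 = bif u1 == u2 then r3 else 1)
  (hk1' : k1' = bif u2 != u3 then 1 else r1') (hl1' : l1' = bif u2 != u3 then r1' else 1)
  (hk2' : k2' = bif u1 != u3 then 1 else r2') (hl2' : l2' = bif u1 != u3 then r2' else 1)
  (hk3' : k3' = bif u1 == u2 then 1 else r3') (hl3' : l3' = bif u1 == u2 then r3' else 1) :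
  k1*l2*l3=k1'*l2'*l3' ∧ l1*k2*l3=l1'*k2'*l3' ∧ l1*l2*k3=l1'*l2'*k3' ∧ 
   δ*k1*k2*k3+k1*k2*l3+k1*l2*k3+l1*k2*k3 = l1'*l2'*l3' := by
  obtain ⟨h0,h9, h1,h2,h4,h5,h8,h6,h7⟩ := ratio_facts ha hb hc hq da db dc da' e4 e5
  -- The formulas for `δ` express the inverses as polynomials.
  have hai : ai = -a - δ := by linear_combination da
  have hbi : bi = -b - δ := by linear_combination db
  have hci : ci = -c - δ := by linear_combination dc
  subst h0
  clear e4 e5 da db dc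
  cases u1 <;> cases u2 <;> cases u3 <;> cases s <;> 
  simp at hr1 hr1' hr2 hr2' hr3 hr3' hk1 hk2 hk3 hl1 hl2 hl3 hk1' hk2' hk3' hl1' hl2' hl3' <;>
    subst hk1 hk2 hk3 hl1 hl2 hl3 hk1' hk2' hk3' hl1' hl2' hl3'
      hr1 hr1' hr2 hr2' hr3 hr3' <;>
    refine ⟨?_, ?_, ?_, ?_⟩ <;> first | rfl | ring1 | grind

/-- `u` or its inverse, according to a sign. -/
def signed {G : Type*} [Inv G] (ε : Bool) (u : G) : G := bif ε then u else u⁻¹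

/-- The hypothesis determines `A3`; after substitution both sides are the same word in an abelian
group on five letters, for each of the sixteen sign patterns. -/
theorem signed_prod {G : Type*} [CommGroup G] {A1 A2 A3 A1' A2' A3' : G}
    (h : A1 * A2 * A3 = A3' * A2' * A1') (u1 u2 u3 s : Bool) :
    signed (u1 == s) (bif u1 then A1 else A1') * signed (u2 == s) (bif u2 then A2 else A2') *
        signed (u3 == s) (bif u3 then A3 else A3') =
      signed (u1 == s) (bif !u1 then A1 else A1') * signed (u2 == s) (bif !u2 then A2 else A2') *
        signed (u3 == s) (bif !u3 then A3 else A3') := by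
  obtain rfl : A3 = A1⁻¹ * A2⁻¹ * A3' * A2' * A1' := by
    rw [eq_comm]
    calc A1⁻¹ * A2⁻¹ * A3' * A2' * A1' = A1⁻¹ * A2⁻¹ * (A3' * A2' * A1') := by
          simp only [mul_assoc]
      _ = A1⁻¹ * A2⁻¹ * (A1 * A2 * A3) := by rw [h]
      _ = A3 := by rw [mul_comm A1 A2, mul_assoc A2]; simp [mul_assoc]
  cases u1 <;> cases u2 <;> cases u3 <;> cases s <;> simp [signed] <;>
    apply Additive.ofMul.injective <;> simp only [ofMul_mul, ofMul_inv] <;> abel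

/-- The axioms cover one arrangement of the strands; other orientations invert some coefficients and
interchange some of those before the move with those after it. The identities persist because the
contribution of the `A`s is the same on both sides (`signed_prod`), and what is left involves only
the ratios `B / A`, to which `ratio_id` applies. The indices 1, 2, 3 stand for the crossings
bottom–middle, middle–top and bottom–top. -/
theorem hexagon_identities {R : Type*} [CommRing R] {δ : R}
    {A1 A2 A3 B1 B2 B3 A1' A2' A3' B1' B2' B3' : Rˣ}
    (t1 : (A1 * A2 * A3 : R) = A3' * A2' * A1') (t2 : (A1 * B2 * B3 : R) = B3' * B2' * A1')
    (t3 : (B1 * A2 * B3 : R) = B3' * A2' * B1')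
    (t4 : (A1 * A2 * B3 : R) = A3' * B2' * A1' + A3' * A2' * B1' + δ * A3' * B2' * B1'
      + B3' * B2' * B1')
    (t5 : (B1 * A2 * A3 + A1 * B2 * A3 + δ * B1 * B2 * A3 + B1 * B2 * B3 : R) = B3' * A2' * A1')
    (d1 : -((A1 : R) * (B1⁻¹ : Rˣ)) - (A1⁻¹ : Rˣ) * (B1 : R) = δ)
    (d2 : -((A2 : R) * (B2⁻¹ : Rˣ)) - (A2⁻¹ : Rˣ) * (B2 : R) = δ)
    (d3 : -((A3 : R) * (B3⁻¹ : Rˣ)) - (A3⁻¹ : Rˣ) * (B3 : R) = δ)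
    (d1' : -((A1' : R) * (B1'⁻¹ : Rˣ)) - (A1'⁻¹ : Rˣ) * (B1' : R) = δ)
    (u1 u2 u3 s : Bool) {k1 k2 k3 l1 l2 l3 k1' k2' k3' l1' l2' l3' : Rˣ}
    (hk1 : k1 = signed (u1 == s) (bif u1 then bif u2 != u3 then A1 else B1
      else bif u2 != u3 then A1' else B1'))
    (hl1 : l1 = signed (u1 == s) (bif u1 then bif u2 != u3 then B1 else A1
      else bif u2 != u3 then B1' else A1'))
    (hk2 : k2 = signed (u2 == s) (bif u2 then bif u1 != u3 then A2 else B2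
      else bif u1 != u3 then A2' else B2'))
    (hl2 : l2 = signed (u2 == s) (bif u2 then bif u1 != u3 then B2 else A2
      else bif u1 != u3 then B2' else A2'))
    (hk3 : k3 = signed (u3 == s) (bif u3 then bif u1 == u2 then A3 else B3
      else bif u1 == u2 then A3' else B3'))
    (hl3 : l3 = signed (u3 == s) (bif u3 then bif u1 == u2 then B3 else A3
      else bif u1 == u2 then B3' else A3'))
    (hk1' : k1' = signed (u1 == s) (bif !u1 then bif u2 != u3 then A1 else B1
      else bif u2 != u3 then A1' else B1'))
    (hl1' : l1' = signed (u1 == s) (bif !u1 then bif u2 != u3 then B1 else A1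
      else bif u2 != u3 then B1' else A1'))
    (hk2' : k2' = signed (u2 == s) (bif !u2 then bif u1 != u3 then A2 else B2
      else bif u1 != u3 then A2' else B2'))
    (hl2' : l2' = signed (u2 == s) (bif !u2 then bif u1 != u3 then B2 else A2
      else bif u1 != u3 then B2' else A2'))
    (hk3' : k3' = signed (u3 == s) (bif !u3 then bif u1 == u2 then A3 else B3
      else bif u1 == u2 then A3' else B3'))
    (hl3' : l3' = signed (u3 == s) (bif !u3 then bif u1 == u2 then B3 else A3
      else bif u1 == u2 then B3' else A3')) :
    (k1 * l2 * l3 : R) = k1' * l2' * l3' ∧ (l1 * k2 * l3 : R) = l1' * k2' * l3' ∧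
      (l1 * l2 * k3 : R) = l1' * l2' * k3' ∧
      (δ * k1 * k2 * k3 + k1 * k2 * l3 + k1 * l2 * k3 + l1 * k2 * k3 : R) = l1' * l2' * l3' := by
  obtain ⟨a, rfl⟩ : ∃ a, B1 = a * A1 := ⟨B1 * A1⁻¹, by simp⟩
  obtain ⟨b, rfl⟩ : ∃ a, B2 = a * A2 := ⟨B2 * A2⁻¹, by simp⟩
  obtain ⟨c, rfl⟩ : ∃ a, B3 = a * A3 := ⟨B3 * A3⁻¹, by simp⟩
  -- The unit `q` is the change of the ratio at the first crossing. By `t3` the third ratio then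
  -- changes by `q⁻¹`, and by `t2` the second one by `q`.
  obtain ⟨q, rfl⟩ : ∃ q, B1' = q * a * A1' := ⟨B1' * A1'⁻¹ * a⁻¹, by simp⟩
  norm_cast at t1 t2 t3
  have e3 : B3' = q⁻¹ * c * A3' := by
    have h : (q * a * A1' * A2') * B3' = (q * a * A1' * A2') * (q⁻¹ * c * A3') := by
      calc (q * a * A1' * A2') * B3' = B3' * A2' * (q * a * A1') := by
            simp only [mul_comm, mul_left_comm]
        _ = a * c * (A1 * A2 * A3) := by rw [← t3]; simp only [mul_comm, mul_left_comm]
        _ = a * c * (A3' * A2' * A1') * (q * q⁻¹) := by rw [t1]; simp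
        _ = _ := by simp only [mul_assoc, mul_comm, mul_left_comm]
    exact mul_left_cancel h
  subst e3
  have e2 : B2' = q * b * A2' := by
    have h : (q⁻¹ * c * A3' * A1') * B2' = (q⁻¹ * c * A3' * A1') * (q * b * A2') := by
      calc (q⁻¹ * c * A3' * A1') * B2' = q⁻¹ * c * A3' * B2' * A1' := by
            simp only [mul_comm, mul_left_comm]
        _ = b * c * (A1 * A2 * A3) := by rw [← t2]; simp only [mul_comm, mul_left_comm]
        _ = b * c * (A3' * A2' * A1') * (q * q⁻¹) := by rw [t1]; simp
        _ = _ := by simp only [mul_assoc, mul_comm, mul_left_comm]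
    exact mul_left_cancel h
  subst e2
  have t1R : (A1 * A2 * A3 : R) = A3' * A2' * A1' := by exact_mod_cast congrArg Units.val t1
  have v : ∀ u : Rˣ, (u : R) * ((u⁻¹ : Rˣ) : R) = 1 := fun u => by simp
  have ea : δ = -(a : R) - (a⁻¹ : Rˣ) := by
    rw [← d1]; simp only [mul_inv_rev, Units.val_mul]
    linear_combination (-(a⁻¹ : Rˣ) - (a : R)) * v A1
  have eb : δ = -(b : R) - (b⁻¹ : Rˣ) := by
    rw [← d2]; simp only [mul_inv_rev, Units.val_mul]
    linear_combination (-(b⁻¹ : Rˣ) - (b : R)) * v A2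
  have ec : δ = -(c : R) - (c⁻¹ : Rˣ) := by
    rw [← d3]; simp only [mul_inv_rev, Units.val_mul]
    linear_combination (-(c⁻¹ : Rˣ) - (c : R)) * v A3
  have ea' : δ = -((q : R) * a) - (q⁻¹ : Rˣ) * (a⁻¹ : Rˣ) := by
    rw [← d1']; simp only [mul_inv_rev, Units.val_mul]
    linear_combination (-(a⁻¹ : Rˣ) * (q⁻¹ : Rˣ) - (q : R) * a) * v A1'
  -- Cancelling this unit turns `t4` and `t5` into relations between ratios.
  have hK : IsUnit ((A1 * A2 * A3 : R)) := ⟨A1 * A2 * A3, by simp⟩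
  have e4 : (c : R) = q * a + q * b + δ * (q * a) * (q * b)
      + (q * a) * (q * b) * ((q⁻¹ : Rˣ) * c) := by
    apply hK.mul_left_cancel
    push_cast at t4
    linear_combination t4 - ((q : R) * a + q * b + δ * (q * a) * (q * b)
      + (q * a) * (q * b) * ((q⁻¹ : Rˣ) * c)) * t1R
  have e5 : (a : R) + b + δ * a * b + a * b * c = (q⁻¹ : Rˣ) * c := by
    apply hK.mul_left_cancel
    push_cast at t5
    linear_combination t5 - ((q⁻¹ : Rˣ) * c : R) * t1R
  have hP := signed_prod t1 u1 u2 u3 s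
  have hs : ∀ (ε u : Bool) (x y : Rˣ), ((signed ε (bif u then x else y) : Rˣ) : R)
      = bif u then (bif ε then (x : R) else (x⁻¹ : Rˣ)) else
        (bif ε then (y : R) else (y⁻¹ : Rˣ)) := by
    intro ε u x y
    cases u <;> cases ε <;> simp [signed]
  have hk : ∀ (ε u co : Bool) (A A' r r' : Rˣ),
      ((signed ε (bif u then bif co then A else r * A else bif co then A' else r' * A') : Rˣ) : R)
        = ((signed ε (bif u then A else A') : Rˣ) : R)
          * bif co then 1 else ((signed ε (bif u then r else r') : Rˣ) : R) := by
    intro ε u co A A' r r'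
    cases u <;> cases ε <;> cases co <;> simp [signed, mul_comm]
  have hl : ∀ (ε u co : Bool) (A A' r r' : Rˣ),
      ((signed ε (bif u then bif co then r * A else A else bif co then r' * A' else A') : Rˣ) : R)
        = ((signed ε (bif u then A else A') : Rˣ) : R)
          * bif co then ((signed ε (bif u then r else r') : Rˣ) : R) else 1 := by
    intro ε u co A A' r r'
    cases u <;> cases ε <;> cases co <;> simp [signed, mul_comm]
  obtain ⟨m1, m2, m3, m4⟩ := ratio_id (v a) (v b) (v c) (v q) ea eb ec ea' e4 e5 u1 u2 u3 s
    ((signed (u1 == s) (bif u1 then a else q * a) : Rˣ) : R)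
    ((signed (u2 == s) (bif u2 then b else q * b) : Rˣ) : R)
    ((signed (u3 == s) (bif u3 then c else q⁻¹ * c) : Rˣ) : R)
    ((signed (u1 == s) (bif !u1 then a else q * a) : Rˣ) : R)
    ((signed (u2 == s) (bif !u2 then b else q * b) : Rˣ) : R)
    ((signed (u3 == s) (bif !u3 then c else q⁻¹ * c) : Rˣ) : R) _ _ _ _ _ _ _ _ _ _ _ _
    (by rw [hs]; simp [mul_comm]) (by rw [hs]; simp [mul_comm]) (by rw [hs]; simp [mul_comm])
    (by rw [hs]; simp [mul_comm]) (by rw [hs]; simp [mul_comm]) (by rw [hs]; simp [mul_comm])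
    rfl rfl rfl rfl rfl rfl rfl rfl rfl rfl rfl rfl
  simp only [hk1, hk2, hk3, hl1, hl2, hl3, hk1', hk2', hk3', hl1', hl2', hl3', hk, hl]
  have fin : ∀ {x y : R}, x = y →
      ((signed (u1 == s) (bif u1 then A1 else A1') * signed (u2 == s) (bif u2 then A2 else A2') *
        signed (u3 == s) (bif u3 then A3 else A3') : Rˣ) : R) * x =
      ((signed (u1 == s) (bif !u1 then A1 else A1') * signed (u2 == s) (bif !u2 then A2 else A2') *
        signed (u3 == s) (bif !u3 then A3 else A3') : Rˣ) : R) * y := by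
    intro x y h
    rw [hP, h]
  simp only [Units.val_mul] at fin
  have f1 := fin m1
  have f2 := fin m2
  have f3 := fin m3
  have f4 := fin m4
  refine ⟨?_, ?_, ?_, ?_⟩
  · linear_combination f1
  · linear_combination f2
  · linear_combination f3
  · linear_combination f4

/-! ### Merging classes along a list of pairs -/

namespace Setoid

variable {E : Type*}

/-- The smallest setoid above `s` relating all pairs of a list. -/
def gen (s : Setoid E) (l : List (E × E)) : Setoid E :=
  s ⊔ Relation.EqvGen.setoid fun a b => (a, b) ∈ l

theorem gen_le_iff {s t : Setoid E} {l : List (E × E)} :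
    gen s l ≤ t ↔ s ≤ t ∧ ∀ p ∈ l, Quotient.mk t p.1 = Quotient.mk t p.2 := by
  simp only [gen, sup_le_iff, eqvGen_le_iff, Quotient.eq, Prod.forall]

theorem sup_eq_gen {s u : Setoid E} {l : List (E × E)}
    (h : ∀ t : Setoid E, u ≤ t ↔ ∀ p ∈ l, Quotient.mk t p.1 = Quotient.mk t p.2) :
    s ⊔ u = gen s l :=
  eq_of_forall_ge_iff fun t => by rw [sup_le_iff, gen_le_iff, h]

theorem gen_congr {s : Setoid E} {l l' : List (E × E)}
    (h : ∀ t : Setoid E, (∀ p ∈ l, Quotient.mk t p.1 = Quotient.mk t p.2) ↔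
      ∀ p ∈ l', Quotient.mk t p.1 = Quotient.mk t p.2) : gen s l = gen s l' :=
  eq_of_forall_ge_iff fun t => by rw [gen_le_iff, gen_le_iff, h]

theorem gen_cons {s : Setoid E} {l : List (E × E)} {a b : E} :
    gen s ((a, b) :: l) = gen s l ⊔ pair a b :=
  eq_of_forall_ge_iff fun t => by
    rw [gen_le_iff, sup_le_iff, gen_le_iff, pair_le_iff_mk]
    simp only [List.forall_mem_cons]
    tauto

theorem Isolated.gen {s : Setoid E} {l : List (E × E)} {m : E} (hs : Isolated m s)
    (h : ∀ p ∈ l, p.1 ≠ m ∧ p.2 ≠ m) : Isolated m (gen s l) :=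
  hs.sup (Isolated.of_forall rfl fun a b hab => h (a, b) hab)

/-- A piece that touches nothing else only merges into an existing component. This lemma and the
next two eliminate the pieces inside a hole one by one. -/
theorem numClasses_gen_cons [Finite E] {s : Setoid E} {l : List (E × E)} {m a : E}
    (hs : Isolated m s) (h : ∀ p ∈ l, p.1 ≠ m ∧ p.2 ≠ m) (ha : m ≠ a) :
    (gen s ((m, a) :: l)).numClasses + 1 = (gen s l).numClasses := by
  rw [gen_cons, numClasses_sup_pair (hs.gen h) ha]

theorem numClasses_gen_cons₂ [Finite E] {s : Setoid E} {l : List (E × E)} {m m' a a' : E}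
    (hs : Isolated m s) (hs' : Isolated m' s) (h : ∀ p ∈ l, p.1 ≠ m ∧ p.2 ≠ m)
    (h' : ∀ p ∈ l, p.1 ≠ m' ∧ p.2 ≠ m') (hm : m ≠ m') (h1 : m ≠ a) (h2 : m ≠ a') (h3 : m' ≠ a') :
    (gen s ((m, a) :: (m', a') :: l)).numClasses + 2 = (gen s l).numClasses := by
  have e1 : (gen s ((m', a') :: l)).numClasses + 1 = _ := numClasses_gen_cons hs' h' h3
  have e2 : (gen s ((m, a) :: (m', a') :: l)).numClasses + 1 = _ :=
    numClasses_gen_cons hs (by simpa [hm.symm, h2.symm] using h) h1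
  omega

theorem numClasses_gen_cons₃ [Finite E] {s : Setoid E} {l : List (E × E)} {m m' m'' a a' a'' : E}
    (hs : Isolated m s) (hs' : Isolated m' s) (hs'' : Isolated m'' s)
    (h : ∀ p ∈ l, p.1 ≠ m ∧ p.2 ≠ m) (h' : ∀ p ∈ l, p.1 ≠ m' ∧ p.2 ≠ m')
    (h'' : ∀ p ∈ l, p.1 ≠ m'' ∧ p.2 ≠ m'') (hm : m ≠ m') (hm' : m ≠ m'') (hm'' : m' ≠ m'')
    (h1 : m ≠ a) (h2 : m ≠ a') (h3 : m ≠ a'') (h4 : m' ≠ a') (h5 : m' ≠ a'') (h6 : m'' ≠ a'') :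
    (gen s ((m, a) :: (m', a') :: (m'', a'') :: l)).numClasses + 3 = (gen s l).numClasses := by
  have e1 : (gen s ((m', a') :: (m'', a'') :: l)).numClasses + 2 = _ :=
    numClasses_gen_cons₂ hs' hs'' h' h'' hm'' h4 h5 h6
  have e2 : (gen s ((m, a) :: (m', a') :: (m'', a'') :: l)).numClasses + 1 = _ :=
    numClasses_gen_cons hs
      (by simpa [hm.symm, h2.symm, hm'.symm, h3.symm] using h) h1
  omega

end Setoid

/-! ### Crossings described by inner and outer semiarcs -/

namespace Xing

variable {E X R : Type*} [Biquandle X] [CommRing R]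

theorem smoothing_le_iff {c : Xing E} {b : Bool} {t : Setoid E} : c.smoothing b ≤ t ↔
    (bif b then Quotient.mk t c.ru = Quotient.mk t c.lo ∧ Quotient.mk t c.ro = Quotient.mk t c.lu
      else Quotient.mk t c.ru = Quotient.mk t c.ro ∧ Quotient.mk t c.lu = Quotient.mk t c.lo) := by
  cases b <;> simp [smoothing, Setoid.pair_le_iff_mk]

/-- The crossing whose under-strand consists of `iu` and `ou` and whose over-strand consists of `io`
and `oo`; `vu` says that `iu` is on the right, and `vo` that `io` is on the right. -/
def ofSides (vu vo : Bool) (iu ou io oo : E) (pos : Bool) : Xing E :=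
  ⟨bif vu then iu else ou, bif vo then io else oo, bif vu then ou else iu, bif vo then oo else io,
    pos⟩

/-- Inner ends on the same side are joined by the oriented smoothing, inner ends on different sides
by the other one; `vu != vo` always selects the smoothing that cuts off the inner corner. -/
theorem ofSides_corner {vu vo : Bool} {iu ou io oo : E} {pos : Bool} {t : Setoid E} :
    (ofSides vu vo iu ou io oo pos).smoothing (vu != vo) ≤ t ↔
      Quotient.mk t iu = Quotient.mk t io ∧ Quotient.mk t ou = Quotient.mk t oo := by
  rw [smoothing_le_iff]
  cases vu <;> cases vo <;> simp [ofSides] <;> tauto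

theorem ofSides_cross {vu vo : Bool} {iu ou io oo : E} {pos : Bool} {t : Setoid E} :
    (ofSides vu vo iu ou io oo pos).smoothing (!(vu != vo)) ≤ t ↔
      Quotient.mk t iu = Quotient.mk t oo ∧ Quotient.mk t io = Quotient.mk t ou := by
  rw [smoothing_le_iff]
  cases vu <;> cases vo <;> simp [ofSides] <;> tauto

theorem weight_eq_signed (β : BiquandleBracket X R) (f : E → X) (c : Xing E) (b : Bool) :
    c.weight β f b = signed c.pos (bif b then β.B (f c.ru) (f c.ro) else β.A (f c.ru) (f c.ro)) *
      (signed c.pos β.w)⁻¹ := by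
  cases h : c.pos <;> cases b <;> simp [weight, signed, h]

/-- Two adjacent semiarcs at a crossing determine the colors of the other two. -/
theorem ofSides_colored_unique {vu vo : Bool} {iu ou io oo : E} {pos : Bool} {f g : E → X}
    (hf : (ofSides vu vo iu ou io oo pos).Colored f)
    (hg : (ofSides vu vo iu ou io oo pos).Colored g) (hou : f ou = g ou) (hoo : f oo = g oo) :
    f iu = g iu ∧ f io = g io := by
  cases vu <;> cases vo <;> simp only [ofSides, Colored, cond_true, cond_false] at hf hg
  · rw [hf.1, hg.1, hf.2, hg.2, hou, hoo]
    exact ⟨rfl, rfl⟩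
  · have h1 : f io = g io := by
      apply (Biquandle.over_bijective (f ou)).1
      simp only
      rw [← hf.2, hou, ← hg.2, hoo]
    rw [hf.1, hg.1, h1, hou]
    exact ⟨rfl, rfl⟩
  · have h1 : f iu = g iu := by
      apply (Biquandle.under_bijective (f oo)).1
      simp only
      rw [← hf.1, hoo, ← hg.1, hou]
    rw [hf.2, hg.2, h1, hoo]
    exact ⟨rfl, rfl⟩
  · have h := @(Biquandle.sideways_bijective (X := X)).1 (f iu, f io) (g iu, g io) (by
      simp only
      rw [← hf.1, ← hf.2, ← hg.1, ← hg.2, hou, hoo])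
    exact ⟨congrArg Prod.fst h, congrArg Prod.snd h⟩

end Xing

/-- The bits say which of the two colors is prescribed on the right. Both on the left is sideways
bijectivity, the mixed cases are bijectivity of the two operations, and both on the right is
trivial: these axioms allow one under- and one over-semiarc to be colored freely. -/
theorem Biquandle.exists_side {X : Type*} [Biquandle X] (vu vo : Bool) (a b : X) :
    ∃ p q : X, (bif vu then p else Biquandle.utri p q) = a ∧
      (bif vo then q else Biquandle.otri q p) = b := by
  cases vu <;> cases vo <;> simp only [cond_true, cond_false]
  · obtain ⟨⟨p, q⟩, h⟩ := (Biquandle.sideways_bijective (X := X)).2 (b, a)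
    exact ⟨p, q, congrArg Prod.snd h, congrArg Prod.fst h⟩
  · obtain ⟨p, hp⟩ := (Biquandle.under_bijective b).2 a
    exact ⟨p, b, hp, rfl⟩
  · obtain ⟨q, hq⟩ := (Biquandle.over_bijective a).2 b
    exact ⟨a, q, rfl, hq⟩
  · exact ⟨a, b, rfl, rfl⟩

namespace Xing

variable {E X R : Type*} [Biquandle X] [CommRing R]

/-- The inner colors are chosen before the semiarcs and the sign, since the two crossings of a bigon
share their inner semiarcs and need the same pair. -/
theorem ofSides_colored_exists (vu vo : Bool) (a b : X) :
    ∃ a' b' : X, ∀ (iu ou io oo : E) (pos : Bool) (f : E → X), f ou = a → f oo = b → f iu = a' →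
      f io = b' → (ofSides vu vo iu ou io oo pos).Colored f := by
  obtain ⟨p, q, hp, hq⟩ := Biquandle.exists_side (!vu) (!vo) a b
  refine ⟨bif vu then p else Biquandle.utri p q, bif vo then q else Biquandle.otri q p, ?_⟩
  intro iu ou io oo pos f h1 h2 h3 h4
  cases vu <;> cases vo <;> simp_all [ofSides, Colored]

end Xing

/-- The base state is arbitrary because the natural one at a triangle, with all corners cut off,
depends on the sides of the strands. -/
theorem sum_fin_three_bool {R : Type*} [AddCommMonoid R] (F : (Fin 3 → Bool) → R) (a b c : Bool) :
    ∑ σ, F σ = F ![a, b, c] + F ![a, b, !c] + F ![a, !b, c] + F ![!a, b, c] + F ![a, !b, !c] +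
      F ![!a, b, !c] + F ![!a, !b, c] + F ![!a, !b, !c] := by
  have hu : (Finset.univ : Finset (Fin 3 → Bool)) = {![a, b, c], ![a, b, !c], ![a, !b, c],
      ![!a, b, c], ![a, !b, !c], ![!a, b, !c], ![!a, !b, c], ![!a, !b, !c]} := by
    revert a b c
    decide
  rw [hu]
  repeat rw [Finset.sum_insert (by revert a b c; decide)]
  rw [Finset.sum_singleton]
  simp only [add_assoc]

theorem sum_fin_two_bool {R : Type*} [AddCommMonoid R] (F : (Fin 2 → Bool) → R) (a b : Bool) :
    ∑ σ, F σ = F ![a, b] + F ![a, !b] + F ![!a, b] + F ![!a, !b] := by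
  have hu : (Finset.univ : Finset (Fin 2 → Bool)) = {![a, b], ![a, !b], ![!a, b], ![!a, !b]} := by
    revert a b
    decide
  rw [hu]
  repeat rw [Finset.sum_insert (by revert a b; decide)]
  rw [Finset.sum_singleton]
  simp only [add_assoc]

/-! ### The cube of colors of three strands -/

namespace Biquandle

variable {X : Type*} [Biquandle X]

/-- The color of the bottom strand, given its sides with respect to the middle and top strands. -/
def cubeB (x y z : X) : Bool → Bool → X
  | true, true => x
  | false, true => utri x y
  | true, false => utri x z
  | false, false => utri (utri x y) (otri z y)

/-- The color of the middle strand, given its sides with respect to the bottom and top strands. -/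
def cubeM (x y z : X) : Bool → Bool → X
  | true, true => y
  | false, true => otri y x
  | true, false => utri y z
  | false, false => utri (otri y x) (otri z x)

/-- The color of the top strand, given its sides with respect to the bottom and middle strands. -/
def cubeT (x y z : X) : Bool → Bool → X
  | true, true => z
  | false, true => otri z x
  | true, false => otri z y
  | false, false => otri (otri z y) (utri x y)

/-- The faces through the base vertex hold by definition of the cube, and so does the far bottom–top
face, by the choice of the far values of `cubeB` and `cubeT`. The exchange laws are what closes up
the other two far faces. -/
theorem cube_face_BM (x y z : X) (t : Bool) :
    cubeB x y z false t = utri (cubeB x y z true t) (cubeM x y z true t) ∧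
      cubeM x y z false t = otri (cubeM x y z true t) (cubeB x y z true t) := by
  cases t
  · exact ⟨(exchange_under_under x z y).symm, exchange_over_under y x z⟩
  · exact ⟨rfl, rfl⟩

theorem cube_face_MT (x y z : X) (t : Bool) :
    cubeM x y z t false = utri (cubeM x y z t true) (cubeT x y z t true) ∧
      cubeT x y z t false = otri (cubeT x y z t true) (cubeM x y z t true) := by
  cases t
  · exact ⟨rfl, (exchange_over_over z x y).symm⟩
  · exact ⟨rfl, rfl⟩

theorem cube_face_BT (x y z : X) (t : Bool) :
    cubeB x y z t false = utri (cubeB x y z t true) (cubeT x y z true t) ∧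
      cubeT x y z false t = otri (cubeT x y z true t) (cubeB x y z t true) := by
  cases t <;> exact ⟨rfl, rfl⟩

/-- If one of the bits is `true`, the other two strands are prescribed on a face through the base
vertex. There `exists_side` yields two of the three elements, and bijectivity of the operations
yields the third. -/
theorem cube_exists (vB vM vT : Bool) (b m t : X) :
    ∃ x y z : X, cubeB x y z vM vT = b ∧ cubeM x y z vB vT = m ∧ cubeT x y z vB vM = t := by
  have hB : ∀ (y z : X) (vM vT : Bool) (b : X), ∃ x, cubeB x y z vM vT = b := by
    intro y z vM vT b
    cases vM <;> cases vT
    · obtain ⟨p, hp⟩ := (under_bijective (otri z y)).2 b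
      obtain ⟨x, rfl⟩ := (under_bijective y).2 p
      exact ⟨x, hp⟩
    · exact (under_bijective y).2 b
    · exact (under_bijective z).2 b
    · exact ⟨b, rfl⟩
  have hT : ∀ (x y : X) (vB vM : Bool) (t : X), ∃ z, cubeT x y z vB vM = t := by
    intro x y vB vM t
    cases vB <;> cases vM
    · obtain ⟨p, hp⟩ := (over_bijective (utri x y)).2 t
      obtain ⟨z, rfl⟩ := (over_bijective y).2 p
      exact ⟨z, hp⟩
    · exact (over_bijective x).2 t
    · exact (over_bijective y).2 t
    · exact ⟨t, rfl⟩
  have hM : ∀ (x z : X) (vB vT : Bool) (m : X), ∃ y, cubeM x y z vB vT = m := by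
    intro x z vB vT m
    cases vB <;> cases vT
    · obtain ⟨p, hp⟩ := (under_bijective (otri z x)).2 m
      obtain ⟨y, rfl⟩ := (over_bijective x).2 p
      exact ⟨y, hp⟩
    · exact (over_bijective x).2 m
    · exact (under_bijective z).2 m
    · exact ⟨m, rfl⟩
  have caseB : ∀ (vM vT : Bool) (b m t : X),
      ∃ x y z : X, cubeB x y z vM vT = b ∧ cubeM x y z true vT = m ∧ cubeT x y z true vM = t := by
    intro vM vT b m t
    obtain ⟨y, z, h1, h2⟩ := exists_side vT vM m t
    obtain ⟨x, hx⟩ := hB y z vM vT b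
    refine ⟨x, y, z, hx, ?_, ?_⟩
    · rw [← h1]; cases vT <;> rfl
    · rw [← h2]; cases vM <;> rfl
  cases vT
  · cases vB
    · cases vM
      · obtain ⟨p, q, h1, h2⟩ := exists_side false false b m
        obtain ⟨p', q', h3, h4⟩ := exists_side false false b t
        simp only [cond_false] at h1 h2 h3 h4
        obtain ⟨x, y, z, e1, e2, e3⟩ := caseB false false b q q'
        refine ⟨x, y, z, e1, ?_, ?_⟩
        · have hf := cube_face_BM x y z false
          rw [e1, e2] at hf
          have : cubeB x y z true false = p := by
            apply (under_bijective q).1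
            simp only
            rw [h1, ← hf.1]
          rw [hf.2, this, h2]
        · have hf := cube_face_BT x y z false
          rw [e1, e3] at hf
          have : cubeB x y z false true = p' := by
            apply (under_bijective q').1
            simp only
            rw [h3, ← hf.1]
          rw [hf.2, this, h4]
      · obtain ⟨x, z, h1, h2⟩ := exists_side false false b t
        obtain ⟨y, hy⟩ := hM x z false false m
        exact ⟨x, y, z, h1, hy, h2⟩
    · exact caseB vM false b m t
  · obtain ⟨x, y, h1, h2⟩ := exists_side vM vB b m
    obtain ⟨z, hz⟩ := hT x y vB vM t
    refine ⟨x, y, z, ?_, ?_, hz⟩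
    · rw [← h1]; cases vM <;> rfl
    · rw [← h2]; cases vB <;> rfl

end Biquandle

/-! ### The three crossings of a triangle -/

open Biquandle

/-- The crossings of a bottom, a middle and a top strand bounding a triangle with sides `iB`, `iM`,
`iT`; the bottom strand continues to `B1` at the crossing with the middle strand and to `B2` at the
crossing with the top strand, and so on. The triangle lies to the right (`true`) or to the left of
the three strands, as given by `vB`, `vM`, `vT`. -/
def hexagon {E : Type*} (vB vM vT s : Bool) (iB iM iT B1 B2 M1 M2 T1 T2 : E) : Fin 3 → Xing E :=
  ![Xing.ofSides vM vB iB B1 iM M1 (vT == s), Xing.ofSides vT vM iM M2 iT T2 (vB == s),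
    Xing.ofSides vT vB iB B2 iT T1 (vM != s)]

section

variable {E X R : Type*} [Biquandle X] [CommRing R]

theorem Xing.ofSides_swap (vu vo : Bool) (iu ou io oo : E) (pos : Bool) :
    Xing.ofSides (!vu) (!vo) ou iu oo io pos = Xing.ofSides vu vo iu ou io oo pos := by
  cases vu <;> cases vo <;> rfl

/-- The colors of the three sides of the triangle extend to a cube by `cube_exists`, and at each
crossing the inner colors determine the outer ones. Negating all bits and exchanging the two outer
ends of each strand keeps `x`, `y`, `z`, which is how colorings pass through the third move. -/
theorem hexagon_colored_iff {vB vM vT s : Bool} {iB iM iT B1 B2 M1 M2 T1 T2 : E} {f : E → X} :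
    (∀ i, (hexagon vB vM vT s iB iM iT B1 B2 M1 M2 T1 T2 i).Colored f) ↔
      ∃ x y z : X, (f iB = cubeB x y z vM vT ∧ f iM = cubeM x y z vB vT ∧
        f iT = cubeT x y z vB vM) ∧
        f B1 = cubeB x y z (!vM) vT ∧ f B2 = cubeB x y z vM (!vT) ∧
        f M1 = cubeM x y z (!vB) vT ∧ f M2 = cubeM x y z vB (!vT) ∧
        f T1 = cubeT x y z (!vB) vM ∧ f T2 = cubeT x y z vB (!vM) := by
  have key : ∀ x y z : X,
      (Xing.ofSides vM vB (cubeB x y z vM vT) (cubeB x y z (!vM) vT) (cubeM x y z vB vT)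
        (cubeM x y z (!vB) vT) (vT == s)).Colored id ∧
      (Xing.ofSides vT vM (cubeM x y z vB vT) (cubeM x y z vB (!vT)) (cubeT x y z vB vM)
        (cubeT x y z vB (!vM)) (vB == s)).Colored id ∧
      (Xing.ofSides vT vB (cubeB x y z vM vT) (cubeB x y z vM (!vT)) (cubeT x y z vB vM)
        (cubeT x y z (!vB) vM) (vM != s)).Colored id := by
    intro x y z
    have h1 := cube_face_BM x y z vT
    have h2 := cube_face_MT x y z vB
    have h3 := cube_face_BT x y z vM
    refine ⟨?_, ?_, ?_⟩
    · cases vM <;> cases vB <;> exact h1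
    · cases vM <;> cases vT <;> exact h2
    · cases vB <;> cases vT <;> exact h3
  have hmap : ∀ (vu vo : Bool) (iu ou io oo : E) (pos : Bool),
      (Xing.ofSides vu vo iu ou io oo pos).Colored f ↔
        (Xing.ofSides vu vo (f iu) (f ou) (f io) (f oo) pos).Colored id := by
    intro vu vo iu ou io oo pos
    cases vu <;> cases vo <;> rfl
  have h3 : (∀ i, (hexagon vB vM vT s iB iM iT B1 B2 M1 M2 T1 T2 i).Colored f) ↔
      (Xing.ofSides vM vB (f iB) (f B1) (f iM) (f M1) (vT == s)).Colored id ∧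
      (Xing.ofSides vT vM (f iM) (f M2) (f iT) (f T2) (vB == s)).Colored id ∧
      (Xing.ofSides vT vB (f iB) (f B2) (f iT) (f T1) (vM != s)).Colored id := by
    rw [← hmap, ← hmap, ← hmap]
    simp [Fin.forall_fin_succ, hexagon]
  have huniq : ∀ (vu vo : Bool) (iu ou io oo ou' oo' : X) (pos : Bool),
      (Xing.ofSides vu vo iu ou io oo pos).Colored id →
      (Xing.ofSides vu vo iu ou' io oo' pos).Colored id → ou = ou' ∧ oo = oo' := by
    intro vu vo iu ou io oo ou' oo' pos h h'
    -- Inner and outer ends are interchanged so that `ofSides_colored_unique` determines the outer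
    -- colors; the index type `Fin 4` turns the four colors into a coloring.
    have e : ∀ ou oo, (Xing.ofSides vu vo iu ou io oo pos).Colored id →
        (Xing.ofSides (!vu) (!vo) (0 : Fin 4) 1 2 3 pos).Colored ![ou, iu, oo, io] := by
      intro ou oo h
      rw [← Xing.ofSides_swap] at h
      cases vu <;> cases vo <;> exact h
    exact Xing.ofSides_colored_unique (e _ _ h) (e _ _ h') rfl rfl
  rw [h3]
  constructor
  · rintro ⟨c1, c2, c3⟩
    obtain ⟨x, y, z, hB, hM, hT⟩ := cube_exists vB vM vT (f iB) (f iM) (f iT)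
    obtain ⟨k1, k2, k3⟩ := key x y z
    rw [hB, hM] at k1
    rw [hM, hT] at k2
    rw [hB, hT] at k3
    obtain ⟨e1, e2⟩ := huniq _ _ _ _ _ _ _ _ _ c1 k1
    obtain ⟨e3, e4⟩ := huniq _ _ _ _ _ _ _ _ _ c2 k2
    obtain ⟨e5, e6⟩ := huniq _ _ _ _ _ _ _ _ _ c3 k3
    exact ⟨x, y, z, ⟨hB.symm, hM.symm, hT.symm⟩, e1, e5, e2, e3, e6, e4⟩
  · rintro ⟨x, y, z, ⟨hB, hM, hT⟩, e1, e5, e2, e3, e6, e4⟩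
    rw [hB, hM, hT, e1, e2, e3, e4, e5, e6]
    exact key x y z

-- Here `k` belongs to the smoothing that cuts off a corner and `l` to the other one. States with at
-- least two corners cut off all induce the same pairing of the outer ends, and cutting off all
-- three leaves an extra loop, hence the factor `β.δ`. The other four states give the other four
-- noncrossing pairings of six points. The three inner pieces are absorbed, which lowers the
-- exponents by three.
set_option maxHeartbeats 1000000 in
theorem hexagon_localSum [Finite E] (β : BiquandleBracket X R) {vB vM vT s : Bool}
    {iB iM iT B1 B2 M1 M2 T1 T2 : E} (f : E → X) {t : Setoid E}
    (hB : Setoid.Isolated iB t) (hM : Setoid.Isolated iM t) (hT : Setoid.Isolated iT t)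
    (hBM : iB ≠ iM) (hBT : iB ≠ iT) (hMT : iM ≠ iT)
    (h1 : B1 ≠ iB ∧ B1 ≠ iM ∧ B1 ≠ iT) (h2 : B2 ≠ iB ∧ B2 ≠ iM ∧ B2 ≠ iT)
    (h3 : M1 ≠ iB ∧ M1 ≠ iM ∧ M1 ≠ iT) (h4 : M2 ≠ iB ∧ M2 ≠ iM ∧ M2 ≠ iT)
    (h5 : T1 ≠ iB ∧ T1 ≠ iM ∧ T1 ≠ iT) (h6 : T2 ≠ iB ∧ T2 ≠ iM ∧ T2 ≠ iT)
    {L : Fin 3 → Xing E} (hL : L = hexagon vB vM vT s iB iM iT B1 B2 M1 M2 T1 T2)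
    {k1 k2 k3 l1 l2 l3 : R}
    (hk1 : k1 = (L 0).weight β f (vM != vB)) (hl1 : l1 = (L 0).weight β f (!(vM != vB)))
    (hk2 : k2 = (L 1).weight β f (vT != vM)) (hl2 : l2 = (L 1).weight β f (!(vT != vM)))
    (hk3 : k3 = (L 2).weight β f (vT != vB)) (hl3 : l3 = (L 2).weight β f (!(vT != vB))) :
    Circuit.localSum β L f t =
      (β.δ * k1 * k2 * k3 + k1 * k2 * l3 + k1 * l2 * k3 + l1 * k2 * k3) *
          β.δ ^ ((t.gen [(B1, M1), (M2, T2), (B2, T1)]).numClasses - 3)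
        + l1 * l2 * l3 * β.δ ^ ((t.gen [(B2, M2), (M1, T1), (B1, T2)]).numClasses - 3)
        + k1 * l2 * l3 * β.δ ^ ((t.gen [(B1, M1), (B2, M2), (T1, T2)]).numClasses - 3)
        + l1 * k2 * l3 * β.δ ^ ((t.gen [(M2, T2), (M1, T1), (B1, B2)]).numClasses - 3)
        + l1 * l2 * k3 * β.δ ^ ((t.gen [(B2, T1), (M1, M2), (B1, T2)]).numClasses - 3) := by
  subst hL
  have st : ∀ (σ : Fin 3 → Bool) (l : List (E × E)),
      (∀ u : Setoid E, (∀ i, (hexagon vB vM vT s iB iM iT B1 B2 M1 M2 T1 T2 i).smoothing (σ i) ≤ u)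
        ↔ ∀ p ∈ l, Quotient.mk u p.1 = Quotient.mk u p.2) →
      t ⊔ ⨆ i, (hexagon vB vM vT s iB iM iT B1 B2 M1 M2 T1 T2 i).smoothing (σ i) = t.gen l :=
    fun σ l h => Setoid.sup_eq_gen fun u => by rw [iSup_le_iff, h]
  have s_kkk := st ![(vM != vB), (vT != vM), (vT != vB)]
    [(iM, iB), (iT, iB), (B1, M1), (M2, T2), (B2, T1)] (by
      intro u
      simp only [Fin.forall_fin_succ, hexagon, Matrix.cons_val_zero, Matrix.cons_val_succ,
        Xing.ofSides_corner, List.forall_mem_cons, List.not_mem_nil,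
        IsEmpty.forall_iff, implies_true, and_true]
      grind)
  have s_kkl := st ![(vM != vB), (vT != vM), !(vT != vB)]
    [(iB, T1), (iM, T1), (iT, T1), (B1, M1), (M2, T2), (B2, T1)] (by
      intro u
      simp only [Fin.forall_fin_succ, hexagon, Matrix.cons_val_zero, Matrix.cons_val_succ,
        Xing.ofSides_corner, Xing.ofSides_cross, List.forall_mem_cons, List.not_mem_nil,
        IsEmpty.forall_iff, implies_true, and_true]
      grind)
  have s_klk := st ![(vM != vB), !(vT != vM), (vT != vB)]
    [(iB, M2), (iM, M2), (iT, M2), (B1, M1), (M2, T2), (B2, T1)] (by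
      intro u
      simp only [Fin.forall_fin_succ, hexagon, Matrix.cons_val_zero, Matrix.cons_val_succ,
        Xing.ofSides_corner, Xing.ofSides_cross, List.forall_mem_cons, List.not_mem_nil,
        IsEmpty.forall_iff, implies_true, and_true]
      grind)
  have s_lkk := st ![!(vM != vB), (vT != vM), (vT != vB)]
    [(iB, M1), (iM, M1), (iT, M1), (B1, M1), (M2, T2), (B2, T1)] (by
      intro u
      simp only [Fin.forall_fin_succ, hexagon, Matrix.cons_val_zero, Matrix.cons_val_succ,
        Xing.ofSides_corner, Xing.ofSides_cross, List.forall_mem_cons, List.not_mem_nil,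
        IsEmpty.forall_iff, implies_true, and_true]
      grind)
  have s_kll := st ![(vM != vB), !(vT != vM), !(vT != vB)]
    [(iB, T1), (iM, T1), (iT, M2), (B1, M1), (B2, M2), (T1, T2)] (by
      intro u
      simp only [Fin.forall_fin_succ, hexagon, Matrix.cons_val_zero, Matrix.cons_val_succ,
        Xing.ofSides_corner, Xing.ofSides_cross, List.forall_mem_cons, List.not_mem_nil,
        IsEmpty.forall_iff, implies_true, and_true]
      grind)
  have s_lkl := st ![!(vM != vB), (vT != vM), !(vT != vB)]
    [(iB, M1), (iM, B1), (iT, B1), (M2, T2), (M1, T1), (B1, B2)] (by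
      intro u
      simp only [Fin.forall_fin_succ, hexagon, Matrix.cons_val_zero, Matrix.cons_val_succ,
        Xing.ofSides_corner, Xing.ofSides_cross, List.forall_mem_cons, List.not_mem_nil,
        IsEmpty.forall_iff, implies_true, and_true]
      grind)
  have s_llk := st ![!(vM != vB), !(vT != vM), (vT != vB)]
    [(iB, M1), (iM, B1), (iT, M1), (B2, T1), (M1, M2), (B1, T2)] (by
      intro u
      simp only [Fin.forall_fin_succ, hexagon, Matrix.cons_val_zero, Matrix.cons_val_succ,
        Xing.ofSides_corner, Xing.ofSides_cross, List.forall_mem_cons, List.not_mem_nil,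
        IsEmpty.forall_iff, implies_true, and_true]
      grind)
  have s_lll := st ![!(vM != vB), !(vT != vM), !(vT != vB)]
    [(iB, M1), (iM, B1), (iT, M2), (B2, M2), (M1, T1), (B1, T2)] (by
      intro u
      simp only [Fin.forall_fin_succ, hexagon, Matrix.cons_val_zero, Matrix.cons_val_succ,
        Xing.ofSides_cross, List.forall_mem_cons, List.not_mem_nil,
        IsEmpty.forall_iff, implies_true, and_true]
      grind)
  -- The inner pieces form a loop of their own, so only two classes are lost, not three.
  have n_kkk := Setoid.numClasses_gen_cons₂ (l := [(B1, M1), (M2, T2), (B2, T1)])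
    (a := iB) (a' := iB) hM hT
    (by
      simp only [List.forall_mem_cons, List.not_mem_nil, IsEmpty.forall_iff, implies_true, and_true]
      exact ⟨⟨h1.2.1, h3.2.1⟩, ⟨h4.2.1, h6.2.1⟩, ⟨h2.2.1, h5.2.1⟩⟩)
    (by
      simp only [List.forall_mem_cons, List.not_mem_nil, IsEmpty.forall_iff, implies_true, and_true]
      exact ⟨⟨h1.2.2, h3.2.2⟩, ⟨h4.2.2, h6.2.2⟩, ⟨h2.2.2, h5.2.2⟩⟩)
    hMT hBM.symm hBM.symm hBT.symm
  have n_kkl := Setoid.numClasses_gen_cons₃ (l := [(B1, M1), (M2, T2), (B2, T1)])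
    (a := T1) (a' := T1) (a'' := T1) hB hM hT
    (by
      simp only [List.forall_mem_cons, List.not_mem_nil, IsEmpty.forall_iff, implies_true, and_true]
      exact ⟨⟨h1.1, h3.1⟩, ⟨h4.1, h6.1⟩, ⟨h2.1, h5.1⟩⟩)
    (by
      simp only [List.forall_mem_cons, List.not_mem_nil, IsEmpty.forall_iff, implies_true, and_true]
      exact ⟨⟨h1.2.1, h3.2.1⟩, ⟨h4.2.1, h6.2.1⟩, ⟨h2.2.1, h5.2.1⟩⟩)
    (by
      simp only [List.forall_mem_cons, List.not_mem_nil, IsEmpty.forall_iff, implies_true, and_true]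
      exact ⟨⟨h1.2.2, h3.2.2⟩, ⟨h4.2.2, h6.2.2⟩, ⟨h2.2.2, h5.2.2⟩⟩)
    hBM hBT hMT (h5.1.symm) (h5.1.symm) (h5.1.symm) (h5.2.1.symm) (h5.2.1.symm) (h5.2.2.symm)
  have n_klk := Setoid.numClasses_gen_cons₃ (l := [(B1, M1), (M2, T2), (B2, T1)])
    (a := M2) (a' := M2) (a'' := M2) hB hM hT
    (by
      simp only [List.forall_mem_cons, List.not_mem_nil, IsEmpty.forall_iff, implies_true, and_true]
      exact ⟨⟨h1.1, h3.1⟩, ⟨h4.1, h6.1⟩, ⟨h2.1, h5.1⟩⟩)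
    (by
      simp only [List.forall_mem_cons, List.not_mem_nil, IsEmpty.forall_iff, implies_true, and_true]
      exact ⟨⟨h1.2.1, h3.2.1⟩, ⟨h4.2.1, h6.2.1⟩, ⟨h2.2.1, h5.2.1⟩⟩)
    (by
      simp only [List.forall_mem_cons, List.not_mem_nil, IsEmpty.forall_iff, implies_true, and_true]
      exact ⟨⟨h1.2.2, h3.2.2⟩, ⟨h4.2.2, h6.2.2⟩, ⟨h2.2.2, h5.2.2⟩⟩)
    hBM hBT hMT (h4.1.symm) (h4.1.symm) (h4.1.symm) (h4.2.1.symm) (h4.2.1.symm) (h4.2.2.symm)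
  have n_lkk := Setoid.numClasses_gen_cons₃ (l := [(B1, M1), (M2, T2), (B2, T1)])
    (a := M1) (a' := M1) (a'' := M1) hB hM hT
    (by
      simp only [List.forall_mem_cons, List.not_mem_nil, IsEmpty.forall_iff, implies_true, and_true]
      exact ⟨⟨h1.1, h3.1⟩, ⟨h4.1, h6.1⟩, ⟨h2.1, h5.1⟩⟩)
    (by
      simp only [List.forall_mem_cons, List.not_mem_nil, IsEmpty.forall_iff, implies_true, and_true]
      exact ⟨⟨h1.2.1, h3.2.1⟩, ⟨h4.2.1, h6.2.1⟩, ⟨h2.2.1, h5.2.1⟩⟩)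
    (by
      simp only [List.forall_mem_cons, List.not_mem_nil, IsEmpty.forall_iff, implies_true, and_true]
      exact ⟨⟨h1.2.2, h3.2.2⟩, ⟨h4.2.2, h6.2.2⟩, ⟨h2.2.2, h5.2.2⟩⟩)
    hBM hBT hMT (h3.1.symm) (h3.1.symm) (h3.1.symm) (h3.2.1.symm) (h3.2.1.symm) (h3.2.2.symm)
  have n_kll := Setoid.numClasses_gen_cons₃ (l := [(B1, M1), (B2, M2), (T1, T2)])
    (a := T1) (a' := T1) (a'' := M2) hB hM hT
    (by
      simp only [List.forall_mem_cons, List.not_mem_nil, IsEmpty.forall_iff, implies_true, and_true]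
      exact ⟨⟨h1.1, h3.1⟩, ⟨h2.1, h4.1⟩, ⟨h5.1, h6.1⟩⟩)
    (by
      simp only [List.forall_mem_cons, List.not_mem_nil, IsEmpty.forall_iff, implies_true, and_true]
      exact ⟨⟨h1.2.1, h3.2.1⟩, ⟨h2.2.1, h4.2.1⟩, ⟨h5.2.1, h6.2.1⟩⟩)
    (by
      simp only [List.forall_mem_cons, List.not_mem_nil, IsEmpty.forall_iff, implies_true, and_true]
      exact ⟨⟨h1.2.2, h3.2.2⟩, ⟨h2.2.2, h4.2.2⟩, ⟨h5.2.2, h6.2.2⟩⟩)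
    hBM hBT hMT (h5.1.symm) (h5.1.symm) (h4.1.symm) (h5.2.1.symm) (h4.2.1.symm) (h4.2.2.symm)
  have n_lkl := Setoid.numClasses_gen_cons₃ (l := [(M2, T2), (M1, T1), (B1, B2)])
    (a := M1) (a' := B1) (a'' := B1) hB hM hT
    (by
      simp only [List.forall_mem_cons, List.not_mem_nil, IsEmpty.forall_iff, implies_true, and_true]
      exact ⟨⟨h4.1, h6.1⟩, ⟨h3.1, h5.1⟩, ⟨h1.1, h2.1⟩⟩)
    (by
      simp only [List.forall_mem_cons, List.not_mem_nil, IsEmpty.forall_iff, implies_true, and_true]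
      exact ⟨⟨h4.2.1, h6.2.1⟩, ⟨h3.2.1, h5.2.1⟩, ⟨h1.2.1, h2.2.1⟩⟩)
    (by
      simp only [List.forall_mem_cons, List.not_mem_nil, IsEmpty.forall_iff, implies_true, and_true]
      exact ⟨⟨h4.2.2, h6.2.2⟩, ⟨h3.2.2, h5.2.2⟩, ⟨h1.2.2, h2.2.2⟩⟩)
    hBM hBT hMT (h3.1.symm) (h1.1.symm) (h1.1.symm) (h1.2.1.symm) (h1.2.1.symm) (h1.2.2.symm)
  have n_llk := Setoid.numClasses_gen_cons₃ (l := [(B2, T1), (M1, M2), (B1, T2)])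
    (a := M1) (a' := B1) (a'' := M1) hB hM hT
    (by
      simp only [List.forall_mem_cons, List.not_mem_nil, IsEmpty.forall_iff, implies_true, and_true]
      exact ⟨⟨h2.1, h5.1⟩, ⟨h3.1, h4.1⟩, ⟨h1.1, h6.1⟩⟩)
    (by
      simp only [List.forall_mem_cons, List.not_mem_nil, IsEmpty.forall_iff, implies_true, and_true]
      exact ⟨⟨h2.2.1, h5.2.1⟩, ⟨h3.2.1, h4.2.1⟩, ⟨h1.2.1, h6.2.1⟩⟩)
    (by
      simp only [List.forall_mem_cons, List.not_mem_nil, IsEmpty.forall_iff, implies_true, and_true]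
      exact ⟨⟨h2.2.2, h5.2.2⟩, ⟨h3.2.2, h4.2.2⟩, ⟨h1.2.2, h6.2.2⟩⟩)
    hBM hBT hMT (h3.1.symm) (h1.1.symm) (h3.1.symm) (h1.2.1.symm) (h3.2.1.symm) (h3.2.2.symm)
  have n_lll := Setoid.numClasses_gen_cons₃ (l := [(B2, M2), (M1, T1), (B1, T2)])
    (a := M1) (a' := B1) (a'' := M2) hB hM hT
    (by
      simp only [List.forall_mem_cons, List.not_mem_nil, IsEmpty.forall_iff, implies_true, and_true]
      exact ⟨⟨h2.1, h4.1⟩, ⟨h3.1, h5.1⟩, ⟨h1.1, h6.1⟩⟩)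
    (by
      simp only [List.forall_mem_cons, List.not_mem_nil, IsEmpty.forall_iff, implies_true, and_true]
      exact ⟨⟨h2.2.1, h4.2.1⟩, ⟨h3.2.1, h5.2.1⟩, ⟨h1.2.1, h6.2.1⟩⟩)
    (by
      simp only [List.forall_mem_cons, List.not_mem_nil, IsEmpty.forall_iff, implies_true, and_true]
      exact ⟨⟨h2.2.2, h4.2.2⟩, ⟨h3.2.2, h5.2.2⟩, ⟨h1.2.2, h6.2.2⟩⟩)
    hBM hBT hMT (h3.1.symm) (h1.1.symm) (h4.1.symm) (h1.2.1.symm) (h4.2.1.symm) (h4.2.2.symm)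
  rw [Circuit.localSum, sum_fin_three_bool _ (vM != vB) (vT != vM) (vT != vB)]
  rw [s_kkk, s_kkl, s_klk, s_lkk, s_kll, s_lkl, s_llk, s_lll]
  simp only [Fin.prod_univ_three, Matrix.cons_val_zero, Matrix.cons_val_one, Matrix.cons_val,
    Units.val_mul, ← hk1, ← hk2, ← hk3, ← hl1, ← hl2, ← hl3]
  -- The differences in the exponents are truncated; the counts above show that at least three
  -- classes are present.
  rw [show (t.gen [(iM, iB), (iT, iB), (B1, M1), (M2, T2), (B2, T1)]).numClasses
    = (t.gen [(B1, M1), (M2, T2), (B2, T1)]).numClasses - 3 + 1 by omega]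
  rw [show (t.gen [(iB, T1), (iM, T1), (iT, T1), (B1, M1), (M2, T2), (B2, T1)]).numClasses
    = (t.gen [(B1, M1), (M2, T2), (B2, T1)]).numClasses - 3 by omega]
  rw [show (t.gen [(iB, M2), (iM, M2), (iT, M2), (B1, M1), (M2, T2), (B2, T1)]).numClasses
    = (t.gen [(B1, M1), (M2, T2), (B2, T1)]).numClasses - 3 by omega]
  rw [show (t.gen [(iB, M1), (iM, M1), (iT, M1), (B1, M1), (M2, T2), (B2, T1)]).numClasses
    = (t.gen [(B1, M1), (M2, T2), (B2, T1)]).numClasses - 3 by omega]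
  rw [show (t.gen [(iB, T1), (iM, T1), (iT, M2), (B1, M1), (B2, M2), (T1, T2)]).numClasses
    = (t.gen [(B1, M1), (B2, M2), (T1, T2)]).numClasses - 3 by omega]
  rw [show (t.gen [(iB, M1), (iM, B1), (iT, B1), (M2, T2), (M1, T1), (B1, B2)]).numClasses
    = (t.gen [(M2, T2), (M1, T1), (B1, B2)]).numClasses - 3 by omega]
  rw [show (t.gen [(iB, M1), (iM, B1), (iT, M1), (B2, T1), (M1, M2), (B1, T2)]).numClasses
    = (t.gen [(B2, T1), (M1, M2), (B1, T2)]).numClasses - 3 by omega]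
  rw [show (t.gen [(iB, M1), (iM, B1), (iT, M2), (B2, M2), (M1, T1), (B1, T2)]).numClasses
    = (t.gen [(B2, M2), (M1, T1), (B1, T2)]).numClasses - 3 by omega]
  ring

end

/-! ### Local moves on circuits -/

namespace Circuit

open Biquandle

variable {E C X R : Type*}

theorem ker_mk_eq {f : E → X} {a b : E} :
    Quotient.mk (Setoid.ker f) a = Quotient.mk (Setoid.ker f) b ↔ f a = f b := by
  rw [Quotient.eq, Setoid.ker_def]

variable [Biquandle X] [CommRing R]

theorem isColoring_add {ι : Type*} {G : Circuit E C} {L : ι → Xing E} {f : E → X} :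
    (G.add L).IsColoring f ↔ G.IsColoring f ∧ ∀ i, (L i).Colored f := by
  simp only [IsColoring, add, Sum.forall, Sum.elim_inl, Sum.elim_inr]
  tauto

theorem isColoring_addBond {G : Circuit E C} {r : E → E → Prop} {f : E → X} :
    (G.addBond r).IsColoring f ↔ G.IsColoring f ∧ Relation.EqvGen.setoid r ≤ Setoid.ker f := by
  simp only [IsColoring, addBond, Setoid.eqvGen_le_iff, Setoid.ker_def]
  constructor
  · rintro ⟨h1, h2⟩
    exact ⟨⟨h1, fun a b h => h2 a b (Or.inl h)⟩, fun a b h => h2 a b (Or.inr h)⟩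
  · rintro ⟨⟨h1, h2⟩, h3⟩
    exact ⟨h1, fun a b h => h.elim (h2 a b) (h3 a b)⟩

/-- The labels of a crossing sit on its right-hand side, whether the inner or the outer semiarc lies
there. This fixes the bits of its two strands to `true` and leaves only the bit of the third strand.
-/
theorem hexagon_weight (β : BiquandleBracket X R) {vB vM vT s : Bool}
    {iB iM iT B1 B2 M1 M2 T1 T2 : E} {f : E → X} {x y z : X}
    (hi : f iB = cubeB x y z vM vT ∧ f iM = cubeM x y z vB vT ∧ f iT = cubeT x y z vB vM)
    (e1 : f B1 = cubeB x y z (!vM) vT) (e2 : f B2 = cubeB x y z vM (!vT))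
    (e3 : f M1 = cubeM x y z (!vB) vT) (e4 : f M2 = cubeM x y z vB (!vT))
    (e5 : f T1 = cubeT x y z (!vB) vM) (e6 : f T2 = cubeT x y z vB (!vM)) (b : Bool) :
    (hexagon vB vM vT s iB iM iT B1 B2 M1 M2 T1 T2 0).weight β f b =
      signed (vT == s) (bif b then β.B (cubeB x y z true vT) (cubeM x y z true vT)
        else β.A (cubeB x y z true vT) (cubeM x y z true vT)) * (signed (vT == s) β.w)⁻¹ ∧
    (hexagon vB vM vT s iB iM iT B1 B2 M1 M2 T1 T2 1).weight β f b =
      signed (vB == s) (bif b then β.B (cubeM x y z vB true) (cubeT x y z vB true)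
        else β.A (cubeM x y z vB true) (cubeT x y z vB true)) * (signed (vB == s) β.w)⁻¹ ∧
    (hexagon vB vM vT s iB iM iT B1 B2 M1 M2 T1 T2 2).weight β f b =
      signed (vM != s) (bif b then β.B (cubeB x y z vM true) (cubeT x y z true vM)
        else β.A (cubeB x y z vM true) (cubeT x y z true vM)) * (signed (vM != s) β.w)⁻¹ := by
  obtain ⟨h1, h2, h3⟩ := hi
  refine ⟨?_, ?_, ?_⟩ <;> rw [Xing.weight_eq_signed] <;>
    simp only [hexagon, Matrix.cons_val_zero, Matrix.cons_val_one, Matrix.cons_val, Xing.ofSides]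
  · cases vM <;> cases vB <;> simp only [cond_true, cond_false, h1, h2, e1, e3,
      Bool.not_false]
  · cases vM <;> cases vT <;> simp only [cond_true, cond_false, h3, h2, e4, e6,
      Bool.not_false]
  · cases vT <;> cases vB <;> simp only [cond_true, cond_false, h3, h1, e2, e5,
      Bool.not_false]

/-- The pairing given by the corners of one triangle is the pairing given by the three
`l`-smoothings of the other. So `m4` and `m5` match the coefficients of `e` and `e'`, while `f1`,
`f2`, `f3` belong to pairings common to both sides. -/
theorem hexagon_sum_eq {d w1 w2 w3 k1 k2 k3 l1 l2 l3 k1' k2' k3' l1' l2' l3' e e' f1 f2 f3 : R}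
    (m1 : k1 * l2 * l3 = k1' * l2' * l3') (m2 : l1 * k2 * l3 = l1' * k2' * l3')
    (m3 : l1 * l2 * k3 = l1' * l2' * k3')
    (m4 : d * k1 * k2 * k3 + k1 * k2 * l3 + k1 * l2 * k3 + l1 * k2 * k3 = l1' * l2' * l3')
    (m5 : d * k1' * k2' * k3' + k1' * k2' * l3' + k1' * l2' * k3' + l1' * k2' * k3'
      = l1 * l2 * l3) :
    (d * (k1' * w1) * (k2' * w2) * (k3' * w3) + k1' * w1 * (k2' * w2) * (l3' * w3) +
        k1' * w1 * (l2' * w2) * (k3' * w3) + l1' * w1 * (k2' * w2) * (k3' * w3)) * e' +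
      l1' * w1 * (l2' * w2) * (l3' * w3) * e + k1' * w1 * (l2' * w2) * (l3' * w3) * f1 +
      l1' * w1 * (k2' * w2) * (l3' * w3) * f2 + l1' * w1 * (l2' * w2) * (k3' * w3) * f3 =
    (d * (k1 * w1) * (k2 * w2) * (k3 * w3) + k1 * w1 * (k2 * w2) * (l3 * w3) +
        k1 * w1 * (l2 * w2) * (k3 * w3) + l1 * w1 * (k2 * w2) * (k3 * w3)) * e +
      l1 * w1 * (l2 * w2) * (l3 * w3) * e' + k1 * w1 * (l2 * w2) * (l3 * w3) * f1 +
      l1 * w1 * (k2 * w2) * (l3 * w3) * f2 + l1 * w1 * (l2 * w2) * (k3 * w3) * f3 := by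
  linear_combination w1 * w2 * w3 * (e' * m5 - e * m4 - f1 * m1 - f2 * m2 - f3 * m3)

/-- The bits `vT`, `vB`, `!vM` play the roles of `u1`, `u2`, `u3`: each crossing is governed by the
side of the third strand, and the negation reflects the opposite sign rule at the bottom–top
crossing. -/
theorem bracket_identities (β : BiquandleBracket X R) (x y z : X) (vB vM vT s : Bool) :
    let c1 : Bool → Bool → Bool → R := fun v s b =>
      (signed (v == s) (bif b then β.B (cubeB x y z true v) (cubeM x y z true v)
        else β.A (cubeB x y z true v) (cubeM x y z true v)) : Rˣ)
    let c2 : Bool → Bool → Bool → R := fun v s b =>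
      (signed (v == s) (bif b then β.B (cubeM x y z v true) (cubeT x y z v true)
        else β.A (cubeM x y z v true) (cubeT x y z v true)) : Rˣ)
    let c3 : Bool → Bool → Bool → R := fun v s b =>
      (signed (v != s) (bif b then β.B (cubeB x y z v true) (cubeT x y z true v)
        else β.A (cubeB x y z v true) (cubeT x y z true v)) : Rˣ)
    let k1 := c1 vT s (vM != vB)
    let l1 := c1 vT s (!(vM != vB))
    let k2 := c2 vB s (vT != vM)
    let l2 := c2 vB s (!(vT != vM))
    let k3 := c3 vM s (vT != vB)
    let l3 := c3 vM s (!(vT != vB))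
    let k1' := c1 (!vT) (!s) ((!vM) != (!vB))
    let l1' := c1 (!vT) (!s) (!((!vM) != (!vB)))
    let k2' := c2 (!vB) (!s) ((!vT) != (!vM))
    let l2' := c2 (!vB) (!s) (!((!vT) != (!vM)))
    let k3' := c3 (!vM) (!s) ((!vT) != (!vB))
    let l3' := c3 (!vM) (!s) (!((!vT) != (!vB)))
    k1 * l2 * l3 = k1' * l2' * l3' ∧ l1 * k2 * l3 = l1' * k2' * l3' ∧
      l1 * l2 * k3 = l1' * l2' * k3' ∧
      β.δ * k1 * k2 * k3 + k1 * k2 * l3 + k1 * l2 * k3 + l1 * k2 * k3 = l1' * l2' * l3' := by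
  intro c1 c2 c3 k1 l1 k2 l2 k3 l3 k1' l1' k2' l2' k3' l3'
  refine hexagon_identities (β.triple₁ x y z) (β.triple₂ x y z) (β.triple₃ x y z)
    (β.triple₄ x y z) (β.triple₅ x y z) (β.δ_eq _ _) (β.δ_eq _ _) (β.δ_eq _ _) (β.δ_eq _ _)
    vT vB (!vM) s ?_ ?_ ?_ ?_ ?_ ?_ ?_ ?_ ?_ ?_ ?_ ?_ <;>
    cases vB <;> cases vM <;> cases vT <;> cases s <;> rfl

/-- The third Reidemeister move. -/
theorem matrix_add_hexagon [Fintype E] [Fintype C] [DecidableEq C] [Fintype X]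
    (β : BiquandleBracket X R) (G : Circuit E C) (vB vM vT s : Bool)
    {iB iM iT B1 B2 M1 M2 T1 T2 : E}
    (hB : G.Avoids iB) (hM : G.Avoids iM) (hT : G.Avoids iT)
    (hBM : iB ≠ iM) (hBT : iB ≠ iT) (hMT : iM ≠ iT)
    (h1 : B1 ≠ iB ∧ B1 ≠ iM ∧ B1 ≠ iT) (h2 : B2 ≠ iB ∧ B2 ≠ iM ∧ B2 ≠ iT)
    (h3 : M1 ≠ iB ∧ M1 ≠ iM ∧ M1 ≠ iT) (h4 : M2 ≠ iB ∧ M2 ≠ iM ∧ M2 ≠ iT)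
    (h5 : T1 ≠ iB ∧ T1 ≠ iM ∧ T1 ≠ iT) (h6 : T2 ≠ iB ∧ T2 ≠ iM ∧ T2 ≠ iT) :
    (G.add (hexagon vB vM vT s iB iM iT B1 B2 M1 M2 T1 T2)).matrix β =
      (G.add (hexagon (!vB) (!vM) (!vT) (!s) iB iM iT B2 B1 M2 M1 T2 T1)).matrix β := by
  classical
  have hm : ∀ e ∈ ({iB, iM, iT} : Set E), G.Avoids e := by
    rintro e (rfl | rfl | rfl) <;> assumption
  have hex : ∀ (vB vM vT s : Bool) (B1 B2 M1 M2 T1 T2 : E),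
      (B1 ≠ iB ∧ B1 ≠ iM ∧ B1 ≠ iT) → (B2 ≠ iB ∧ B2 ≠ iM ∧ B2 ≠ iT) →
      (M1 ≠ iB ∧ M1 ≠ iM ∧ M1 ≠ iT) → (M2 ≠ iB ∧ M2 ≠ iM ∧ M2 ≠ iT) →
      (T1 ≠ iB ∧ T1 ≠ iM ∧ T1 ≠ iT) → (T2 ≠ iB ∧ T2 ≠ iM ∧ T2 ≠ iT) → ∀ f : E → X,
      (G.add (hexagon vB vM vT s iB iM iT B1 B2 M1 M2 T1 T2)).IsColoring f →
      ∃ (f' : E → X) (x y z : X), (∀ e, e ∉ ({iB, iM, iT} : Set E) → f' e = f e) ∧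
        (G.add (hexagon (!vB) (!vM) (!vT) (!s) iB iM iT B2 B1 M2 M1 T2 T1)).IsColoring f' ∧
        (f iB = cubeB x y z vM vT ∧ f iM = cubeM x y z vB vT ∧ f iT = cubeT x y z vB vM) ∧
        (f' iB = cubeB x y z (!vM) (!vT) ∧ f' iM = cubeM x y z (!vB) (!vT) ∧
          f' iT = cubeT x y z (!vB) (!vM)) ∧
        f B1 = cubeB x y z (!vM) vT ∧ f B2 = cubeB x y z vM (!vT) ∧
        f M1 = cubeM x y z (!vB) vT ∧ f M2 = cubeM x y z vB (!vT) ∧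
        f T1 = cubeT x y z (!vB) vM ∧ f T2 = cubeT x y z vB (!vM) := by
    intro vB vM vT s B1 B2 M1 M2 T1 T2 h1 h2 h3 h4 h5 h6 f hf
    rw [isColoring_add, hexagon_colored_iff] at hf
    obtain ⟨hG, x, y, z, hi, e1, e2, e3, e4, e5, e6⟩ := hf
    -- The new triangle sits at the opposite corner of the same cube, so only the inner colors
    -- change.
    let f' : E → X := fun e => if e = iB then cubeB x y z (!vM) (!vT) else
      if e = iM then cubeM x y z (!vB) (!vT) else if e = iT then cubeT x y z (!vB) (!vM) else f e
    have g0 : ∀ e, e ≠ iB ∧ e ≠ iM ∧ e ≠ iT → f' e = f e := by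
      rintro e ⟨ha, hb, hc⟩
      simp [f', ha, hb, hc]
    have g1 : f' iB = cubeB x y z (!vM) (!vT) := by simp [f']
    have g2 : f' iM = cubeM x y z (!vB) (!vT) := by simp [f', hBM.symm]
    have g3 : f' iT = cubeT x y z (!vB) (!vM) := by simp [f', hBT.symm, hMT.symm]
    have hag : ∀ e, e ∉ ({iB, iM, iT} : Set E) → f' e = f e := by
      intro e he
      apply g0
      simpa using he
    refine ⟨f', x, y, z, hag, ?_, hi, ⟨g1, g2, g3⟩, e1, e2, e3, e4, e5, e6⟩
    rw [isColoring_add, hexagon_colored_iff]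
    refine ⟨hG.congr hm hag, x, y, z, ⟨g1, g2, g3⟩, ?_⟩
    rw [g0 _ h1, g0 _ h2, g0 _ h3, g0 _ h4, g0 _ h5, g0 _ h6]
    simp only [Bool.not_not]
    exact ⟨e2, e1, e4, e3, e6, e5⟩
  have huniq : ∀ (vB vM vT s : Bool) (B1 B2 M1 M2 T1 T2 : E),
      (B1 ≠ iB ∧ B1 ≠ iM ∧ B1 ≠ iT) → (B2 ≠ iB ∧ B2 ≠ iM ∧ B2 ≠ iT) →
      (M1 ≠ iB ∧ M1 ≠ iM ∧ M1 ≠ iT) → (T1 ≠ iB ∧ T1 ≠ iM ∧ T1 ≠ iT) → ∀ f g : E → X,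
      (G.add (hexagon vB vM vT s iB iM iT B1 B2 M1 M2 T1 T2)).IsColoring f →
      (G.add (hexagon vB vM vT s iB iM iT B1 B2 M1 M2 T1 T2)).IsColoring g →
      (∀ e, e ∉ ({iB, iM, iT} : Set E) → f e = g e) → f = g := by
    intro vB vM vT s B1 B2 M1 M2 T1 T2 h1 h2 h3 h5 f g hf hg h
    rw [isColoring_add] at hf hg
    have g0 : ∀ e, e ≠ iB ∧ e ≠ iM ∧ e ≠ iT → f e = g e := fun e he => h e (by simpa using he)
    have c1 := Xing.ofSides_colored_unique (hf.2 0) (hg.2 0) (g0 _ h1) (g0 _ h3)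
    have c3 := Xing.ofSides_colored_unique (hf.2 2) (hg.2 2) (g0 _ h2) (g0 _ h5)
    funext e
    by_cases he : e ∈ ({iB, iM, iT} : Set E)
    · rcases he with rfl | rfl | rfl
      · exact c1.1
      · exact c1.2
      · exact c3.2
    · exact h e he
  refine matrix_eq_of_agree β {iB, iM, iT} rfl rfl ?_ ?_ ?_ ?_ (huniq _ _ _ _ _ _ _ _ _ _ h1 h2 h3 h5)
    (huniq _ _ _ _ _ _ _ _ _ _ h2 h1 h4 h6) ?_
  · rintro (h | h | h)
    exacts [hB.2.2.1 h, hM.2.2.1 h, hT.2.2.1 h]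
  · rintro (h | h | h)
    exacts [hB.2.2.2 h, hM.2.2.2 h, hT.2.2.2 h]
  · intro f hf
    obtain ⟨f', x, y, z, ha, hb, -⟩ := hex _ _ _ _ _ _ _ _ _ _ h1 h2 h3 h4 h5 h6 f hf
    exact ⟨f', ha, hb⟩
  · intro f hf
    obtain ⟨f', x, y, z, ha, hb, -⟩ := hex _ _ _ _ _ _ _ _ _ _ h2 h1 h4 h3 h6 h5 f hf
    simp only [Bool.not_not] at hb
    exact ⟨f', ha, hb⟩
  · intro f f' hf hf' hag
    obtain ⟨f₁, x, y, z, ha, hb, hi, hi', e1, e2, e3, e4, e5, e6⟩ :=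
      hex _ _ _ _ _ _ _ _ _ _ h1 h2 h3 h4 h5 h6 f hf
    obtain rfl : f' = f₁ := huniq _ _ _ _ _ _ _ _ _ _ h2 h1 h4 h6 _ _ hf' hb fun e he => by
      rw [hag e he, ha e he]
    rw [value_add, value_add]
    refine Finset.sum_congr rfl fun σ _ => ?_
    rw [Finset.prod_congr rfl fun c _ => weight_congr hm β hag c (σ c)]
    congr 1
    rw [hexagon_localSum β f (hB.isolated σ) (hM.isolated σ) (hT.isolated σ) hBM hBT hMT
      h1 h2 h3 h4 h5 h6 rfl rfl rfl rfl rfl rfl rfl,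
      hexagon_localSum β f' (hB.isolated σ) (hM.isolated σ) (hT.isolated σ) hBM hBT hMT
      h2 h1 h4 h3 h6 h5 rfl rfl rfl rfl rfl rfl rfl]
    have g0 : ∀ e, e ≠ iB ∧ e ≠ iM ∧ e ≠ iT → f' e = f e := fun e he => hag e (by simpa using he)
    have e1' := g0 _ h1
    have e2' := g0 _ h2
    have e3' := g0 _ h3
    have e4' := g0 _ h4
    have e5' := g0 _ h5
    have e6' := g0 _ h6
    rw [e1] at e1'
    rw [e2] at e2'
    rw [e3] at e3'
    rw [e4] at e4'
    rw [e5] at e5'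
    rw [e6] at e6'
    have W := hexagon_weight β (s := s) hi e1 e2 e3 e4 e5 e6
    have W' := hexagon_weight β (vB := !vB) (vM := !vM) (vT := !vT) (s := !s) (B1 := B2) (B2 := B1)
      (M1 := M2) (M2 := M1) (T1 := T2) (T2 := T1) hi' (by rw [Bool.not_not, e2'])
      (by rw [Bool.not_not, e1']) (by rw [Bool.not_not, e4']) (by rw [Bool.not_not, e3'])
      (by rw [Bool.not_not, e6']) (by rw [Bool.not_not, e5'])
    simp only [(W _).1, (W _).2.1, (W _).2.2, (W' _).1, (W' _).2.1, (W' _).2.2]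
    obtain ⟨m1, m2, m3, m4⟩ := bracket_identities β x y z vB vM vT s
    -- The same identity with the two triangles interchanged.
    obtain ⟨-, -, -, m5⟩ := bracket_identities β x y z (!vB) (!vM) (!vT) (!s)
    simp only [Bool.not_not] at m5
    -- The move preserves the sign of each crossing, so the writhe factors agree.
    have w1 : signed ((!vT) == (!s)) β.w = signed (vT == s) β.w := by cases vT <;> cases s <;> rfl
    have w2 : signed ((!vB) == (!s)) β.w = signed (vB == s) β.w := by cases vB <;> cases s <;> rfl
    have w3 : signed ((!vM) != (!s)) β.w = signed (vM != s) β.w := by cases vM <;> cases s <;> rfl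
    rw [w1, w2, w3]
    have g1 : (G.stateSetoid σ).gen [(B2, M2), (B1, M1), (T2, T1)]
        = (G.stateSetoid σ).gen [(B1, M1), (B2, M2), (T1, T2)] :=
      Setoid.gen_congr fun t => by simp; grind
    have g2 : (G.stateSetoid σ).gen [(M1, T1), (M2, T2), (B2, B1)]
        = (G.stateSetoid σ).gen [(M2, T2), (M1, T1), (B1, B2)] :=
      Setoid.gen_congr fun t => by simp; grind
    have g3 : (G.stateSetoid σ).gen [(B1, T2), (M2, M1), (B2, T1)]
        = (G.stateSetoid σ).gen [(B2, T1), (M1, M2), (B1, T2)] :=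
      Setoid.gen_congr fun t => by simp; grind
    rw [g1, g2, g3]
    simp only [Units.val_mul]
    exact hexagon_sum_eq m1 m2 m3 m4 m5

end Circuit

/-! ### The second and the first Reidemeister move on circuits -/

namespace Circuit

open Biquandle

variable {E C X R : Type*} [Biquandle X] [CommRing R]

/-- The common factor cancels, and inverting `A` and `B` only interchanges the two summands. -/
theorem signed_ratio (ε : Bool) (A B W : Rˣ) :
    ((signed ε A * W : Rˣ) : R) * ((signed ε B * W)⁻¹ : Rˣ) +
      ((signed ε B * W : Rˣ) : R) * ((signed ε A * W)⁻¹ : Rˣ) = A * (B⁻¹ : Rˣ) + (A⁻¹ : Rˣ) * B := by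
  rw [← Units.val_mul, ← Units.val_mul, ← Units.val_mul, ← Units.val_mul]
  have h : ∀ a b : Rˣ, a * W * (b * W)⁻¹ = a * b⁻¹ := fun a b => by simp [mul_assoc]
  rw [h, h]
  cases ε
  · simp [signed, mul_comm, add_comm]
  · simp [signed, mul_comm]

/-- Inserting the formula for `δ`, the sum `A * δ + B` collapses to `-A ^ 2 * B⁻¹`, and the version
with inverses to the inverse of this unit. This is where the normalization by `w` is needed. -/
theorem signed_kink {A B w : Rˣ} {δ : R}
    (hδ : -((A : R) * (B⁻¹ : Rˣ)) - (A⁻¹ : Rˣ) * (B : R) = δ) (hw : -(A ^ 2 * B⁻¹) = w) (ε : Bool) :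
    ((signed ε A * (signed ε w)⁻¹ : Rˣ) : R) * δ + ((signed ε B * (signed ε w)⁻¹ : Rˣ) : R) = 1 := by
  have hA := A.mul_inv
  have hB := B.mul_inv
  have hW := w.mul_inv
  have hw' : (w : R) = -((A : R) ^ 2 * (B⁻¹ : Rˣ)) := by rw [← hw]; simp
  cases ε <;> simp only [signed, cond_true, cond_false, Units.val_mul, inv_inv, ← hδ]
  · linear_combination -((w : R) * (B⁻¹ : Rˣ)) * hA - ((A⁻¹ : Rˣ) : R) ^ 2 * B * hw' +
      ((A⁻¹ : Rˣ) : R) ^ 2 * (A : R) ^ 2 * hB + (A * (A⁻¹ : Rˣ) + 1) * hA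
  · linear_combination hW - (w⁻¹ : Rˣ) * hw' - (w⁻¹ : Rˣ) * B * hA

/-- The second Reidemeister move: two strands running through `o1`, `m0`, `o2` and `u1`, `m1`, `u2`
without crossings, or with two crossings of opposite signs. -/
theorem matrix_addBond_eq_add_pair [Fintype E] [Fintype C] [DecidableEq C] [Fintype X]
    (β : BiquandleBracket X R) (G : Circuit E C) (vu vo g : Bool) {m0 m1 o1 o2 u1 u2 : E}
    (h0 : G.Avoids m0) (h1 : G.Avoids m1) (hm : m0 ≠ m1) (ho1 : o1 ≠ m0 ∧ o1 ≠ m1)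
    (ho2 : o2 ≠ m0 ∧ o2 ≠ m1) (hu1 : u1 ≠ m0 ∧ u1 ≠ m1) (hu2 : u2 ≠ m0 ∧ u2 ≠ m1)
    {r : E → E → Prop}
    (hr : ∀ t : Setoid E, Relation.EqvGen.setoid r ≤ t ↔
      (Quotient.mk t m0 = Quotient.mk t o1 ∧ Quotient.mk t m0 = Quotient.mk t o2) ∧
      (Quotient.mk t m1 = Quotient.mk t u1 ∧ Quotient.mk t m1 = Quotient.mk t u2)) :
    (G.addBond r).matrix β = (G.add ![Xing.ofSides vu vo m1 u1 m0 o1 g,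
      Xing.ofSides vu vo m1 u2 m0 o2 (!g)]).matrix β := by
  classical
  set L : Fin 2 → Xing E := ![Xing.ofSides vu vo m1 u1 m0 o1 g,
      Xing.ofSides vu vo m1 u2 m0 o2 (!g)] with hL
  have hav : ∀ e ∈ ({m0, m1} : Set E), G.Avoids e := by
    rintro e (rfl | rfl) <;> assumption
  have hD : ∀ f : E → X, (G.addBond r).IsColoring f ↔ G.IsColoring f ∧
      (f m0 = f o1 ∧ f m0 = f o2) ∧ (f m1 = f u1 ∧ f m1 = f u2) := by
    intro f
    rw [isColoring_addBond, hr]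
    simp only [ker_mk_eq]
  have hD' : ∀ f : E → X, (G.add L).IsColoring f → G.IsColoring f ∧ f o1 = f o2 ∧ f u1 = f u2 ∧
      (L 0).Colored f := by
    intro f hf
    rw [isColoring_add] at hf
    have c1 := hf.2 0
    have c2 := hf.2 1
    -- The two crossings share their inner semiarcs, which determine the outer colors once inner and
    -- outer ends are interchanged.
    have e : ∀ (o u : E) (pos : Bool), (Xing.ofSides vu vo m1 u m0 o pos).Colored f →
        (Xing.ofSides (!vu) (!vo) (0 : Fin 4) 1 2 3 g).Colored ![f u, f m1, f o, f m0] := by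
      intro o u pos h
      rw [← Xing.ofSides_swap] at h
      cases vu <;> cases vo <;> exact h
    have := Xing.ofSides_colored_unique (e _ _ _ c1) (e _ _ _ c2) rfl rfl
    exact ⟨hf.1, this.2, this.1, c1⟩
  have heq : ∀ (f g : E → X), (∀ e, e ∉ ({m0, m1} : Set E) → f e = g e) → f m0 = g m0 →
      f m1 = g m1 → f = g := by
    intro f g h e0 e1
    funext e
    by_cases he : e ∈ ({m0, m1} : Set E)
    · rcases he with rfl | rfl <;> assumption
    · exact h e he
  refine matrix_eq_of_agree β {m0, m1} rfl rfl ?_ ?_ ?_ ?_ ?_ ?_ ?_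
  · rintro (h | h)
    exacts [h0.2.2.1 h, h1.2.2.1 h]
  · rintro (h | h)
    exacts [h0.2.2.2 h, h1.2.2.2 h]
  · intro f hf
    rw [hD] at hf
    obtain ⟨hG, ⟨e1, e2⟩, e3, e4⟩ := hf
    obtain ⟨a, b, hab⟩ := Xing.ofSides_colored_exists (E := E) vu vo (f u1) (f o1)
    let f' : E → X := fun e => if e = m0 then b else if e = m1 then a else f e
    have g0 : ∀ e, e ≠ m0 ∧ e ≠ m1 → f' e = f e := by
      rintro e ⟨ha, hb⟩
      simp [f', ha, hb]
    have hag : ∀ e, e ∉ ({m0, m1} : Set E) → f' e = f e := fun e he => g0 e (by simpa using he)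
    have gm0 : f' m0 = b := by simp [f']
    have gm1 : f' m1 = a := by simp [f', hm.symm]
    refine ⟨f', hag, ?_⟩
    rw [isColoring_add]
    refine ⟨hG.congr hav hag, ?_⟩
    rw [Fin.forall_fin_two]
    exact ⟨hab _ _ _ _ _ _ (g0 _ hu1) (g0 _ ho1) gm1 gm0,
      hab _ _ _ _ _ _ ((g0 _ hu2).trans (e4.symm.trans e3)) ((g0 _ ho2).trans (e2.symm.trans e1))
        gm1 gm0⟩
  · intro f hf
    obtain ⟨hG, e1, e2, -⟩ := hD' f hf
    let f' : E → X := fun e => if e = m0 then f o1 else if e = m1 then f u1 else f e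
    have g0 : ∀ e, e ≠ m0 ∧ e ≠ m1 → f' e = f e := by
      rintro e ⟨ha, hb⟩
      simp [f', ha, hb]
    have hag : ∀ e, e ∉ ({m0, m1} : Set E) → f' e = f e := fun e he => g0 e (by simpa using he)
    have gm0 : f' m0 = f o1 := by simp [f']
    have gm1 : f' m1 = f u1 := by simp [f', hm.symm]
    refine ⟨f', hag, ?_⟩
    rw [hD, gm0, gm1, g0 _ ho1, g0 _ ho2, g0 _ hu1, g0 _ hu2]
    exact ⟨hG.congr hav hag, ⟨rfl, e1⟩, rfl, e2⟩
  · intro f g hf hg h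
    rw [hD] at hf hg
    refine heq f g h ?_ ?_
    · rw [hf.2.1.1, hg.2.1.1, h _ (by simpa using ho1)]
    · rw [hf.2.2.1, hg.2.2.1, h _ (by simpa using hu1)]
  · intro f g hf hg h
    have := Xing.ofSides_colored_unique (hD' f hf).2.2.2 (hD' g hg).2.2.2
      (h _ (by simpa using hu1)) (h _ (by simpa using ho1))
    exact heq f g h this.2 this.1
  · intro f f' hf hf' hag
    obtain ⟨hG, e1, e2, -⟩ := hD' f' hf'
    rw [value_add, value_addBond]
    refine Finset.sum_congr rfl fun σ _ => ?_
    rw [Finset.prod_congr rfl fun c _ => weight_congr hav β hag c (σ c)]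
    congr 1
    have i0 := h0.isolated σ
    have i1 := h1.isolated σ
    generalize G.stateSetoid σ = t at *
    have st : ∀ (σ : Fin 2 → Bool) (l : List (E × E)),
        (∀ u : Setoid E, (∀ i, (L i).smoothing (σ i) ≤ u)
          ↔ ∀ p ∈ l, Quotient.mk u p.1 = Quotient.mk u p.2) →
        t ⊔ ⨆ i, (L i).smoothing (σ i) = t.gen l :=
      fun σ l h => Setoid.sup_eq_gen fun u => by rw [iSup_le_iff, h]
    have skk := st ![vu != vo, vu != vo] [(m0, m1), (u1, o1), (u2, o2)] (by
      intro u
      simp only [Fin.forall_fin_succ, hL, Matrix.cons_val_zero, Matrix.cons_val_succ,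
        Xing.ofSides_corner, List.forall_mem_cons, List.not_mem_nil,
        IsEmpty.forall_iff, implies_true, and_true]
      grind)
    have skl := st ![vu != vo, !(vu != vo)] [(m0, u2), (m1, u2), (u1, o1), (u2, o2)] (by
      intro u
      simp only [Fin.forall_fin_succ, hL, Matrix.cons_val_zero, Matrix.cons_val_succ,
        Xing.ofSides_corner, Xing.ofSides_cross, List.forall_mem_cons, List.not_mem_nil,
        IsEmpty.forall_iff, implies_true, and_true]
      grind)
    have slk := st ![!(vu != vo), vu != vo] [(m0, u1), (m1, u1), (u1, o1), (u2, o2)] (by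
      intro u
      simp only [Fin.forall_fin_succ, hL, Matrix.cons_val_zero, Matrix.cons_val_succ,
        Xing.ofSides_corner, Xing.ofSides_cross, List.forall_mem_cons, List.not_mem_nil,
        IsEmpty.forall_iff, implies_true, and_true]
      grind)
    have sll := st ![!(vu != vo), !(vu != vo)] [(m0, u1), (m1, o1), (u1, u2), (o1, o2)] (by
      intro u
      simp only [Fin.forall_fin_succ, hL, Matrix.cons_val_zero, Matrix.cons_val_succ,
        Xing.ofSides_cross, List.forall_mem_cons, List.not_mem_nil,
        IsEmpty.forall_iff, implies_true, and_true]
      grind)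
    have sD : t ⊔ Relation.EqvGen.setoid r = t.gen [(m0, o1), (m1, u1), (u1, u2), (o1, o2)] :=
      Setoid.sup_eq_gen fun u => by
        rw [hr]
        simp only [List.forall_mem_cons, List.not_mem_nil, IsEmpty.forall_iff, implies_true,
          and_true]
        grind
    have nkk := Setoid.numClasses_gen_cons (l := [(u1, o1), (u2, o2)]) i0 (by simp; tauto) hm
    have two : ∀ (l : List (E × E)) (a b : E), (∀ p ∈ l, p.1 ≠ m0 ∧ p.2 ≠ m0) →
        (∀ p ∈ l, p.1 ≠ m1 ∧ p.2 ≠ m1) → a ≠ m0 ∧ a ≠ m1 → b ≠ m0 ∧ b ≠ m1 →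
        (t.gen ((m0, a) :: (m1, b) :: l)).numClasses + 2 = (t.gen l).numClasses :=
      fun l a b hl hl' ha hb => Setoid.numClasses_gen_cons₂ i0 i1 hl hl' hm ha.1.symm
        hb.1.symm hb.2.symm
    have nkl := two [(u1, o1), (u2, o2)] u2 u2 (by simp; tauto) (by simp; tauto) hu2 hu2
    have nlk := two [(u1, o1), (u2, o2)] u1 u1 (by simp; tauto) (by simp; tauto) hu1 hu1
    have nll := two [(u1, u2), (o1, o2)] u1 o1 (by simp; tauto) (by simp; tauto) hu1 ho1
    have nD := two [(u1, u2), (o1, o2)] o1 u1 (by simp; tauto) (by simp; tauto) ho1 hu1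
    rw [Circuit.localSum, sum_fin_two_bool _ (vu != vo) (vu != vo), skk, skl, slk, sll, sD]
    simp only [Fin.prod_univ_two, Matrix.cons_val_zero, Matrix.cons_val_one,
      Units.val_mul]
    -- The outer colors agree at the two crossings, hence so do the labels, and the signs are
    -- opposite.
    have hw : ∀ b, (L 1).weight β f' b = ((L 0).weight β f' b)⁻¹ := by
      intro b
      rw [Xing.weight_eq_signed, Xing.weight_eq_signed]
      simp only [hL, Matrix.cons_val_zero, Matrix.cons_val_one, Xing.ofSides]
      cases g <;> cases vu <;> cases vo <;> simp [signed, e1, e2, mul_comm]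
    -- The two mixed states contribute `-β.δ` together. This cancels the loop of the state with both
    -- corners cut off, and the remaining state has weight one.
    have hkl : ((L 0).weight β f' (vu != vo) : R) * (((L 0).weight β f' (!(vu != vo)))⁻¹ : Rˣ) +
        (L 0).weight β f' (!(vu != vo)) * (((L 0).weight β f' (vu != vo))⁻¹ : Rˣ) = -β.δ := by
      rw [Xing.weight_eq_signed, Xing.weight_eq_signed]
      rw [← β.δ_eq (f' (L 0).ru) (f' (L 0).ro)]
      have := signed_ratio (L 0).pos (β.A (f' (L 0).ru) (f' (L 0).ro))
        (β.B (f' (L 0).ru) (f' (L 0).ro)) (signed (L 0).pos β.w)⁻¹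
      cases vu != vo <;> simp only [Bool.not_true, Bool.not_false, cond_true, cond_false] <;>
        linear_combination this
    rw [hw, hw]
    rw [show (t.gen [(m0, m1), (u1, o1), (u2, o2)]).numClasses
        = (t.gen [(m0, u1), (m1, u1), (u1, o1), (u2, o2)]).numClasses + 1 by omega,
      show (t.gen [(m0, u2), (m1, u2), (u1, o1), (u2, o2)]).numClasses
        = (t.gen [(m0, u1), (m1, u1), (u1, o1), (u2, o2)]).numClasses by omega,
      show (t.gen [(m0, u1), (m1, o1), (u1, u2), (o1, o2)]).numClasses
        = (t.gen [(m0, o1), (m1, u1), (u1, u2), (o1, o2)]).numClasses by omega]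
    have hu := ((L 0).weight β f' (vu != vo)).mul_inv
    have hu' := ((L 0).weight β f' (!(vu != vo))).mul_inv
    linear_combination (β.δ * hu + hkl) *
      β.δ ^ (t.gen [(m0, u1), (m1, u1), (u1, o1), (u2, o2)]).numClasses +
      hu' * β.δ ^ (t.gen [(m0, o1), (m1, u1), (u1, u2), (o1, o2)]).numClasses

/-- By `under_self` the sideways map carries the diagonal into itself. Its injectivity makes `x ↦
utri x x` injective, and finiteness makes it onto. -/
theorem _root_.Biquandle.exists_diagonal {X : Type*} [Finite X] [Biquandle X] (z : X) :
    ∃ x, utri x x = z := by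
  have hinj : Function.Injective fun x : X => utri x x := by
    intro x y h
    have := @(sideways_bijective (X := X)).1 (x, x) (y, y) (by
      simp only at h ⊢
      rw [← under_self, ← under_self, h])
    exact congrArg Prod.fst this
  exact (Finite.injective_iff_surjective.1 hinj) z

/-- The sideways image of `(x, y)` lies on the diagonal and is therefore also the image of a
diagonal pair; injectivity finishes. This equates the colors at the ends of a kink whose loop
semiarc is on the left of the crossing. -/
theorem _root_.Biquandle.eq_of_side_eq {X : Type*} [Finite X] [Biquandle X] {x y : X}
    (h : otri y x = utri x y) : x = y := by
  obtain ⟨z, hz⟩ := Biquandle.exists_diagonal (utri x y)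
  have := @(sideways_bijective (X := X)).1 (x, y) (z, z) (by
    simp only
    rw [← under_self, hz, h])
  exact (congrArg Prod.fst this).trans (congrArg Prod.snd this).symm

/-- The first Reidemeister move: a strand running through `x`, `m`, `y` without or with a
self-crossing. -/
theorem matrix_addBond_eq_add_kink [Fintype E] [Fintype C] [DecidableEq C] [Fintype X]
    (β : BiquandleBracket X R) (G : Circuit E C) (v pos : Bool) {m x y : E}
    (hm : G.Avoids m) (hx : x ≠ m) (hy : y ≠ m) {r : E → E → Prop}
    (hr : ∀ t : Setoid E, Relation.EqvGen.setoid r ≤ t ↔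
      Quotient.mk t m = Quotient.mk t x ∧ Quotient.mk t m = Quotient.mk t y) :
    (G.addBond r).matrix β =
      (G.add fun _ : Unit => Xing.ofSides v v m x m y pos).matrix β := by
  classical
  set c := Xing.ofSides v v m x m y pos with hc
  have hav : ∀ e ∈ ({m} : Set E), G.Avoids e := by
    rintro e rfl
    exact hm
  have hD : ∀ f : E → X, (G.addBond r).IsColoring f ↔ G.IsColoring f ∧ f m = f x ∧ f m = f y := by
    intro f
    rw [isColoring_addBond, hr]
    simp only [ker_mk_eq]
  have hD' : ∀ f : E → X, (G.add fun _ : Unit => c).IsColoring f → G.IsColoring f ∧ f x = f y ∧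
      c.Colored f := by
    intro f hf
    rw [isColoring_add] at hf
    have h := hf.2 ()
    refine ⟨hf.1, ?_, h⟩
    cases v
    · simp only [hc, Xing.ofSides, Xing.Colored, cond_false] at h
      exact Biquandle.eq_of_side_eq (h.2.symm.trans h.1)
    · simp only [hc, Xing.ofSides, Xing.Colored, cond_true] at h
      rw [h.1, h.2, under_self]
  have heq : ∀ (f g : E → X), (∀ e, e ∉ ({m} : Set E) → f e = g e) → f m = g m → f = g := by
    intro f g h e0
    funext e
    by_cases he : e = m
    · rw [he, e0]
    · exact h e he
  refine matrix_eq_of_agree β {m} rfl rfl hm.2.2.1 hm.2.2.2 ?_ ?_ ?_ ?_ ?_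
  · intro f hf
    rw [hD] at hf
    obtain ⟨hG, e1, e2⟩ := hf
    obtain ⟨z, hz⟩ := Biquandle.exists_diagonal (f x)
    -- A loop on the left has its color forced by the ends; for a loop on the right, the diagonal
    -- map has to be inverted.
    let f' : E → X := fun e => if e = m then (bif v then z else utri (f x) (f x)) else f e
    have g0 : ∀ e, e ≠ m → f' e = f e := fun e he => by simp [f', he]
    have gm : f' m = bif v then z else utri (f x) (f x) := by simp [f']
    refine ⟨f', g0, ?_⟩
    rw [isColoring_add]
    refine ⟨hG.congr hav g0, fun _ => ?_⟩
    have hxy : f y = f x := e2.symm.trans e1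
    cases v
    · simp only [hc, Xing.ofSides, Xing.Colored, cond_false, gm, g0 x hx, g0 y hy, hxy]
      exact ⟨trivial, under_self _⟩
    · simp only [hc, Xing.ofSides, Xing.Colored, cond_true, gm, g0 x hx, g0 y hy, hxy,
        ← under_self, hz]
      exact ⟨trivial, trivial⟩
  · intro f hf
    obtain ⟨hG, e1, -⟩ := hD' f hf
    let f' : E → X := fun e => if e = m then f x else f e
    have g0 : ∀ e, e ≠ m → f' e = f e := fun e he => by simp [f', he]
    have gm : f' m = f x := by simp [f']
    refine ⟨f', g0, ?_⟩
    rw [hD, gm, g0 x hx, g0 y hy]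
    exact ⟨hG.congr hav g0, rfl, e1⟩
  · intro f g hf hg h
    rw [hD] at hf hg
    refine heq f g h ?_
    rw [hf.2.1, hg.2.1, h x hx]
  · intro f g hf hg h
    exact heq f g h (Xing.ofSides_colored_unique (hD' f hf).2.2 (hD' g hg).2.2 (h x hx) (h y hy)).1
  · intro f f' hf hf' hag
    obtain ⟨hG, e1, hcol⟩ := hD' f' hf'
    rw [value_add, value_addBond]
    refine Finset.sum_congr rfl fun σ _ => ?_
    rw [Finset.prod_congr rfl fun c _ => weight_congr hav β hag c (σ c)]
    congr 1
    have im := hm.isolated σ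
    generalize G.stateSetoid σ = t at *
    -- The oriented smoothing leaves `m` as a separate component, which produces the factor `δ` of
    -- `signed_kink`.
    have s0 : t ⊔ c.smoothing false = t.gen [(x, y)] := Setoid.sup_eq_gen fun u => by
      have : (v != v) = false := by simp
      rw [← this, Xing.ofSides_corner]
      simp
    have s1 : t ⊔ c.smoothing true = t.gen [(m, x), (x, y)] := Setoid.sup_eq_gen fun u => by
      have : (!(v != v)) = true := by simp
      rw [← this, Xing.ofSides_cross]
      simp
      grind
    have sD : t ⊔ Relation.EqvGen.setoid r = t.gen [(m, x), (x, y)] :=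
      Setoid.sup_eq_gen fun u => by
        rw [hr]
        simp
        grind
    have n := Setoid.numClasses_gen_cons (l := [(x, y)]) (a := x) im (by simp [hx, hy]) hx.symm
    have hsum : Circuit.localSum β (fun _ : Unit => c) f' t =
        c.weight β f' false * β.δ ^ (t ⊔ c.smoothing false).numClasses +
        c.weight β f' true * β.δ ^ (t ⊔ c.smoothing true).numClasses := by
      rw [Circuit.localSum, Fintype.sum_equiv (Equiv.funUnique Unit Bool) _
        (fun b => (c.weight β f' b : R) * β.δ ^ (t ⊔ c.smoothing b).numClasses)]
      · rw [Fintype.sum_bool, add_comm]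
      · intro σ
        simp
    have hlab : f' c.ru = f' c.ro := by
      cases v
      · exact e1
      · rfl
    rw [hsum, s0, s1, sD, ← n, Xing.weight_eq_signed, Xing.weight_eq_signed, hlab]
    simp only [cond_false, cond_true]
    have key := signed_kink (β.δ_eq (f' c.ro) (f' c.ro)) (β.w_eq (f' c.ro)) c.pos
    linear_combination β.δ ^ (t.gen [(m, x), (x, y)]).numClasses * key

end Circuit

/-! ### Semiarcs cut out by a finite set of parameters -/

namespace Finset

/-- The piece that ends at `t` when a line is cut at the points of `P`. -/
noncomputable def pieceBefore (P : Finset ℝ) (t : ℝ) : Fin (P.card + 1) :=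
  ⟨(P.filter (· < t)).card, Nat.lt_succ_of_le (card_filter_le _ _)⟩

/-- The piece that starts at `t` when a line is cut at the points of `P`. -/
noncomputable def pieceAfter (P : Finset ℝ) (t : ℝ) : Fin (P.card + 1) :=
  ⟨(P.filter (· ≤ t)).card, Nat.lt_succ_of_le (card_filter_le _ _)⟩

variable {P : Finset ℝ}

theorem card_filter_lt_lt_iff {p p' : ℝ} (hp : p ∈ P) :
    (P.filter (· < p)).card < (P.filter (· < p')).card ↔ p < p' := by
  constructor
  · intro h
    by_contra hle
    rw [not_lt] at hle
    exact absurd h (not_lt.2 (card_le_card (monotone_filter_right P fun x _ hx =>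
      lt_of_lt_of_le hx hle)))
  · intro h
    refine card_lt_card ⟨monotone_filter_right P fun x _ hx => lt_trans hx h, fun hs => ?_⟩
    have := hs (mem_filter.2 ⟨hp, h⟩)
    simp at this

theorem card_filter_lt_inj {p p' : ℝ} (hp : p ∈ P) (hp' : p' ∈ P)
    (h : (P.filter (· < p)).card = (P.filter (· < p')).card) : p = p' := by
  have h1 := card_filter_lt_lt_iff (P := P) (p := p) (p' := p') hp
  have h2 := card_filter_lt_lt_iff (P := P) (p := p') (p' := p) hp'
  rcases lt_trichotomy p p' with hlt | heq | hgt
  · have := h1.2 hlt; omega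
  · exact heq
  · have := h2.2 hgt; omega

theorem card_filter_le_eq {p : ℝ} (hp : p ∈ P) :
    (P.filter (· ≤ p)).card = (P.filter (· < p)).card + 1 := by
  classical
  have : P.filter (· ≤ p) = insert p (P.filter (· < p)) := by
    ext x
    simp only [mem_filter, mem_insert, le_iff_lt_or_eq]
    constructor
    · rintro ⟨h1, h2 | h2⟩
      · exact Or.inr ⟨h1, h2⟩
      · exact Or.inl h2
    · rintro (rfl | ⟨h1, h2⟩)
      · exact ⟨hp, Or.inr rfl⟩
      · exact ⟨h1, Or.inl h2⟩
  rw [this, card_insert_of_notMem (by simp)]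

/-- The rank of a point is injective on `P` and takes values below `P.card`, so counting makes it
onto. -/
theorem exists_card_filter_lt_eq {k : ℕ} (hk : k < P.card) :
    ∃ p ∈ P, (P.filter (· < p)).card = k := by
  have hmaps : ∀ p ∈ P, (P.filter (· < p)).card ∈ range P.card := by
    intro p hp
    rw [mem_range]
    refine card_lt_card ⟨filter_subset _ _, fun hs => ?_⟩
    have := hs hp
    simp at this
  have := surj_on_of_inj_on_of_card_le (fun p _ => (P.filter (· < p)).card) hmaps
    (fun p p' hp hp' h => card_filter_lt_inj hp hp' h) (by simp) k (mem_range.2 hk)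
  obtain ⟨p, hp, h⟩ := this
  exact ⟨p, hp, h.symm⟩

theorem pieceAfter_val {p : ℝ} (hp : p ∈ P) :
    (P.pieceAfter p : ℕ) = (P.pieceBefore p : ℕ) + 1 := card_filter_le_eq hp

end Finset

/-! ### The circuit of a diagram -/

namespace Xing

variable {E : Type*}

/-- The crossing with given incoming and outgoing semiarcs of the over- and under-strand. -/
def ofPassages (overIn overOut underIn underOut : E) (pos : Bool) : Xing E :=
  ⟨bif pos then underIn else underOut, bif pos then overOut else overIn,
    bif pos then underOut else underIn, bif pos then overIn else overOut, pos⟩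

end Xing

namespace KnotoidDiagram

variable {M : Type*} [TopologicalSpace M] [ChartedSpace (EuclideanSpace ℝ (Fin 2)) M]

theorem fst_mem_passages {D : KnotoidDiagram M} {c : ℝ × ℝ} (h : c ∈ D.crossings) :
    c.1 ∈ D.passages := by
  classical
  exact Finset.mem_union_left _ (Finset.mem_image_of_mem _ h)

theorem snd_mem_passages {D : KnotoidDiagram M} {c : ℝ × ℝ} (h : c ∈ D.crossings) :
    c.2 ∈ D.passages := by
  classical
  exact Finset.mem_union_right _ (Finset.mem_image_of_mem _ h)

variable [IsManifold (𝓡 2) ∞ M] {X R : Type*} [Biquandle X] [CommRing R]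

open Classical in
/-- The circuit of a diagram whose passages are moved by `ψ` into a finite set `P`, the remaining
points of `P` being trivial junctions. -/
noncomputable def circuit (o : SurfaceOrientation M) (D : KnotoidDiagram M) (P : Finset ℝ)
    (ψ : ℝ → ℝ) {C : Type*} (e : C → ℝ × ℝ) : Circuit (Fin (P.card + 1)) C where
  cr c := Xing.ofPassages (P.pieceBefore (ψ (e c).1)) (P.pieceAfter (ψ (e c).1))
    (P.pieceBefore (ψ (e c).2)) (P.pieceAfter (ψ (e c).2)) (decide (D.IsPositive o (e c)))
  bond a b := ∃ p ∈ P, p ∉ ψ '' D.passages ∧ a = P.pieceBefore p ∧ b = P.pieceAfter p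
  tail := 0
  head := Fin.last _

/-- The circuit of a diagram. -/
noncomputable def baseCircuit (o : SurfaceOrientation M) (D : KnotoidDiagram M) :
    Circuit D.Semiarc {c // c ∈ D.crossings} :=
  D.circuit o D.passages id Subtype.val

theorem baseCircuit_cr (o : SurfaceOrientation M) (D : KnotoidDiagram M)
    (c : {c // c ∈ D.crossings}) : (D.baseCircuit o).cr c =
    open Classical in Xing.ofPassages (D.before c.1.1) (D.after c.1.1) (D.before c.1.2)
      (D.after c.1.2) (decide (D.IsPositive o c.1)) := rfl

theorem baseCircuit_bond (o : SurfaceOrientation M) (D : KnotoidDiagram M) (a b : D.Semiarc) :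
    ¬ (D.baseCircuit o).bond a b := by
  rintro ⟨p, hp, h, -⟩
  exact h (by simpa using hp)

theorem isColoring_baseCircuit (o : SurfaceOrientation M) (D : KnotoidDiagram M)
    (f : D.Semiarc → X) : (D.baseCircuit o).IsColoring f ↔ D.IsColoring o f := by
  classical
  rw [Circuit.IsColoring, IsColoring]
  constructor
  · rintro ⟨h, -⟩ c hc
    have hcol := h ⟨c, hc⟩
    rw [baseCircuit_cr] at hcol
    constructor
    · intro hp
      simpa [Xing.ofPassages, Xing.Colored, labelX, labelY, hp] using hcol
    · intro hp
      simpa [Xing.ofPassages, Xing.Colored, labelX, labelY, hp] using hcol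
  · intro h
    refine ⟨fun c => ?_, fun a b hab => absurd hab (D.baseCircuit_bond o a b)⟩
    obtain ⟨h1, h2⟩ := h c.1 c.2
    rw [baseCircuit_cr]
    by_cases hp : D.IsPositive o c.1
    · simpa [Xing.ofPassages, Xing.Colored, labelX, labelY, hp] using h1 hp
    · simpa [Xing.ofPassages, Xing.Colored, labelX, labelY, hp] using h2 hp

/-- The relation `Joined` names the ends at a crossing by their direction, `smoothing` by their
side. The translation depends on the sign, but the pairs that get joined are the same. -/
theorem stateComponents_eq (o : SurfaceOrientation M) (D : KnotoidDiagram M)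
    (σ : Finset (ℝ × ℝ)) (τ : {c // c ∈ D.crossings} → Bool) (hτ : ∀ c, τ c = true ↔ c.1 ∈ σ) :
    D.stateComponents σ = ((D.baseCircuit o).stateSetoid τ).numClasses := by
  rw [stateComponents, Setoid.card_quot]
  congr 1
  apply le_antisymm
  · rw [Setoid.eqvGen_le_iff]
    rintro a b ⟨c, hc, h⟩
    have hle : ((D.baseCircuit o).cr ⟨c, hc⟩).smoothing (τ ⟨c, hc⟩)
        ≤ (D.baseCircuit o).stateSetoid τ :=
      le_sup_of_le_right (le_iSup
        (fun c => ((D.baseCircuit o).cr c).smoothing (τ c)) ⟨c, hc⟩)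
    rw [Xing.smoothing_le_iff, baseCircuit_cr] at hle
    have h0 := hτ ⟨c, hc⟩
    rw [← Quotient.eq]
    by_cases hp : D.IsPositive o c <;> cases ht : τ ⟨c, hc⟩ <;>
      simp only [ht, Xing.ofPassages, hp, decide_true, decide_false, cond_true, cond_false]
        at hle h0 <;> simp only [Bool.false_eq_true, false_iff, true_iff] at h0 <;>
      rcases h with ⟨h1, ⟨rfl, rfl⟩ | ⟨rfl, rfl⟩⟩ | ⟨h1, ⟨rfl, rfl⟩ | ⟨rfl, rfl⟩⟩ <;>
      first
        | exact absurd h1 h0 | exact absurd h0 h1 | exact hle.1 | exact hle.2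
        | exact hle.1.symm | exact hle.2.symm
  · refine sup_le ?_ (iSup_le fun c => ?_)
    · rw [Setoid.eqvGen_le_iff]
      intro a b hab
      exact absurd hab (D.baseCircuit_bond o a b)
    · have key : ∀ a b, D.Joined σ a b →
          Quotient.mk (Relation.EqvGen.setoid (D.Joined σ)) a = Quotient.mk _ b :=
        fun a b h => Quotient.sound (Relation.EqvGen.rel _ _ h)
      rw [Xing.smoothing_le_iff, baseCircuit_cr]
      have h0 := hτ c
      cases ht : τ c <;> rw [ht] at h0 <;> simp only [Bool.false_eq_true, false_iff, true_iff] at h0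
      · have k1 := key _ _ ⟨c.1, c.2, Or.inl ⟨h0, Or.inl ⟨rfl, rfl⟩⟩⟩
        have k2 := key _ _ ⟨c.1, c.2, Or.inl ⟨h0, Or.inr ⟨rfl, rfl⟩⟩⟩
        by_cases hp : D.IsPositive o c.1 <;>
          simp only [Xing.ofPassages, hp, decide_true, decide_false, cond_true, cond_false]
        · exact ⟨k2, k1.symm⟩
        · exact ⟨k1.symm, k2⟩
      · have k1 := key _ _ ⟨c.1, c.2, Or.inr ⟨h0, Or.inl ⟨rfl, rfl⟩⟩⟩
        have k2 := key _ _ ⟨c.1, c.2, Or.inr ⟨h0, Or.inr ⟨rfl, rfl⟩⟩⟩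
        by_cases hp : D.IsPositive o c.1 <;>
          simp only [Xing.ofPassages, hp, decide_true, decide_false, cond_true, cond_false]
        · exact ⟨k1.symm, k2⟩
        · exact ⟨k2.symm, k1⟩

/-- The power of `w` is one factor per crossing, and sets of crossings correspond to Boolean states.
-/
theorem bracketValue_eq (o : SurfaceOrientation M) (D : KnotoidDiagram M)
    (β : BiquandleBracket X R) (f : D.Semiarc → X) :
    D.bracketValue o β f = (D.baseCircuit o).value β f := by
  classical
  have hw : ∀ (σ : Finset (ℝ × ℝ)) (τ : {c // c ∈ D.crossings} → Bool),
      (∀ c, τ c = true ↔ c.1 ∈ σ) →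
      (∏ c ∈ D.crossings, D.smoothingCoeff o β f σ c) *
      (β.w ^ (((D.crossings.filter fun c => ¬ D.IsPositive o c).card : ℤ)
        - ((D.crossings.filter fun c => D.IsPositive o c).card : ℤ))) =
      ∏ c, ((D.baseCircuit o).cr c).weight β f (τ c) := by
    intro σ τ hτ
    have hpow : β.w ^ (((D.crossings.filter fun c => ¬ D.IsPositive o c).card : ℤ)
        - ((D.crossings.filter fun c => D.IsPositive o c).card : ℤ)) =
        ∏ c ∈ D.crossings, if D.IsPositive o c then β.w⁻¹ else β.w := by
      rw [Finset.prod_ite, Finset.prod_const, Finset.prod_const, zpow_sub, zpow_natCast,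
        zpow_natCast, inv_pow, mul_comm]
    rw [hpow, ← Finset.prod_mul_distrib, ← Finset.prod_coe_sort]
    refine Finset.prod_congr rfl fun c _ => ?_
    have h0 := hτ c
    rw [baseCircuit_cr, smoothingCoeff]
    by_cases hp : D.IsPositive o c.1 <;> cases ht : τ c <;> rw [ht] at h0 <;>
      simp only [Bool.false_eq_true, false_iff, true_iff] at h0 <;>
      simp [hp, h0, Xing.weight, Xing.ofPassages, labelX, labelY]
  rw [bracketValue, Circuit.value]
  refine Finset.sum_bij' (fun σ _ c => decide (c.1 ∈ σ))
    (fun τ _ => (Finset.univ.filter fun c => τ c = true).image Subtype.val) ?_ ?_ ?_ ?_ ?_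
  · intro σ _
    simp
  · intro τ _
    rw [Finset.mem_powerset]
    intro c hc
    obtain ⟨c, -, rfl⟩ := Finset.mem_image.1 hc
    exact c.2
  · intro σ hσ
    ext c
    simp only [Finset.mem_image, Finset.mem_filter, Finset.mem_univ, true_and, decide_eq_true_eq]
    constructor
    · rintro ⟨c, hc, rfl⟩
      exact hc
    · intro hc
      exact ⟨⟨c, Finset.mem_powerset.1 hσ hc⟩, hc, rfl⟩
  · intro τ _
    funext c
    simp
  · intro σ _
    have hτ : ∀ c : {c // c ∈ D.crossings}, decide (c.1 ∈ σ) = true ↔ c.1 ∈ σ := fun c => by simp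
    rw [← hw σ _ hτ, D.stateComponents_eq o σ _ hτ, Units.val_mul]
    ring

theorem bracketMatrix_eq_base [Fintype X] (o : SurfaceOrientation M) (D : KnotoidDiagram M)
    (β : BiquandleBracket X R) : D.bracketMatrix o β = (D.baseCircuit o).matrix β := by
  classical
  ext1 j k
  rw [bracketMatrix, Circuit.matrix]
  simp only [Matrix.of_apply]
  refine Finset.sum_congr ?_ fun f _ => by rw [bracketValue_eq]
  ext f
  simp only [Finset.mem_filter, Finset.mem_univ, true_and, isColoring_baseCircuit]
  rfl

/-- The matrix of a diagram can be computed from the circuit over any finite set that contains the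
passages, up to a monotone change of parameters. -/
theorem bracketMatrix_eq_circuit [Fintype X] (o : SurfaceOrientation M) (D : KnotoidDiagram M)
    (β : BiquandleBracket X R) (P : Finset ℝ) (ψ : ℝ → ℝ) (hψ : StrictMonoOn ψ D.passages)
    (hP : ∀ t ∈ D.passages, ψ t ∈ P) {C : Type*} [Fintype C] [DecidableEq C] (e : C → ℝ × ℝ)
    (he : Function.Injective e) (hr : ∀ c, c ∈ D.crossings ↔ c ∈ Set.range e) :
    D.bracketMatrix o β = (D.circuit o P ψ e).matrix β := by
  classical
  rw [bracketMatrix_eq_base]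
  let Q := D.passages
  let idx : ℝ → ℕ := fun p => (P.filter (· < p)).card
  have hidx : ∀ q ∈ Q, ∀ t ∈ Q, idx (ψ q) < idx (ψ t) ↔ q < t := by
    intro q hq t ht
    rw [Finset.card_filter_lt_lt_iff (hP q hq)]
    exact hψ.lt_iff_lt hq ht
  -- A piece cut out by `P` lies in the semiarc numbered by how many moved passages come before it.
  let κ : Fin (P.card + 1) → D.Semiarc := fun i =>
    ⟨(Q.filter fun q => idx (ψ q) < i).card, Nat.lt_succ_of_le (Finset.card_filter_le _ _)⟩
  have hbef : ∀ t ∈ Q, κ (P.pieceBefore (ψ t)) = D.before t := by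
    intro t ht
    refine Fin.ext ?_
    change (Q.filter fun q => idx (ψ q) < idx (ψ t)).card = (Q.filter (· < t)).card
    rw [Finset.filter_congr fun q hq => hidx q hq t ht]
  have haft : ∀ t ∈ Q, κ (P.pieceAfter (ψ t)) = D.after t := by
    intro t ht
    refine Fin.ext ?_
    change (Q.filter fun q => idx (ψ q) < (P.pieceAfter (ψ t) : ℕ)).card
      = (Q.filter (· ≤ t)).card
    rw [Finset.pieceAfter_val (hP t ht)]
    congr 1
    refine Finset.filter_congr fun q hq => ?_
    change idx (ψ q) < idx (ψ t) + 1 ↔ _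
    rw [Nat.lt_succ_iff, ← not_lt, hidx t ht q hq, not_lt]
  have hmono : ∀ i j : Fin (P.card + 1), i ≤ j → κ i ≤ κ j := by
    intro i j hij
    refine Fin.mk_le_mk.2 (Finset.card_le_card (Finset.monotone_filter_right Q fun q _ hq => ?_))
    exact lt_of_lt_of_le hq hij
  have hbond : ∀ a b, (D.circuit o P ψ e).bond a b → κ a = κ b := by
    rintro a b ⟨p, hp, hpq, rfl, rfl⟩
    refine Fin.ext ?_
    change (Q.filter fun q => idx (ψ q) < idx p).card
      = (Q.filter fun q => idx (ψ q) < (P.pieceAfter p : ℕ)).card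
    rw [Finset.pieceAfter_val hp]
    congr 1
    refine Finset.filter_congr fun q hq => ?_
    change _ ↔ idx (ψ q) < idx p + 1
    rw [Nat.lt_succ_iff, le_iff_lt_or_eq]
    refine ⟨Or.inl, fun h => h.resolve_right fun heq => hpq ⟨q, hq, ?_⟩⟩
    exact Finset.card_filter_lt_inj (hP q hq) hp heq
  -- Being monotone, `κ` is constant between `i` and `j`; it jumps at every moved passage, so only
  -- trivial junctions lie in between.
  have hstep : ∀ (i j : Fin (P.card + 1)), i ≤ j → κ i = κ j →
      Relation.EqvGen (D.circuit o P ψ e).bond i j := by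
    rintro ⟨i, hi⟩ ⟨j, hj⟩ hij
    induction j with
    | zero =>
      intro _
      obtain rfl : i = 0 := Nat.le_zero.1 hij
      exact Relation.EqvGen.refl _
    | succ j ih =>
      intro hκ
      rcases Nat.lt_or_ge i (j + 1) with hlt | hge
      · have hj' : j < P.card + 1 := by omega
        have hle1 := hmono ⟨i, hi⟩ ⟨j, hj'⟩ (Nat.lt_succ_iff.1 hlt)
        have hle2 := hmono ⟨j, hj'⟩ ⟨j + 1, hj⟩ (Nat.le_succ j)
        have e1 : κ ⟨i, hi⟩ = κ ⟨j, hj'⟩ := le_antisymm hle1 (hκ ▸ hle2)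
        have e2 : κ ⟨j, hj'⟩ = κ ⟨j + 1, hj⟩ := e1.symm.trans hκ
        refine Relation.EqvGen.trans _ _ _ (ih hj' (Nat.lt_succ_iff.1 hlt) e1)
          (Relation.EqvGen.rel _ _ ?_)
        obtain ⟨p, hp, hpj⟩ := Finset.exists_card_filter_lt_eq (P := P) (k := j) (by omega)
        refine ⟨p, hp, ?_, Fin.ext hpj.symm, Fin.ext ?_⟩
        · rintro ⟨q, hq, rfl⟩
          have h1 : (Q.filter fun q => idx (ψ q) < j) ⊂ Q.filter fun q => idx (ψ q) < j + 1 := by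
            refine ⟨Finset.monotone_filter_right Q fun x _ hx => Nat.lt_succ_of_lt hx,
              fun hs => ?_⟩
            have := hs (Finset.mem_filter.2 ⟨hq, by rw [show idx (ψ q) = j from hpj]; omega⟩)
            have := (Finset.mem_filter.1 this).2
            have h3 : idx (ψ q) = j := hpj
            omega
          have h2 := Finset.card_lt_card h1
          have h3 := congrArg Fin.val e2
          exact absurd h3 (ne_of_lt h2)
        · rw [Finset.pieceAfter_val hp]
          exact congrArg (· + 1) hpj.symm
      · obtain rfl : i = j + 1 := le_antisymm hij hge
        exact Relation.EqvGen.refl _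
  have hmem : ∀ c : C, e c ∈ D.crossings := fun c => (hr _).2 ⟨c, rfl⟩
  let ee : C ≃ {c // c ∈ D.crossings} := Equiv.ofBijective (fun c => ⟨e c, hmem c⟩)
    ⟨fun a b h => he (congrArg Subtype.val h), fun c => by
      obtain ⟨a, ha⟩ := (hr c.1).1 c.2
      exact ⟨a, Subtype.ext ha⟩⟩
  refine Circuit.matrix_eq_of_collapse β κ ?_ ee ?_ (D.baseCircuit_bond o) ?_ ?_ ?_
  · rintro ⟨k, hk⟩
    rcases Nat.eq_zero_or_pos k with rfl | hpos
    · refine ⟨0, Fin.ext ?_⟩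
      change (Q.filter fun q => idx (ψ q) < 0).card = 0
      simp
    · obtain ⟨q, hq, hqk⟩ := Finset.exists_card_filter_lt_eq (P := Q) (k := k - 1) (by
        change k < Q.card + 1 at hk
        omega)
      refine ⟨P.pieceAfter (ψ q), ?_⟩
      rw [haft q hq]
      refine Fin.ext ?_
      change (Q.filter (· ≤ q)).card = k
      rw [Finset.card_filter_le_eq hq, hqk]
      omega
  · intro c
    have h1 := fst_mem_passages (hmem c)
    have h2 := snd_mem_passages (hmem c)
    rw [baseCircuit_cr]
    change Xing.ofPassages (D.before (e c).1) (D.after (e c).1) (D.before (e c).2)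
      (D.after (e c).2) (decide (D.IsPositive o (e c))) = _
    rw [← hbef _ h1, ← haft _ h1, ← hbef _ h2, ← haft _ h2]
    by_cases hp : D.IsPositive o (e c) <;>
      simp [circuit, Xing.ofPassages, Xing.map, hp]
  · intro a b
    constructor
    · intro h
      rcases le_total a b with hab | hab
      · exact hstep a b hab h
      · exact Relation.EqvGen.symm _ _ (hstep b a hab h.symm)
    · intro h
      have hle : Relation.EqvGen.setoid (D.circuit o P ψ e).bond ≤ Setoid.ker κ :=
        Setoid.eqvGen_le_iff.2 fun a b hab => hbond a b hab
      exact hle h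
  · refine Fin.ext ?_
    change (Q.filter fun q => idx (ψ q) < 0).card = 0
    simp
  · refine Fin.ext ?_
    change (Q.filter fun q => idx (ψ q) < P.card).card = Q.card
    congr 1
    refine Finset.filter_true_of_mem fun q hq => ?_
    refine Finset.card_lt_card ⟨Finset.filter_subset _ _, fun hs => ?_⟩
    have := hs (hP q hq)
    simp at this

end KnotoidDiagram

/-! ### Circuits with a hole -/

section CutPoints

variable {n : ℕ}

open Classical in
/-- The passages of the crossings in `O` and the ends of the intervals `[a i, b i]`. -/
noncomputable def cutPoints (O : Finset (ℝ × ℝ)) (a b : Fin n → ℝ) : Finset ℝ :=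
  (O.image Prod.fst ∪ O.image Prod.snd) ∪ (Finset.univ.image a ∪ Finset.univ.image b)

/-- The intervals `[a i, b i]` are disjoint and contain no passage of a crossing in `O`. -/
structure IsHole (O : Finset (ℝ × ℝ)) (a b : Fin n → ℝ) : Prop where
  lt : ∀ i, a i < b i
  disjoint : ∀ i j, i ≠ j → Disjoint (Icc (a i) (b i)) (Icc (a j) (b j))
  fst_notMem : ∀ c ∈ O, ∀ i, c.1 ∉ Icc (a i) (b i)
  snd_notMem : ∀ c ∈ O, ∀ i, c.2 ∉ Icc (a i) (b i)

variable {O : Finset (ℝ × ℝ)} {a b : Fin n → ℝ}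

theorem mem_cutPoints {t : ℝ} : t ∈ cutPoints O a b ↔
    ((∃ c ∈ O, c.1 = t) ∨ ∃ c ∈ O, c.2 = t) ∨ (∃ i, a i = t) ∨ ∃ i, b i = t := by
  classical
  simp only [cutPoints, Finset.mem_union, Finset.mem_image, Finset.mem_univ, true_and]

theorem left_mem_cutPoints (i : Fin n) : a i ∈ cutPoints O a b :=
  mem_cutPoints.2 (Or.inr (Or.inl ⟨i, rfl⟩))

theorem right_mem_cutPoints (i : Fin n) : b i ∈ cutPoints O a b :=
  mem_cutPoints.2 (Or.inr (Or.inr ⟨i, rfl⟩))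

theorem fst_mem_cutPoints {c : ℝ × ℝ} (h : c ∈ O) : c.1 ∈ cutPoints O a b :=
  mem_cutPoints.2 (Or.inl (Or.inl ⟨c, h, rfl⟩))

theorem snd_mem_cutPoints {c : ℝ × ℝ} (h : c ∈ O) : c.2 ∈ cutPoints O a b :=
  mem_cutPoints.2 (Or.inl (Or.inr ⟨c, h, rfl⟩))

/-- The piece that ends at the beginning of the `i`-th interval. -/
noncomputable def pieceIn (O : Finset (ℝ × ℝ)) (a b : Fin n → ℝ) (i : Fin n) :
    Fin ((cutPoints O a b).card + 1) := (cutPoints O a b).pieceBefore (a i)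

/-- The piece inside the `i`-th interval. -/
noncomputable def pieceMid (O : Finset (ℝ × ℝ)) (a b : Fin n → ℝ) (i : Fin n) :
    Fin ((cutPoints O a b).card + 1) := (cutPoints O a b).pieceAfter (a i)

/-- The piece that starts at the end of the `i`-th interval. -/
noncomputable def pieceOut (O : Finset (ℝ × ℝ)) (a b : Fin n → ℝ) (i : Fin n) :
    Fin ((cutPoints O a b).card + 1) := (cutPoints O a b).pieceAfter (b i)

/-- The circuit of the crossings in `O`, where the intervals `[a i, b i]` are left free. -/
noncomputable def outerCircuit (O : Finset (ℝ × ℝ)) (ε : ℝ × ℝ → Bool) (a b : Fin n → ℝ) :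
    Circuit (Fin ((cutPoints O a b).card + 1)) {c // c ∈ O} where
  cr c := Xing.ofPassages ((cutPoints O a b).pieceBefore c.1.1)
    ((cutPoints O a b).pieceAfter c.1.1) ((cutPoints O a b).pieceBefore c.1.2)
    ((cutPoints O a b).pieceAfter c.1.2) (ε c.1)
  bond _ _ := False
  tail := 0
  head := Fin.last _

namespace IsHole

theorem eq_of_mem (h : IsHole O a b) {i j : Fin n} {t : ℝ} (hi : t ∈ Icc (a i) (b i))
    (hj : t ∈ Icc (a j) (b j)) : i = j := by
  by_contra hij
  exact Set.disjoint_left.1 (h.disjoint i j hij) hi hj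

theorem left_ne_right (h : IsHole O a b) (i j : Fin n) : a i ≠ b j := by
  intro hab
  have hmem : a i ∈ Icc (a j) (b j) := by
    rw [hab]
    exact right_mem_Icc.2 (h.lt j).le
  obtain rfl := h.eq_of_mem (left_mem_Icc.2 (h.lt i).le) hmem
  exact (h.lt i).ne hab

theorem left_injective (h : IsHole O a b) : Function.Injective a := fun i j hij =>
  h.eq_of_mem (left_mem_Icc.2 (h.lt i).le) (by rw [hij]; exact left_mem_Icc.2 (h.lt j).le)

/-- No cut point lies strictly between `a i` and `b i`, so the piece that starts at one end of the
interval stops at the other. -/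
theorem pieceBefore_right (h : IsHole O a b) (i : Fin n) :
    (cutPoints O a b).pieceBefore (b i) = pieceMid O a b i := by
  refine Fin.ext (congrArg Finset.card (Finset.filter_congr fun t ht => ?_))
  refine ⟨fun hlt => ?_, fun hle => lt_of_le_of_lt hle (h.lt i)⟩
  by_contra hgt
  rw [not_le] at hgt
  have hmem : t ∈ Icc (a i) (b i) := ⟨hgt.le, hlt.le⟩
  rcases mem_cutPoints.1 ht with (⟨c, hc, rfl⟩ | ⟨c, hc, rfl⟩) | ⟨j, rfl⟩ | ⟨j, rfl⟩
  · exact h.fst_notMem c hc i hmem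
  · exact h.snd_notMem c hc i hmem
  · obtain rfl := h.eq_of_mem hmem (left_mem_Icc.2 (h.lt j).le)
    exact lt_irrefl _ hgt
  · obtain rfl := h.eq_of_mem hmem (right_mem_Icc.2 (h.lt j).le)
    exact lt_irrefl _ hlt

theorem eq_right_of_pieceBefore (h : IsHole O a b) {t : ℝ} (ht : t ∈ cutPoints O a b) {i : Fin n}
    (hti : (cutPoints O a b).pieceBefore t = pieceMid O a b i) : t = b i := by
  rw [← h.pieceBefore_right] at hti
  exact Finset.card_filter_lt_inj ht (right_mem_cutPoints i) (congrArg Fin.val hti)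

theorem eq_left_of_pieceAfter {t : ℝ} (ht : t ∈ cutPoints O a b) {i : Fin n}
    (hti : (cutPoints O a b).pieceAfter t = pieceMid O a b i) : t = a i := by
  have h1 := congrArg Fin.val hti
  rw [pieceMid, Finset.pieceAfter_val ht, Finset.pieceAfter_val (left_mem_cutPoints i)] at h1
  exact Finset.card_filter_lt_inj ht (left_mem_cutPoints i) (Nat.succ_injective h1)

theorem pieceIn_ne (h : IsHole O a b) (i j : Fin n) : pieceIn O a b i ≠ pieceMid O a b j :=
  fun hij => h.left_ne_right i j (h.eq_right_of_pieceBefore (left_mem_cutPoints i) hij)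

theorem pieceOut_ne (h : IsHole O a b) (i j : Fin n) : pieceOut O a b i ≠ pieceMid O a b j :=
  fun hij => h.left_ne_right j i (eq_left_of_pieceAfter (right_mem_cutPoints i) hij).symm

theorem pieceMid_injective (h : IsHole O a b) : Function.Injective (pieceMid O a b) :=
  fun i _ hij => h.left_injective (eq_left_of_pieceAfter (left_mem_cutPoints i) hij)

/-- The only cut points adjacent to this piece are `a i` and `b i`, and no crossing of `O` passes
there. Since there is a cut point on either side, the piece is neither first nor last. This is what
makes the moves local. -/
theorem avoids (h : IsHole O a b) (ε : ℝ × ℝ → Bool) (i : Fin n) :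
    (outerCircuit O ε a b).Avoids (pieceMid O a b i) := by
  have hb : ∀ t, t ∈ cutPoints O a b → t ∉ Icc (a i) (b i) →
      pieceMid O a b i ≠ (cutPoints O a b).pieceBefore t := by
    intro t ht hti heq
    rw [h.eq_right_of_pieceBefore ht heq.symm] at hti
    exact hti (right_mem_Icc.2 (h.lt i).le)
  have ha : ∀ t, t ∈ cutPoints O a b → t ∉ Icc (a i) (b i) →
      pieceMid O a b i ≠ (cutPoints O a b).pieceAfter t := by
    intro t ht hti heq
    rw [eq_left_of_pieceAfter ht heq.symm] at hti
    exact hti (left_mem_Icc.2 (h.lt i).le)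
  refine ⟨fun c => ?_, fun _ _ hab => hab.elim, fun h0 => ?_, fun h1 => ?_⟩
  · have h1 := hb _ (fst_mem_cutPoints c.2) (h.fst_notMem _ c.2 i)
    have h2 := ha _ (fst_mem_cutPoints c.2) (h.fst_notMem _ c.2 i)
    have h3 := hb _ (snd_mem_cutPoints c.2) (h.snd_notMem _ c.2 i)
    have h4 := ha _ (snd_mem_cutPoints c.2) (h.snd_notMem _ c.2 i)
    change _ ≠ (Xing.ofPassages _ _ _ _ (ε c.1)).ru ∧ _ ≠ (Xing.ofPassages _ _ _ _ (ε c.1)).ro ∧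
      _ ≠ (Xing.ofPassages _ _ _ _ (ε c.1)).lu ∧ _ ≠ (Xing.ofPassages _ _ _ _ (ε c.1)).lo
    cases ε c.1
    · exact ⟨h4, h1, h3, h2⟩
    · exact ⟨h3, h2, h4, h1⟩
  · have := congrArg Fin.val h0
    rw [pieceMid, Finset.pieceAfter_val (left_mem_cutPoints i)] at this
    exact Nat.succ_ne_zero _ this.symm
  · rw [← h.pieceBefore_right] at h1
    have h2 := congrArg Fin.val h1
    refine absurd h2 (ne_of_gt (Finset.card_lt_card ⟨Finset.filter_subset _ _, fun hs => ?_⟩))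
    have := hs (right_mem_cutPoints i)
    simp at this

end IsHole

/-- The strand `i` inside the hole passes two crossings, at the slots `(i, false)` and `(i, true)`;
this is the piece before a slot. -/
noncomputable def slotBefore (O : Finset (ℝ × ℝ)) (a b : Fin n → ℝ) (s : Fin n × Bool) :
    Fin ((cutPoints O a b).card + 1) := bif s.2 then pieceMid O a b s.1 else pieceIn O a b s.1

/-- The piece after a slot. -/
noncomputable def slotAfter (O : Finset (ℝ × ℝ)) (a b : Fin n → ℝ) (s : Fin n × Bool) :
    Fin ((cutPoints O a b).card + 1) := bif s.2 then pieceOut O a b s.1 else pieceMid O a b s.1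

/-- A crossing inside the hole, given the slots of its over- and under-passage. -/
noncomputable def slotXing (O : Finset (ℝ × ℝ)) (a b : Fin n → ℝ) (p q : Fin n × Bool)
    (pos : Bool) : Xing (Fin ((cutPoints O a b).card + 1)) :=
  Xing.ofPassages (slotBefore O a b p) (slotAfter O a b p) (slotBefore O a b q)
    (slotAfter O a b q) pos

/-- The bonds that run straight through the hole. -/
def throughBond (O : Finset (ℝ × ℝ)) (a b : Fin n → ℝ)
    (x y : Fin ((cutPoints O a b).card + 1)) : Prop :=
  ∃ i, (x = pieceIn O a b i ∧ y = pieceMid O a b i) ∨ (x = pieceMid O a b i ∧ y = pieceOut O a b i)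

theorem throughBond_le_iff (t : Setoid (Fin ((cutPoints O a b).card + 1))) :
    Relation.EqvGen.setoid (throughBond O a b) ≤ t ↔
      ∀ i, Quotient.mk t (pieceMid O a b i) = Quotient.mk t (pieceIn O a b i) ∧
        Quotient.mk t (pieceMid O a b i) = Quotient.mk t (pieceOut O a b i) := by
  rw [Setoid.eqvGen_le_iff]
  constructor
  · intro h i
    exact ⟨(Quotient.sound (h _ _ ⟨i, Or.inl ⟨rfl, rfl⟩⟩)).symm,
      Quotient.sound (h _ _ ⟨i, Or.inr ⟨rfl, rfl⟩⟩)⟩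
  · rintro h x y ⟨i, ⟨rfl, rfl⟩ | ⟨rfl, rfl⟩⟩
    · exact Quotient.exact (h i).1.symm
    · exact Quotient.exact (h i).2

/-- The parameter of a slot. -/
def slotTime (u v : Fin n → ℝ) (s : Fin n × Bool) : ℝ := bif s.2 then v s.1 else u s.1

end CutPoints

/-! ### Diagrams as outer circuits with a filled hole -/

namespace KnotoidDiagram

variable {M : Type*} [TopologicalSpace M] [ChartedSpace (EuclideanSpace ℝ (Fin 2)) M]
  [IsManifold (𝓡 2) ∞ M] {X R : Type*} [Biquandle X] [CommRing R] {n : ℕ}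

/-- `O` and `ε` record the crossings of `D` outside the intervals `[a i, b i]`, and their signs. -/
structure IsOuter (o : SurfaceOrientation M) (D : KnotoidDiagram M) (O : Finset (ℝ × ℝ))
    (ε : ℝ × ℝ → Bool) (a b : Fin n → ℝ) : Prop where
  hole : IsHole O a b
  mem_iff : ∀ c, c ∈ O ↔ c ∈ D.crossings ∧ ∀ i, c.1 ∉ Icc (a i) (b i)
  sign_iff : ∀ c ∈ O, (ε c = true ↔ D.IsPositive o c)

/-- With no crossing in the hole, every passage belongs to `O`, so the ends of the intervals are
trivial junctions. -/
theorem IsOuter.bracketMatrix_eq_addBond [Fintype X] {o : SurfaceOrientation M}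
    {D : KnotoidDiagram M} {O : Finset (ℝ × ℝ)} {ε : ℝ × ℝ → Bool} {a b : Fin n → ℝ}
    (h : D.IsOuter o O ε a b) (β : BiquandleBracket X R)
    (hin : ∀ c ∈ D.crossings, ∀ i, c.1 ∉ Icc (a i) (b i)) :
    D.bracketMatrix o β = ((outerCircuit O ε a b).addBond (throughBond O a b)).matrix β := by
  classical
  have hO : ∀ c, c ∈ D.crossings ↔ c ∈ O := fun c =>
    ⟨fun hc => (h.mem_iff c).2 ⟨hc, hin c hc⟩, fun hc => ((h.mem_iff c).1 hc).1⟩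
  have hpas : ∀ t, t ∈ D.passages ↔ (∃ c ∈ O, c.1 = t) ∨ ∃ c ∈ O, c.2 = t := by
    intro t
    simp only [passages, Finset.mem_union, Finset.mem_image, hO]
  rw [D.bracketMatrix_eq_circuit o β (cutPoints O a b) id (fun _ _ _ _ h => h)
    (fun t ht => mem_cutPoints.2 (Or.inl ((hpas t).1 ht))) (Subtype.val : {c // c ∈ O} → ℝ × ℝ)
    Subtype.val_injective (fun c => by rw [Subtype.range_val]; exact hO c)]
  congr 1
  refine Circuit.ext (funext fun c => ?_) ?_ rfl rfl
  · have hs : decide (D.IsPositive o c.1) = ε c.1 := by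
      rw [Bool.eq_iff_iff, decide_eq_true_iff, h.sign_iff c.1 c.2]
    change Xing.ofPassages _ _ _ _ (decide (D.IsPositive o c.1)) = Xing.ofPassages _ _ _ _ (ε c.1)
    rw [hs]
    rfl
  · funext x y
    refine propext ⟨?_, ?_⟩
    · rintro ⟨p, hp, hpn, rfl, rfl⟩
      refine Or.inr ?_
      rcases mem_cutPoints.1 hp with hp | ⟨i, rfl⟩ | ⟨i, rfl⟩
      · exact absurd ⟨p, (hpas p).2 hp, rfl⟩ hpn
      · exact ⟨i, Or.inl ⟨rfl, rfl⟩⟩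
      · exact ⟨i, Or.inr ⟨h.hole.pieceBefore_right i, rfl⟩⟩
    · have hno : ∀ t i, t ∈ Icc (a i) (b i) → t ∉ id '' (D.passages : Set ℝ) := by
        rintro t i ht ⟨t, htp, rfl⟩
        rcases (hpas t).1 htp with ⟨c, hc, rfl⟩ | ⟨c, hc, rfl⟩
        · exact h.hole.fst_notMem c hc i ht
        · exact h.hole.snd_notMem c hc i ht
      rintro (hf | ⟨i, ⟨rfl, rfl⟩ | ⟨rfl, rfl⟩⟩)
      · exact hf.elim
      · exact ⟨a i, left_mem_cutPoints i, hno _ i (left_mem_Icc.2 (h.hole.lt i).le), rfl, rfl⟩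
      · exact ⟨b i, right_mem_cutPoints i, hno _ i (right_mem_Icc.2 (h.hole.lt i).le),
          (h.hole.pieceBefore_right i).symm, rfl⟩

/-- Each strand in the hole has exactly two passages. Sliding them to the ends of its interval
preserves the order and turns every cut point into a passage, so the semiarcs become the pieces of
the outer circuit, whatever the parameters of the inner crossings. -/
theorem IsOuter.bracketMatrix_eq_add [Fintype X] {o : SurfaceOrientation M}
    {D : KnotoidDiagram M} {O : Finset (ℝ × ℝ)} {ε : ℝ × ℝ → Bool} {a b : Fin n → ℝ}
    (h : D.IsOuter o O ε a b) (β : BiquandleBracket X R) {u v : Fin n → ℝ}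
    (huv : ∀ i, a i ≤ u i ∧ u i < v i ∧ v i ≤ b i) {ι : Type*} [Fintype ι] [DecidableEq ι]
    (p q : ι → Fin n × Bool) (hpq : Function.Injective fun k => (p k, q k))
    (hsurj : ∀ s, ∃ k, p k = s ∨ q k = s)
    (hin : ∀ c, (c ∈ D.crossings ∧ ∃ i, c.1 ∈ Icc (a i) (b i)) ↔
      ∃ k, c = (slotTime u v (p k), slotTime u v (q k)))
    (pos : ι → Bool)
    (hpos : ∀ k, pos k = true ↔ D.IsPositive o (slotTime u v (p k), slotTime u v (q k))) :
    D.bracketMatrix o β = ((outerCircuit O ε a b).add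
      fun k => slotXing O a b (p k) (q k) (pos k)).matrix β := by
  classical
  set P := cutPoints O a b with hP
  have hmem : ∀ s, slotTime u v s ∈ Icc (a s.1) (b s.1) := by
    rintro ⟨i, _ | _⟩
    · exact ⟨(huv i).1, (huv i).2.1.le.trans (huv i).2.2⟩
    · exact ⟨(huv i).1.trans (huv i).2.1.le, (huv i).2.2⟩
  have hslot : Function.Injective (slotTime u v) := by
    rintro ⟨i, x⟩ ⟨j, y⟩ hst
    obtain rfl : i = j := h.hole.eq_of_mem (hmem (i, x)) (by rw [hst]; exact hmem (j, y))
    have := (huv i).2.1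
    cases x <;> cases y <;> simp only [slotTime, cond_true, cond_false] at hst
    · rfl
    · exact absurd hst this.ne
    · exact absurd hst this.ne'
    · rfl
  have hpas : ∀ t, t ∈ D.passages ↔
      ((∃ c ∈ O, c.1 = t) ∨ ∃ c ∈ O, c.2 = t) ∨ ∃ s, t = slotTime u v s := by
    intro t
    simp only [passages, Finset.mem_union, Finset.mem_image]
    constructor
    · rintro (⟨c, hc, rfl⟩ | ⟨c, hc, rfl⟩)
      · by_cases hi : ∃ i, c.1 ∈ Icc (a i) (b i)
        · obtain ⟨k, rfl⟩ := (hin c).1 ⟨hc, hi⟩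
          exact Or.inr ⟨_, rfl⟩
        · exact Or.inl (Or.inl ⟨c, (h.mem_iff c).2 ⟨hc, not_exists.1 hi⟩, rfl⟩)
      · by_cases hi : ∃ i, c.1 ∈ Icc (a i) (b i)
        · obtain ⟨k, rfl⟩ := (hin c).1 ⟨hc, hi⟩
          exact Or.inr ⟨_, rfl⟩
        · exact Or.inl (Or.inr ⟨c, (h.mem_iff c).2 ⟨hc, not_exists.1 hi⟩, rfl⟩)
    · rintro ((⟨c, hc, rfl⟩ | ⟨c, hc, rfl⟩) | ⟨s, rfl⟩)
      · exact Or.inl ⟨c, ((h.mem_iff c).1 hc).1, rfl⟩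
      · exact Or.inr ⟨c, ((h.mem_iff c).1 hc).1, rfl⟩
      · obtain ⟨k, rfl | rfl⟩ := hsurj s
        · exact Or.inl ⟨_, ((hin _).2 ⟨k, rfl⟩).1, rfl⟩
        · exact Or.inr ⟨_, ((hin _).2 ⟨k, rfl⟩).1, rfl⟩
  -- Slots slide to the ends of their intervals, and other parameters stay fixed. The choice is
  -- harmless because `slotTime u v` is injective.
  let ψ : ℝ → ℝ := fun t => if ht : ∃ s, t = slotTime u v s then slotTime a b ht.choose else t
  have hψs : ∀ s, ψ (slotTime u v s) = slotTime a b s := by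
    intro s
    have hex : ∃ s', slotTime u v s = slotTime u v s' := ⟨s, rfl⟩
    simp only [ψ, dif_pos hex]
    rw [← hslot hex.choose_spec]
  have hout : ∀ t, ((∃ c ∈ O, c.1 = t) ∨ ∃ c ∈ O, c.2 = t) → ∀ i, t ∉ Icc (a i) (b i) := by
    rintro t (⟨c, hc, rfl⟩ | ⟨c, hc, rfl⟩) i
    · exact h.hole.fst_notMem c hc i
    · exact h.hole.snd_notMem c hc i
  have hψo : ∀ t, ((∃ c ∈ O, c.1 = t) ∨ ∃ c ∈ O, c.2 = t) → ψ t = t := by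
    intro t ht
    refine dif_neg ?_
    rintro ⟨s, rfl⟩
    exact hout _ ht _ (hmem s)
  have hend : ∀ s, slotTime a b s ∈ Icc (a s.1) (b s.1) := by
    rintro ⟨i, _ | _⟩
    · exact left_mem_Icc.2 (h.hole.lt i).le
    · exact right_mem_Icc.2 (h.hole.lt i).le
  have hendP : ∀ s, slotTime a b s ∈ P := by
    rintro ⟨i, _ | _⟩
    · exact left_mem_cutPoints i
    · exact right_mem_cutPoints i
  -- A parameter outside an interval is on the same side of all its points; hence sliding within the
  -- intervals is monotone.
  have hlt : ∀ {t x y : ℝ} {i : Fin n}, t ∉ Icc (a i) (b i) → x ∈ Icc (a i) (b i) →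
      y ∈ Icc (a i) (b i) → (t < x → t < y) ∧ (x < t → y < t) := by
    intro t x y i ht hx hy
    constructor
    · intro htx
      by_contra hty
      exact ht ⟨hy.1.trans (not_lt.1 hty), htx.le.trans hx.2⟩
    · intro hxt
      by_contra hyt
      exact ht ⟨hx.1.trans hxt.le, (not_lt.1 hyt).trans hy.2⟩
  have hmono : StrictMonoOn ψ D.passages := by
    intro t ht t' ht' htt
    rcases (hpas t).1 ht with h1 | ⟨s, rfl⟩ <;> rcases (hpas t').1 ht' with h2 | ⟨s', rfl⟩
    · rwa [hψo _ h1, hψo _ h2]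
    · rw [hψo _ h1, hψs]
      exact (hlt (hout _ h1 s'.1) (hmem s') (hend s')).1 htt
    · rw [hψo _ h2, hψs]
      exact (hlt (hout _ h2 s.1) (hmem s) (hend s)).2 htt
    · rw [hψs, hψs]
      by_cases hss : s.1 = s'.1
      · obtain ⟨i, x⟩ := s
        obtain ⟨j, y⟩ := s'
        obtain rfl : i = j := hss
        have h1 := (huv i).2.1
        have h2 := h.hole.lt i
        cases x <;> cases y <;> simp only [slotTime, cond_true, cond_false] at htt ⊢
        · exact absurd htt (lt_irrefl _)
        · exact h2
        · exact absurd htt h1.not_gt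
        · exact absurd htt (lt_irrefl _)
      · have e1 : slotTime u v s < slotTime a b s' := (hlt (fun hm => hss (h.hole.eq_of_mem
          (hmem s) hm)) (hmem s') (hend s')).1 htt
        exact (hlt (fun hm => hss (h.hole.eq_of_mem hm (hend s'))) (hmem s) (hend s)).2 e1
  have hψP : ∀ t ∈ D.passages, ψ t ∈ P := by
    intro t ht
    rcases (hpas t).1 ht with h1 | ⟨s, rfl⟩
    · rw [hψo t h1]
      exact mem_cutPoints.2 (Or.inl h1)
    · rw [hψs]
      exact hendP s
  let e : {c // c ∈ O} ⊕ ι → ℝ × ℝ :=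
    Sum.elim Subtype.val fun k => (slotTime u v (p k), slotTime u v (q k))
  have he : Function.Injective e := by
    refine Subtype.val_injective.sumElim (fun k l hkl => hpq ?_) fun c k hck => ?_
    · exact Prod.ext (hslot (congrArg Prod.fst hkl)) (hslot (congrArg Prod.snd hkl))
    · refine h.hole.fst_notMem c.1 c.2 (p k).1 ?_
      rw [hck]
      exact hmem _
  rw [D.bracketMatrix_eq_circuit o β P ψ hmono hψP e he fun c => ?_]
  · have hbef : ∀ s, P.pieceBefore (slotTime a b s) = slotBefore O a b s := by
      rintro ⟨i, _ | _⟩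
      · rfl
      · exact h.hole.pieceBefore_right i
    have haft : ∀ s, P.pieceAfter (slotTime a b s) = slotAfter O a b s := by
      rintro ⟨i, _ | _⟩ <;> rfl
    congr 1
    refine Circuit.ext (funext fun c => ?_) ?_ rfl rfl
    · rcases c with c | k
      · have hs : decide (D.IsPositive o c.1) = ε c.1 := by
          rw [Bool.eq_iff_iff, decide_eq_true_iff, h.sign_iff c.1 c.2]
        change Xing.ofPassages (P.pieceBefore (ψ c.1.1)) (P.pieceAfter (ψ c.1.1))
          (P.pieceBefore (ψ c.1.2)) (P.pieceAfter (ψ c.1.2)) (decide (D.IsPositive o c.1)) =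
            Xing.ofPassages _ _ _ _ (ε c.1)
        rw [hs, hψo _ (Or.inl ⟨c.1, c.2, rfl⟩), hψo _ (Or.inr ⟨c.1, c.2, rfl⟩)]
      · have hs : decide (D.IsPositive o (slotTime u v (p k), slotTime u v (q k))) = pos k := by
          rw [Bool.eq_iff_iff, decide_eq_true_iff, hpos]
        change Xing.ofPassages (P.pieceBefore (ψ (slotTime u v (p k))))
          (P.pieceAfter (ψ (slotTime u v (p k)))) (P.pieceBefore (ψ (slotTime u v (q k))))
          (P.pieceAfter (ψ (slotTime u v (q k))))
          (decide (D.IsPositive o (slotTime u v (p k), slotTime u v (q k)))) = slotXing _ _ _ _ _ _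
        rw [hs, hψs, hψs, hbef, hbef, haft, haft, slotXing]
    · funext x y
      refine propext ⟨?_, fun hf => hf.elim⟩
      rintro ⟨t, ht, htn, -, -⟩
      refine absurd ?_ htn
      rcases mem_cutPoints.1 ht with ht | ⟨i, rfl⟩ | ⟨i, rfl⟩
      · exact ⟨t, (hpas t).2 (Or.inl ht), hψo t ht⟩
      · exact ⟨_, (hpas _).2 (Or.inr ⟨(i, false), rfl⟩), hψs _⟩
      · exact ⟨_, (hpas _).2 (Or.inr ⟨(i, true), rfl⟩), hψs _⟩
  · constructor
    · intro hc
      by_cases hi : ∃ i, c.1 ∈ Icc (a i) (b i)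
      · obtain ⟨k, hk⟩ := (hin c).1 ⟨hc, hi⟩
        exact ⟨Sum.inr k, hk.symm⟩
      · exact ⟨Sum.inl ⟨c, (h.mem_iff c).2 ⟨hc, not_exists.1 hi⟩⟩, rfl⟩
    · rintro ⟨c | k, rfl⟩
      · exact ((h.mem_iff c.1).1 c.2).1
      · exact ((hin _).2 ⟨k, rfl⟩).1

end KnotoidDiagram

/-! ### The three moves inside the hole -/

section Moves

variable {X R : Type*} [Biquandle X] [CommRing R] {n : ℕ} {O : Finset (ℝ × ℝ)} {a b : Fin n → ℝ}

/-- The middle piece is an end of both branches of the self-crossing. Which side it lies on depends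
on the sign and on which branch comes first, hence the bit `pos != x`. -/
theorem matrix_addBond_eq_add_slot_self [Fintype X] {a b : Fin 1 → ℝ} (h : IsHole O a b)
    (β : BiquandleBracket X R) (ε : ℝ × ℝ → Bool) (x pos : Bool) :
    ((outerCircuit O ε a b).addBond (throughBond O a b)).matrix β =
      ((outerCircuit O ε a b).add
        fun _ : Unit => slotXing O a b (0, x) (0, !x) pos).matrix β := by
  have e : slotXing O a b (0, x) (0, !x) pos = Xing.ofSides (pos != x) (pos != x)
      (pieceMid O a b 0) (bif x then pieceIn O a b 0 else pieceOut O a b 0)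
      (pieceMid O a b 0) (bif x then pieceOut O a b 0 else pieceIn O a b 0) pos := by
    cases x <;> cases pos <;> rfl
  rw [e]
  have h1 := h.pieceIn_ne 0 0
  have h2 := h.pieceOut_ne 0 0
  refine Circuit.matrix_addBond_eq_add_kink β _ _ _ (h.avoids ε 0) ?_ ?_ fun t => ?_
  · cases x <;> assumption
  · cases x <;> assumption
  · rw [throughBond_le_iff, Fin.forall_fin_one]
    cases x
    · exact and_comm
    · exact Iff.rfl

/-- From one crossing of the bigon to the other both the sign and the slots change, and the effects
cancel: the inner pieces lie on the same sides at both crossings. -/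
theorem matrix_addBond_eq_add_slot_pair [Fintype X] {a b : Fin 2 → ℝ} (h : IsHole O a b)
    (β : BiquandleBracket X R) (ε : ℝ × ℝ → Bool) (y g : Bool) :
    ((outerCircuit O ε a b).addBond (throughBond O a b)).matrix β =
      ((outerCircuit O ε a b).add fun k : Fin 2 => slotXing O a b (![(0, false), (0, true)] k)
        (![(1, y), (1, !y)] k) (![g, !g] k)).matrix β := by
  have e : (fun k : Fin 2 => slotXing O a b (![(0, false), (0, true)] k)
        (![(1, y), (1, !y)] k) (![g, !g] k)) =
      ![Xing.ofSides (g == y) g (pieceMid O a b 1)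
          (bif y then pieceOut O a b 1 else pieceIn O a b 1) (pieceMid O a b 0) (pieceIn O a b 0) g,
        Xing.ofSides (g == y) g (pieceMid O a b 1)
          (bif y then pieceIn O a b 1 else pieceOut O a b 1) (pieceMid O a b 0)
          (pieceOut O a b 0) (!g)] := by
    funext k
    fin_cases k <;> cases y <;> cases g <;> rfl
  rw [e]
  have h1 : ∀ i, pieceIn O a b i ≠ pieceMid O a b 0 ∧ pieceIn O a b i ≠ pieceMid O a b 1 :=
    fun i => ⟨h.pieceIn_ne i 0, h.pieceIn_ne i 1⟩
  have h2 : ∀ i, pieceOut O a b i ≠ pieceMid O a b 0 ∧ pieceOut O a b i ≠ pieceMid O a b 1 :=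
    fun i => ⟨h.pieceOut_ne i 0, h.pieceOut_ne i 1⟩
  refine Circuit.matrix_addBond_eq_add_pair β _ _ _ _ (h.avoids ε 0) (h.avoids ε 1)
    (fun h01 => absurd (h.pieceMid_injective h01) (by decide)) (h1 0) (h2 0) ?_ ?_ fun t => ?_
  · cases y
    · exact h1 1
    · exact h2 1
  · cases y
    · exact h2 1
    · exact h1 1
  · rw [throughBond_le_iff, Fin.forall_fin_two]
    cases y
    · exact Iff.rfl
    · exact and_congr_right fun _ => and_comm

/-- The slots of the over-passages of the crossings of a triangle: bottom and middle, middle and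
top, bottom and top strand. The bits `bM`, `bT` say that the middle and the top strand meet the
bottom strand first. -/
def triangleOver (bM bT : Bool) : Fin 3 → Fin 3 × Bool := ![(1, !bM), (0, bT), (0, !bT)]

/-- The slots of the under-passages of the crossings of a triangle. The bit `bB` says that the
bottom strand meets the middle strand first, the bit `bM` that the middle strand meets the bottom
strand first. -/
def triangleUnder (bB bM : Bool) : Fin 3 → Fin 3 × Bool := ![(2, !bB), (1, bM), (2, bB)]

/-- The signs of the crossings of a triangle. -/
def triangleSign (g bB bM bT : Bool) : Fin 3 → Bool := ![g == bT, g == bB, g == bM]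

/-- The signs and the order of the crossings along each strand determine on which side of the strand
the triangle lies; `g` is the one bit that the three orders leave undetermined. -/
theorem triangle_eq_hexagon {a b : Fin 3 → ℝ} (g bB bM bT : Bool) :
    (fun k => slotXing O a b (triangleOver bM bT k) (triangleUnder bB bM k)
      (triangleSign g bB bM bT k)) =
    hexagon (g == (bM == bT)) (g != (bT == bB)) (g == (bM == bB)) (bB == (bM == bT))
      (pieceMid O a b 2) (pieceMid O a b 1) (pieceMid O a b 0)
      (bif bB then pieceIn O a b 2 else pieceOut O a b 2)
      (bif bB then pieceOut O a b 2 else pieceIn O a b 2)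
      (bif bM then pieceIn O a b 1 else pieceOut O a b 1)
      (bif bM then pieceOut O a b 1 else pieceIn O a b 1)
      (bif bT then pieceIn O a b 0 else pieceOut O a b 0)
      (bif bT then pieceOut O a b 0 else pieceIn O a b 0) := by
  funext k
  fin_cases k <;> cases g <;> cases bB <;> cases bM <;> cases bT <;> rfl

/-- Reversing the three orders at fixed signs amounts to negating all four bits, hence to flipping
the sides of the triangle as in `Circuit.matrix_add_hexagon`. -/
theorem matrix_add_triangle [Fintype X] {a b : Fin 3 → ℝ} (h : IsHole O a b)
    (β : BiquandleBracket X R) (ε : ℝ × ℝ → Bool) (g bB bM bT : Bool) :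
    ((outerCircuit O ε a b).add fun k => slotXing O a b (triangleOver bM bT k)
      (triangleUnder bB bM k) (triangleSign g bB bM bT k)).matrix β =
    ((outerCircuit O ε a b).add fun k => slotXing O a b (triangleOver (!bM) (!bT) k)
      (triangleUnder (!bB) (!bM) k) (triangleSign g bB bM bT k)).matrix β := by
  have hs : triangleSign g bB bM bT = triangleSign (!g) (!bB) (!bM) (!bT) := by
    cases g <;> cases bB <;> cases bM <;> cases bT <;> rfl
  have h1 : ∀ (c : Bool) (i : Fin 3), (bif c then pieceIn O a b i else pieceOut O a b i) ≠
      pieceMid O a b 2 ∧ (bif c then pieceIn O a b i else pieceOut O a b i) ≠ pieceMid O a b 1 ∧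
      (bif c then pieceIn O a b i else pieceOut O a b i) ≠ pieceMid O a b 0 := by
    rintro (_ | _) i
    · exact ⟨h.pieceOut_ne i 2, h.pieceOut_ne i 1, h.pieceOut_ne i 0⟩
    · exact ⟨h.pieceIn_ne i 2, h.pieceIn_ne i 1, h.pieceIn_ne i 0⟩
  have h2 : ∀ (c : Bool) (i : Fin 3), (bif c then pieceOut O a b i else pieceIn O a b i) ≠
      pieceMid O a b 2 ∧ (bif c then pieceOut O a b i else pieceIn O a b i) ≠ pieceMid O a b 1 ∧
      (bif c then pieceOut O a b i else pieceIn O a b i) ≠ pieceMid O a b 0 := by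
    intro c i
    have := h1 (!c) i
    cases c <;> exact this
  have hne : ∀ i j : Fin 3, i ≠ j → pieceMid O a b i ≠ pieceMid O a b j :=
    fun i j hij heq => hij (h.pieceMid_injective heq)
  have key := Circuit.matrix_add_hexagon β (outerCircuit O ε a b) (g == (bM == bT))
    (g != (bT == bB)) (g == (bM == bB)) (bB == (bM == bT)) (h.avoids ε 2) (h.avoids ε 1)
    (h.avoids ε 0) (hne 2 1 (by decide)) (hne 2 0 (by decide)) (hne 1 0 (by decide)) (h1 bB 2)
    (h2 bB 2) (h1 bM 1) (h2 bM 1) (h1 bT 0) (h2 bT 0)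
  rw [triangle_eq_hexagon, key]
  conv_rhs => rw [hs]
  rw [triangle_eq_hexagon]
  congr 2
  cases g <;> cases bB <;> cases bM <;> cases bT <;> rfl

end Moves

/-! ### Orientation signs of local parametrizations -/

section Frames

local notation "ℝ²" => EuclideanSpace ℝ (Fin 2)

theorem ContinuousLinearMap.det_comp (A B : ℝ² →L[ℝ] ℝ²) : (A.comp B).det = A.det * B.det :=
  LinearMap.det_comp _ _

/-- The signed area of the parallelogram spanned by two vectors. -/
def signedArea (u v : EuclideanSpace ℝ (Fin 2)) : ℝ := u 0 * v 1 - u 1 * v 0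

theorem signedArea_map (A : ℝ² →L[ℝ] ℝ²) (u v : ℝ²) :
    signedArea (A u) (A v) = A.det * signedArea u v := by
  have hA : A.det = A (EuclideanSpace.single 0 1) 0 * A (EuclideanSpace.single 1 1) 1
      - A (EuclideanSpace.single 1 1) 0 * A (EuclideanSpace.single 0 1) 1 := by
    rw [ContinuousLinearMap.det, ← LinearMap.det_toMatrix
      (EuclideanSpace.basisFun (Fin 2) ℝ).toBasis, Matrix.det_fin_two]
    simp [LinearMap.toMatrix_apply]
  have hu : ∀ (w : ℝ²) (i : Fin 2), A w i = w 0 * A (EuclideanSpace.single 0 1) i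
      + w 1 * A (EuclideanSpace.single 1 1) i := by
    intro w i
    have hw : w = w 0 • EuclideanSpace.single 0 (1 : ℝ) + w 1 • EuclideanSpace.single 1 (1 : ℝ) := by
      ext j
      fin_cases j <;> simp
    conv_lhs => rw [hw]
    simp
  rw [hA, signedArea, signedArea, hu u, hu u, hu v, hu v]
  ring

variable {M : Type*} [TopologicalSpace M] [ChartedSpace (EuclideanSpace ℝ (Fin 2)) M]

/-- The derivative of a map into a surface, read in the preferred chart at the image point. -/
noncomputable def surfaceDeriv (h : EuclideanSpace ℝ (Fin 2) → M) (x : EuclideanSpace ℝ (Fin 2)) :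
    EuclideanSpace ℝ (Fin 2) →L[ℝ] EuclideanSpace ℝ (Fin 2) :=
  fderiv ℝ (fun y => chartAt (EuclideanSpace ℝ (Fin 2)) (h x) (h y)) x

theorem eventually_chartAt_symm_chartAt {h : ℝ² → M} {x : ℝ²} (hh : ContinuousAt h x) :
    ∀ᶠ y in 𝓝 x, (chartAt ℝ² (h x)).symm (chartAt ℝ² (h x) (h y)) = h y := by
  filter_upwards [hh ((chartAt ℝ² (h x)).open_source.mem_nhds (mem_chart_source _ _))] with y hy
  exact (chartAt ℝ² (h x)).left_inv hy

variable [IsManifold (𝓡 2) ∞ M]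

theorem contDiffAt_chartAt_comp {h : ℝ² → M} {x : ℝ²} {p : M} (hh : ContMDiffAt (𝓡 2) (𝓡 2) ∞ h x)
    (hp : h x ∈ (chartAt ℝ² p).source) : ContDiffAt ℝ ∞ (fun y => chartAt ℝ² p (h y)) x := by
  have h1 : ContMDiffAt (𝓡 2) (𝓡 2) ∞ (chartAt ℝ² p) (h x) :=
    contMDiffAt_of_mem_maximalAtlas (IsManifold.chart_mem_maximalAtlas p) hp
  exact contMDiffAt_iff_contDiffAt.1 (h1.comp x hh)

theorem contDiffAt_comp_chartAt_symm {k : M → ℝ²} {p : M} (hk : ContMDiffAt (𝓡 2) (𝓡 2) ∞ k p) :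
    ContDiffAt ℝ ∞ (fun y => k ((chartAt ℝ² p).symm y)) (chartAt ℝ² p p) := by
  have h1 : ContMDiffAt (𝓡 2) (𝓡 2) ∞ (chartAt ℝ² p).symm (chartAt ℝ² p p) :=
    contMDiffAt_symm_of_mem_maximalAtlas (IsManifold.chart_mem_maximalAtlas p)
      (mem_chart_target _ p)
  have h2 : ContMDiffAt (𝓡 2) (𝓡 2) ∞ k ((chartAt ℝ² p).symm (chartAt ℝ² p p)) := by
    rwa [(chartAt ℝ² p).left_inv (mem_chart_source _ p)]
  exact contMDiffAt_iff_contDiffAt.1 (h2.comp _ h1)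

theorem fderiv_comp_eq_comp_surfaceDeriv {h : ℝ² → M} {x : ℝ²} {k : M → ℝ²}
    (hh : ContMDiffAt (𝓡 2) (𝓡 2) ∞ h x) (hk : ContMDiffAt (𝓡 2) (𝓡 2) ∞ k (h x)) :
    fderiv ℝ (fun y => k (h y)) x =
      (fderiv ℝ (fun y => k ((chartAt ℝ² (h x)).symm y)) (chartAt ℝ² (h x) (h x))).comp
        (surfaceDeriv h x) := by
  have h1 := contDiffAt_chartAt_comp hh (mem_chart_source ℝ² (h x))
  have h2 := contDiffAt_comp_chartAt_symm hk
  rw [surfaceDeriv, ← fderiv_comp x (h2.differentiableAt (by simp))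
    (h1.differentiableAt (by simp))]
  refine Filter.EventuallyEq.fderiv_eq ?_
  filter_upwards [eventually_chartAt_symm_chartAt hh.continuousAt] with y hy
  simp only [Function.comp_apply, hy]

/-- The chain rule through the preferred chart at `h x` brings in the transition derivative that
occurs in `SurfaceOrientation.coherent`. -/
theorem tangentCoordChange_comp_surfaceDeriv {h : ℝ² → M} {x : ℝ²} {p : M}
    (hh : ContMDiffAt (𝓡 2) (𝓡 2) ∞ h x) (hp : h x ∈ (chartAt ℝ² p).source) :
    fderiv ℝ (fun y => chartAt ℝ² p (h y)) x =
      (tangentCoordChange (𝓡 2) (h x) p (h x)).comp (surfaceDeriv h x) := by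
  rw [fderiv_comp_eq_comp_surfaceDeriv hh (contMDiffAt_of_mem_maximalAtlas
    (IsManifold.chart_mem_maximalAtlas p) hp), tangentCoordChange_def]
  simp only [mfld_simps, fderivWithin_univ]
  rfl

theorem det_surfaceDeriv_ne_zero {h : ℝ² → M} {x : ℝ²} {k : M → ℝ²}
    (hh : ContMDiffAt (𝓡 2) (𝓡 2) ∞ h x) (hk : ContMDiffAt (𝓡 2) (𝓡 2) ∞ k (h x))
    (hkh : ∀ᶠ y in 𝓝 x, k (h y) = y) : (surfaceDeriv h x).det ≠ 0 := by
  intro h0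
  have h1 := fderiv_comp_eq_comp_surfaceDeriv hh hk
  rw [Filter.EventuallyEq.fderiv_eq (f := fun y => y) hkh, fderiv_fun_id] at h1
  have h2 := congrArg ContinuousLinearMap.det h1
  rw [ContinuousLinearMap.det_comp, h0, mul_zero] at h2
  simp [ContinuousLinearMap.det] at h2

/-- The orientation sign of a continuous family of local parametrizations is constant. -/
theorem SurfaceOrientation.sign_mul_det_pos_iff (o : SurfaceOrientation M) {T : Type*}
    [TopologicalSpace T] [PreconnectedSpace T] (h : T → ℝ² → M) (x : T → ℝ²)
    (hh : ∀ t, ContMDiffAt (𝓡 2) (𝓡 2) ∞ (h t) (x t)) (hcont : Continuous fun t => h t (x t))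
    (hdet : ∀ t, (surfaceDeriv (h t) (x t)).det ≠ 0)
    (hder : ∀ t₀, ContinuousAt
      (fun t => fderiv ℝ (fun y => chartAt ℝ² (h t₀ (x t₀)) (h t y)) (x t)) t₀) (s t : T) :
    0 < ((o.sign (h s (x s)) : ℤ) : ℝ) * (surfaceDeriv (h s) (x s)).det ↔
      0 < ((o.sign (h t (x t)) : ℤ) : ℝ) * (surfaceDeriv (h t) (x t)).det := by
  have hloc : IsLocallyConstant fun t =>
      0 < ((o.sign (h t (x t)) : ℤ) : ℝ) * (surfaceDeriv (h t) (x t)).det := by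
    rw [IsLocallyConstant.iff_eventually_eq]
    intro t₀
    set p := h t₀ (x t₀) with hp
    -- In the fixed chart at `p` the determinant keeps its sign for nearby `t`. Splitting off the
    -- transition determinant, whose sign is controlled by `o.coherent`, compares the orientation
    -- signs at `t` and `t₀`.
    have h1 : ∀ᶠ t in 𝓝 t₀, 0 < (surfaceDeriv (h t₀) (x t₀)).det *
        (fderiv ℝ (fun y => chartAt ℝ² p (h t y)) (x t)).det := by
      have hc : ContinuousAt (fun t => (surfaceDeriv (h t₀) (x t₀)).det *
          (fderiv ℝ (fun y => chartAt ℝ² p (h t y)) (x t)).det) t₀ :=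
        continuousAt_const.mul
          (ContinuousLinearMap.continuous_det.continuousAt.comp (hder t₀))
      refine hc.eventually (lt_mem_nhds ?_)
      exact mul_self_pos.2 (hdet t₀)
    have h2 : ∀ᶠ t in 𝓝 t₀, h t (x t) ∈ (chartAt ℝ² p).source :=
      hcont.continuousAt ((chartAt ℝ² p).open_source.mem_nhds (mem_chart_source _ _))
    have h3 := hcont.continuousAt.eventually (o.coherent p)
    filter_upwards [h1, h2, h3] with t h1 h2 h3
    rw [tangentCoordChange_comp_surfaceDeriv (hh t) h2] at h1
    rw [ContinuousLinearMap.det_comp] at h1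
    set τ := (tangentCoordChange (𝓡 2) (h t (x t)) p (h t (x t))).det
    set d := (surfaceDeriv (h t) (x t)).det
    set d₀ := (surfaceDeriv (h t₀) (x t₀)).det
    have h4 : 0 < (((o.sign p : ℤ) : ℝ) * d₀) * (((o.sign (h t (x t)) : ℤ) : ℝ) * d) * τ ^ 2 := by
      calc 0 < (d₀ * (τ * d)) * (((o.sign p : ℤ) : ℝ) * ((o.sign (h t (x t)) : ℤ) : ℝ) * τ) :=
            mul_pos h1 h3
        _ = _ := by ring
    have h5 : 0 < (((o.sign p : ℤ) : ℝ) * d₀) * (((o.sign (h t (x t)) : ℤ) : ℝ) * d) :=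
      pos_of_mul_pos_left h4 (sq_nonneg _)
    exact propext (pos_iff_pos_of_mul_pos h5).symm
  exact iff_of_eq (hloc.apply_eq_of_preconnectedSpace s t)

omit [IsManifold (𝓡 2) ∞ M] in
theorem curveVelocity_congr {γ γ' : ℝ → M} {t : ℝ} (h : γ =ᶠ[𝓝[Icc 0 1] t] γ')
    (ht : t ∈ Icc (0 : ℝ) 1) : curveVelocity γ t = curveVelocity γ' t := by
  have h0 : γ t = γ' t := h.self_of_nhdsWithin ht
  refine Filter.EventuallyEq.derivWithin_eq_of_mem ?_ ht
  filter_upwards [h] with s hs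
  rw [h0, hs]

theorem curveVelocity_eq_surfaceDeriv {γ : ℝ → M} {h : ℝ² → M} {η : ℝ → ℝ²} {t : ℝ}
    (ht : t ∈ Icc (0 : ℝ) 1) (hγ : γ =ᶠ[𝓝[Icc 0 1] t] fun s => h (η s))
    (hh : ContMDiffAt (𝓡 2) (𝓡 2) ∞ h (η t)) (hη : DifferentiableWithinAt ℝ η (Icc 0 1) t) :
    curveVelocity γ t = surfaceDeriv h (η t) (derivWithin η (Icc 0 1) t) := by
  rw [curveVelocity_congr hγ ht]
  have h1 := (contDiffAt_chartAt_comp hh (mem_chart_source ℝ² (h (η t)))).differentiableAt (by simp)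
  exact (h1.hasFDerivAt.comp_hasDerivWithinAt t hη.hasDerivWithinAt).derivWithin
    (uniqueDiffOn_Icc zero_lt_one t ht)

namespace KnotoidDiagram

theorem isPositive_iff (o : SurfaceOrientation M) (D : KnotoidDiagram M) (c : ℝ × ℝ) :
    D.IsPositive o c ↔ 0 < ((o.sign (D.curve c.1) : ℤ) : ℝ) *
      signedArea (curveVelocity D.curve c.1) (curveVelocity D.curve c.2) := Iff.rfl

omit [IsManifold (𝓡 2) ∞ M] in
theorem curve_eq_of_mem {D : KnotoidDiagram M} {c : ℝ × ℝ} (hc : c ∈ D.crossings) :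
    c.1 ≠ c.2 ∧ D.curve c.1 = D.curve c.2 :=
  (D.double_iff c.1 (D.crossings_subset c hc).1 c.2 (D.crossings_subset c hc).2).2 (Or.inl hc)

omit [IsManifold (𝓡 2) ∞ M] in
/-- The chart expression of the curve of a diagram. -/
theorem contDiffWithinAt_chart (D : KnotoidDiagram M) {e : OpenPartialHomeomorph M ℝ²}
    (he : e ∈ IsManifold.maximalAtlas (𝓡 2) ∞ M) {t : ℝ} (ht : t ∈ Icc (0 : ℝ) 1)
    (hs : D.curve t ∈ e.source) :
    ContDiffWithinAt ℝ ∞ (fun s => e (D.curve s)) (Icc 0 1) t := by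
  have h1 : ContMDiffAt (𝓡 2) (𝓡 2) ∞ e (D.curve t) := contMDiffAt_of_mem_maximalAtlas he hs
  exact contMDiffWithinAt_iff_contDiffWithinAt.1 (h1.comp_contMDiffWithinAt t (D.smooth t ht))

theorem curveVelocity_eq_of_chart (D : KnotoidDiagram M) {e : OpenPartialHomeomorph M ℝ²}
    (he : e ∈ IsManifold.maximalAtlas (𝓡 2) ∞ M) {t : ℝ} (ht : t ∈ Icc (0 : ℝ) 1)
    (hs : D.curve t ∈ e.source) : curveVelocity D.curve t = surfaceDeriv e.symm (e (D.curve t))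
      (derivWithin (fun s => e (D.curve s)) (Icc 0 1) t) := by
  refine curveVelocity_eq_surfaceDeriv ht ?_
    (contMDiffAt_symm_of_mem_maximalAtlas he (e.map_source hs))
    ((D.contDiffWithinAt_chart he ht hs).differentiableWithinAt (by simp))
  have h1 := (D.smooth t ht).continuousWithinAt
  filter_upwards [h1 (e.open_source.mem_nhds hs)] with s hs'
  exact (e.left_inv hs').symm

end KnotoidDiagram

end Frames

/-! ### Reparametrizations and isotopies -/

section Isotopies

local notation "ℝ²" => EuclideanSpace ℝ (Fin 2)

variable {M : Type*} [TopologicalSpace M] [ChartedSpace (EuclideanSpace ℝ (Fin 2)) M]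
  [IsManifold (𝓡 2) ∞ M]

theorem det_surfaceDeriv_symm_ne_zero {e : OpenPartialHomeomorph M ℝ²}
    (he : e ∈ IsManifold.maximalAtlas (𝓡 2) ∞ M) {x : ℝ²} (hx : x ∈ e.target) :
    (surfaceDeriv e.symm x).det ≠ 0 := by
  refine det_surfaceDeriv_ne_zero (k := e) (contMDiffAt_symm_of_mem_maximalAtlas he hx)
    (contMDiffAt_of_mem_maximalAtlas he (e.map_target hx)) ?_
  filter_upwards [e.open_target.mem_nhds hx] with y hy
  exact e.right_inv hy

/-- A chart has a constant orientation sign on a connected set. -/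
theorem SurfaceOrientation.exists_sign_chart (o : SurfaceOrientation M)
    {e : OpenPartialHomeomorph M ℝ²} (he : e ∈ IsManifold.maximalAtlas (𝓡 2) ∞ M) {S : Set ℝ²}
    (hS : IsPreconnected S) (hSe : S ⊆ e.target) :
    ∃ E : ℝ, E ≠ 0 ∧ ∀ x ∈ S,
      0 < E * (((o.sign (e.symm x) : ℤ) : ℝ) * (surfaceDeriv e.symm x).det) := by
  have hne : ∀ x ∈ S, ((o.sign (e.symm x) : ℤ) : ℝ) * (surfaceDeriv e.symm x).det ≠ 0 :=
    fun x hx => mul_ne_zero (Int.cast_ne_zero.2 (o.sign (e.symm x)).ne_zero)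
      (det_surfaceDeriv_symm_ne_zero he (hSe hx))
  rcases S.eq_empty_or_nonempty with rfl | ⟨x₀, hx₀⟩
  · exact ⟨1, one_ne_zero, fun x hx => hx.elim⟩
  refine ⟨_, hne x₀ hx₀, fun x hx => ?_⟩
  have : PreconnectedSpace S := isPreconnected_iff_preconnectedSpace.1 hS
  have key := o.sign_mul_det_pos_iff (T := S) (fun _ => e.symm) Subtype.val
    (fun t => contMDiffAt_symm_of_mem_maximalAtlas he (hSe t.2))
    (continuousOn_iff_continuous_domRestrict.1 (e.continuousOn_symm.mono hSe))
    (fun t => det_surfaceDeriv_symm_ne_zero he (hSe t.2))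
    (fun t₀ => by
      have h1 := contDiffAt_chartAt_comp (contMDiffAt_symm_of_mem_maximalAtlas he (hSe t₀.2))
        (mem_chart_source ℝ² (e.symm t₀))
      exact ((h1.fderiv_right (m := 0) (by simp)).continuousAt).comp
        continuous_subtype_val.continuousAt) ⟨x₀, hx₀⟩ ⟨x, hx⟩
  have h0 := hne x₀ hx₀
  have h1 := hne x hx
  dsimp only at key
  rcases lt_or_gt_of_ne h0 with h2 | h2
  · exact mul_pos_of_neg_of_neg h2 (lt_of_le_of_ne (not_lt.1 fun h3 =>
      absurd (key.2 h3) h2.not_gt) h1)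
  · exact mul_pos h2 (key.1 h2)

namespace KnotoidDiagram

variable {X R : Type*} [Biquandle X] [CommRing R]

/-- A monotone correspondence of passages that respects crossings and signs identifies the circuits
over the passages of `D`. -/
theorem bracketMatrix_congr [Fintype X] (o : SurfaceOrientation M) (β : BiquandleBracket X R)
    (D D' : KnotoidDiagram M) (φ : ℝ → ℝ) (hφ : StrictMonoOn φ D'.passages)
    (hφs : ∀ c, c ∈ D.crossings ↔ ∃ c' ∈ D'.crossings, c = (φ c'.1, φ c'.2))
    (hs : ∀ c ∈ D'.crossings, D'.IsPositive o c ↔ D.IsPositive o (φ c.1, φ c.2)) :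
    D.bracketMatrix o β = D'.bracketMatrix o β := by
  classical
  have himg : φ '' D'.passages = id '' (D.passages : Set ℝ) := by
    ext t
    simp only [passages, Set.mem_image, Finset.coe_union, Finset.coe_image, Set.mem_union,
      Finset.mem_coe, id, exists_eq_right, hφs]
    constructor
    · rintro ⟨_, ⟨c, hc, rfl⟩ | ⟨c, hc, rfl⟩, rfl⟩
      · exact Or.inl ⟨_, ⟨c, hc, rfl⟩, rfl⟩
      · exact Or.inr ⟨_, ⟨c, hc, rfl⟩, rfl⟩
    · rintro (⟨_, ⟨c, hc, rfl⟩, rfl⟩ | ⟨_, ⟨c, hc, rfl⟩, rfl⟩)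
      · exact ⟨_, Or.inl ⟨c, hc, rfl⟩, rfl⟩
      · exact ⟨_, Or.inr ⟨c, hc, rfl⟩, rfl⟩
  rw [D'.bracketMatrix_eq_circuit o β D.passages φ hφ (fun t ht => by
      have : φ t ∈ id '' (D.passages : Set ℝ) := himg ▸ Set.mem_image_of_mem φ ht
      simpa using this) (Subtype.val : {c // c ∈ D'.crossings} → ℝ × ℝ) Subtype.val_injective
      (fun c => by simp),
    D.bracketMatrix_eq_circuit o β D.passages id (fun _ _ _ _ h => h) (fun t ht => ht)
      (fun c : {c // c ∈ D'.crossings} => (φ c.1.1, φ c.1.2)) ?_ ?_]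
  · congr 1
    refine Circuit.ext (funext fun c => ?_) ?_ rfl rfl
    · have h1 : decide (D'.IsPositive o c.1) = decide (D.IsPositive o (φ c.1.1, φ c.1.2)) := by
        rw [Bool.eq_iff_iff, decide_eq_true_iff, decide_eq_true_iff, hs c.1 c.2]
      simp only [circuit, h1, id]
    · simp only [circuit, himg]
  · rintro c c' h
    have h1 := hφ.injOn (fst_mem_passages c.2) (fst_mem_passages c'.2) (congrArg Prod.fst h)
    have h2 := hφ.injOn (snd_mem_passages c.2) (snd_mem_passages c'.2) (congrArg Prod.snd h)
    exact Subtype.ext (Prod.ext h1 h2)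
  · intro c
    rw [hφs]
    constructor
    · rintro ⟨c', hc', rfl⟩
      exact ⟨⟨c', hc'⟩, rfl⟩
    · rintro ⟨c', rfl⟩
      exact ⟨c'.1, c'.2, rfl⟩

omit [IsManifold (𝓡 2) ∞ M] in
theorem mem_Icc_of_mem_passages {D : KnotoidDiagram M} {t : ℝ} (ht : t ∈ D.passages) :
    t ∈ Icc (0 : ℝ) 1 := by
  classical
  simp only [passages, Finset.mem_union, Finset.mem_image] at ht
  rcases ht with ⟨c, hc, rfl⟩ | ⟨c, hc, rfl⟩
  · exact (D.crossings_subset c hc).1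
  · exact (D.crossings_subset c hc).2

/-- Velocities get multiplied by the positive derivative of the parameter change, which does not
affect the signs of crossings. -/
theorem bracketMatrix_eq_of_reparametrization [Fintype X] (o : SurfaceOrientation M)
    (β : BiquandleBracket X R) {D D' : KnotoidDiagram M} (h : Reparametrization D D') :
    D.bracketMatrix o β = D'.bracketMatrix o β := by
  obtain ⟨φ, hφ, hpos, h0, h1, hcurve, hcr⟩ := h
  have hmono : StrictMonoOn φ (Icc 0 1) := by
    refine strictMonoOn_of_deriv_pos (convex_Icc 0 1) hφ.continuousOn fun x hx => ?_
    rw [interior_Icc] at hx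
    have := hpos x (Ioo_subset_Icc_self hx)
    rwa [derivWithin_of_mem_nhds (Icc_mem_nhds hx.1 hx.2)] at this
  have hmaps : MapsTo φ (Icc 0 1) (Icc 0 1) := by
    intro t ht
    rw [← h0, ← h1]
    exact ⟨hmono.monotoneOn (left_mem_Icc.2 zero_le_one) ht ht.1,
      hmono.monotoneOn ht (right_mem_Icc.2 zero_le_one) ht.2⟩
  have hsurj : ∀ s ∈ Icc (0 : ℝ) 1, ∃ t ∈ Icc (0 : ℝ) 1, φ t = s := by
    intro s hs
    rw [← h0, ← h1] at hs
    exact intermediate_value_Icc zero_le_one hφ.continuousOn hs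
  have hvel : ∀ t ∈ Icc (0 : ℝ) 1, curveVelocity D'.curve t =
      derivWithin φ (Icc 0 1) t • curveVelocity D.curve (φ t) := by
    intro t ht
    have e1 : D'.curve =ᶠ[𝓝[Icc 0 1] t] fun s => D.curve (φ s) := by
      filter_upwards [self_mem_nhdsWithin] with s hs
      exact hcurve s hs
    rw [curveVelocity_congr e1 ht]
    have e2 : DifferentiableWithinAt ℝ (fun s => chartAt ℝ² (D.curve (φ t)) (D.curve s))
        (Icc 0 1) (φ t) :=
      (D.contDiffWithinAt_chart (IsManifold.chart_mem_maximalAtlas _) (hmaps ht)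
        (mem_chart_source _ _)).differentiableWithinAt (by simp)
    have e3 : DifferentiableWithinAt ℝ φ (Icc 0 1) t := (hφ t ht).differentiableWithinAt (by simp)
    exact (e2.hasDerivWithinAt.scomp t e3.hasDerivWithinAt hmaps).derivWithin
      (uniqueDiffOn_Icc zero_lt_one t ht)
  refine bracketMatrix_congr o β D D' φ
    (hmono.mono fun t ht => mem_Icc_of_mem_passages ht) (fun c => ⟨fun hc => ?_, ?_⟩) fun c hc => ?_
  · obtain ⟨hc1, hc2⟩ := D.crossings_subset c hc
    obtain ⟨s, hs, hs'⟩ := hsurj _ hc1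
    obtain ⟨t, ht, ht'⟩ := hsurj _ hc2
    exact ⟨(s, t), (hcr s hs t ht).2 (by rwa [hs', ht']), Prod.ext hs'.symm ht'.symm⟩
  · rintro ⟨c', hc', rfl⟩
    obtain ⟨h1, h2⟩ := D'.crossings_subset c' hc'
    exact (hcr _ h1 _ h2).1 hc'
  · obtain ⟨h1, h2⟩ := D'.crossings_subset c hc
    rw [isPositive_iff, isPositive_iff, hvel _ h1, hvel _ h2, hcurve _ h1]
    have e : ((o.sign (D.curve (φ c.1)) : ℤ) : ℝ) *
        signedArea (derivWithin φ (Icc 0 1) c.1 • curveVelocity D.curve (φ c.1))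
          (derivWithin φ (Icc 0 1) c.2 • curveVelocity D.curve (φ c.2)) =
        (derivWithin φ (Icc 0 1) c.1 * derivWithin φ (Icc 0 1) c.2) *
        (((o.sign (D.curve (φ c.1)) : ℤ) : ℝ) *
        signedArea (curveVelocity D.curve (φ c.1)) (curveVelocity D.curve (φ c.2))) := by
      simp only [signedArea, PiLp.smul_apply, smul_eq_mul]
      ring
    rw [e, mul_pos_iff_of_pos_left (mul_pos (hpos _ h1) (hpos _ h2))]

/-- Both velocities at a crossing are transformed by the same derivative, that of `F 1`. The sign of
its determinant, corrected by the orientation, is constant along `F t`, and at time `0` the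
derivative is the identity. -/
theorem bracketMatrix_eq_of_isotopy [Fintype X] (o : SurfaceOrientation M)
    (β : BiquandleBracket X R) {D D' : KnotoidDiagram M} (h : Isotopy D D') :
    D.bracketMatrix o β = D'.bracketMatrix o β := by
  obtain ⟨F, hF, hF0, hcurve, hcr⟩ := h
  refine bracketMatrix_congr o β D D' id (fun _ _ _ _ h => h) (fun c => by simp [hcr])
    fun c hc => ?_
  change _ ↔ D.IsPositive o c
  obtain ⟨h1, h2⟩ := D'.crossings_subset c hc
  obtain ⟨-, heq⟩ := curve_eq_of_mem (hcr ▸ hc : c ∈ D.crossings)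
  set p := D.curve c.1 with hp
  let φ := chartAt ℝ² p
  have hφsymm : ContMDiffAt (𝓡 2) (𝓡 2) ∞ φ.symm (φ p) :=
    contMDiffAt_symm_of_mem_maximalAtlas (IsManifold.chart_mem_maximalAtlas p)
      (mem_chart_target _ p)
  have hφp : φ.symm (φ p) = p := φ.left_inv (mem_chart_source _ p)
  have hsm : ∀ t, ContMDiffAt (𝓡 2) (𝓡 2) ∞ (fun y => F t (φ.symm y)) (φ p) := fun t =>
    (F t).contMDiff.contMDiffAt.comp _ hφsymm
  have hdet : ∀ t, (surfaceDeriv (fun y => F t (φ.symm y)) (φ p)).det ≠ 0 := by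
    intro t
    refine det_surfaceDeriv_ne_zero (k := fun q => φ ((F t).symm q)) (hsm t) ?_ ?_
    · refine ContMDiffAt.comp _ ?_ (F t).symm.contMDiff.contMDiffAt
      rw [hφp, Diffeomorph.symm_apply_apply]
      exact contMDiffAt_of_mem_maximalAtlas (IsManifold.chart_mem_maximalAtlas p)
        (mem_chart_source _ p)
    · filter_upwards [φ.open_target.mem_nhds (mem_chart_target ℝ² p)] with y hy
      rw [Diffeomorph.symm_apply_apply, φ.right_inv hy]
  have hFp : Continuous fun t => F t p := hF.continuous.comp (Continuous.prodMk_left p)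
  have key := o.sign_mul_det_pos_iff (T := ℝ) (fun t y => F t (φ.symm y)) (fun _ => φ p) hsm
    (by simpa only [hφp] using hFp) hdet (fun t₀ => by
      -- Joint smoothness in time and space gives the continuity in time of the spatial derivative.
      have e1 : ContMDiffAt 𝓘(ℝ, ℝ × ℝ²) (𝓘(ℝ, ℝ).prod (𝓡 2)) ∞
          (fun z : ℝ × ℝ² => (z.1, φ.symm z.2)) (t₀, φ p) :=
        contDiff_fst.contMDiff.contMDiffAt.prodMk
          (ContMDiffAt.comp (t₀, φ p) (g := φ.symm) (f := Prod.snd) hφsymm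
            contDiff_snd.contMDiff.contMDiffAt)
      have e2 : ContMDiffAt 𝓘(ℝ, ℝ × ℝ²) (𝓡 2) ∞
          (fun z : ℝ × ℝ² => F z.1 (φ.symm z.2)) (t₀, φ p) :=
        ContMDiffAt.comp (t₀, φ p) (g := fun q : ℝ × M => F q.1 q.2)
          (f := fun z : ℝ × ℝ² => (z.1, φ.symm z.2)) hF.contMDiffAt e1
      have e3 : ContDiffAt ℝ ∞ (fun z : ℝ × ℝ² =>
          chartAt ℝ² (F t₀ (φ.symm (φ p))) (F z.1 (φ.symm z.2))) (t₀, φ p) := by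
        refine contMDiffAt_iff_contDiffAt.1 (ContMDiffAt.comp (t₀, φ p)
          (g := chartAt ℝ² (F t₀ (φ.symm (φ p)))) ?_ e2)
        exact contMDiffAt_of_mem_maximalAtlas (IsManifold.chart_mem_maximalAtlas _)
          (mem_chart_source _ _)
      exact (ContDiffAt.fderiv (m := 0) (f := fun t y =>
        chartAt ℝ² (F t₀ (φ.symm (φ p))) (F t (φ.symm y))) (g := fun _ => φ p) e3
        contDiffAt_const (by simp)).continuousAt) 0 1
  have hvel : ∀ t ∈ Icc (0 : ℝ) 1, D.curve t = p → curveVelocity D'.curve t =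
      surfaceDeriv (fun y => F 1 (φ.symm y)) (φ p) (curveVelocity D.curve t) := by
    intro t ht htp
    have e2 := (D.contDiffWithinAt_chart (IsManifold.chart_mem_maximalAtlas p) ht
        (htp ▸ mem_chart_source ℝ² p)).differentiableWithinAt (n := ∞) (by simp)
    have e4 := curveVelocity_eq_surfaceDeriv (γ := D'.curve) (h := fun y => F 1 (φ.symm y))
      (η := fun s => φ (D.curve s)) ht ?_ (by rw [htp]; exact hsm 1) e2
    · rw [e4, htp, curveVelocity, htp]
    · have e3 := (D.smooth t ht).continuousWithinAt
      filter_upwards [self_mem_nhdsWithin, e3 (φ.open_source.mem_nhds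
        (htp ▸ mem_chart_source ℝ² p))] with s hs hs'
      rw [hcurve s hs, φ.left_inv hs']
  have hid : surfaceDeriv (fun y => F 0 (φ.symm y)) (φ p) = ContinuousLinearMap.id ℝ ℝ² := by
    rw [surfaceDeriv, hF0, hφp, ← fderiv_id (x := φ p)]
    refine Filter.EventuallyEq.fderiv_eq ?_
    filter_upwards [φ.open_target.mem_nhds (mem_chart_target ℝ² p)] with y hy
    rw [hF0]
    exact φ.right_inv hy
  have hid1 : (ContinuousLinearMap.id ℝ ℝ²).det = 1 := LinearMap.det_id
  rw [hid, hF0, hφp, hid1, mul_one] at key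
  rw [isPositive_iff, isPositive_iff, hvel _ h1 rfl, hvel _ h2 heq.symm, signedArea_map,
    hcurve _ h1, ← hp, ← mul_assoc]
  have hd : ((o.sign (F 1 p) : ℤ) : ℝ) *
      (surfaceDeriv (fun y => F 1 (φ.symm y)) (φ p)).det ≠ 0 :=
    mul_ne_zero (Int.cast_ne_zero.2 (o.sign _).ne_zero) (hdet 1)
  have hd0 : ((o.sign p : ℤ) : ℝ) ≠ 0 := Int.cast_ne_zero.2 (o.sign _).ne_zero
  rcases lt_or_gt_of_ne hd with h3 | h3 <;> rcases lt_or_gt_of_ne hd0 with h4 | h4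
  · simp only [mul_pos_iff, h3, h4, h3.not_gt, h4.not_gt, true_and, false_and, false_or]
  · exact absurd (key.1 h4) h3.not_gt
  · exact absurd (key.2 h3) h4.not_gt
  · rw [mul_pos_iff_of_pos_left h3, mul_pos_iff_of_pos_left h4]

end KnotoidDiagram

end Isotopies

/-! ### Strands in a chart -/

section Strands

local notation "ℝ²" => EuclideanSpace ℝ (Fin 2)

variable {M : Type*} [TopologicalSpace M] [ChartedSpace (EuclideanSpace ℝ (Fin 2)) M]

namespace KnotoidDiagram

/-- The velocity of a diagram in the coordinates of a chart. -/
noncomputable def chartVelocity (D : KnotoidDiagram M)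
    (e : OpenPartialHomeomorph M (EuclideanSpace ℝ (Fin 2))) (t : ℝ) : EuclideanSpace ℝ (Fin 2) :=
  derivWithin (fun s => e (D.curve s)) (Icc 0 1) t

/-- The strand of `D` with parameters in `[a, b]` is the graph of `f`, parametrized by the
horizontal coordinate through `τ`, and directed to the right or to the left according to the
sign `d`. -/
structure IsStrand (D : KnotoidDiagram M) (e : OpenPartialHomeomorph M (EuclideanSpace ℝ (Fin 2)))
    (a b : ℝ) (f : ℝ → ℝ) (d : ℝ) (τ : ℝ → ℝ) : Prop where
  sign : d = 1 ∨ d = -1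
  left : e (D.curve a) 0 = -d
  right : e (D.curve b) 0 = d
  mem : ∀ x ∈ Icc (-1 : ℝ) 1, τ x ∈ Icc a b
  coord_zero : ∀ x ∈ Icc (-1 : ℝ) 1, e (D.curve (τ x)) 0 = x
  coord_one : ∀ x ∈ Icc (-1 : ℝ) 1, e (D.curve (τ x)) 1 = f x
  coord_mem : ∀ t ∈ Icc a b, e (D.curve t) 0 ∈ Icc (-1 : ℝ) 1
  inv : ∀ t ∈ Icc a b, τ (e (D.curve t) 0) = t
  mono : ∀ x ∈ Icc (-1 : ℝ) 1, ∀ y ∈ Icc (-1 : ℝ) 1, τ x < τ y ↔ d * x < d * y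
  velocity : ∀ x ∈ Ioo (-1 : ℝ) 1, ∃ r > 0, D.chartVelocity e (τ x) 0 = d * r ∧
    D.chartVelocity e (τ x) 1 = d * r * deriv f x
  continuous : ContinuousOn f (Icc (-1) 1)
  differentiable : ∀ x ∈ Ioo (-1 : ℝ) 1, DifferentiableAt ℝ f x

variable [IsManifold (𝓡 2) ∞ M]

theorem chartVelocity_ne_zero (D : KnotoidDiagram M) {e : OpenPartialHomeomorph M ℝ²}
    (he : e ∈ IsManifold.maximalAtlas (𝓡 2) ∞ M) {t : ℝ} (ht : t ∈ Icc (0 : ℝ) 1)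
    (hs : D.curve t ∈ e.source) : D.chartVelocity e t ≠ 0 := by
  intro h0
  refine D.immersion t ht ?_
  rw [D.curveVelocity_eq_of_chart he ht hs]
  change surfaceDeriv _ _ (D.chartVelocity e t) = 0
  rw [h0, map_zero]

/-- The horizontal coordinate is monotone from one side to the other, so the intermediate value
theorem provides its inverse `τ`. The vertical velocity is the slope times the horizontal one; the
immersion property keeps the latter from vanishing, and monotonicity gives its sign. -/
theorem IsGraph.exists_isStrand {D : KnotoidDiagram M} {e : OpenPartialHomeomorph M ℝ²}
    {a b : ℝ} {f : ℝ → ℝ} (h : D.IsGraph e a b f) (he : e ∈ IsManifold.maximalAtlas (𝓡 2) ∞ M)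
    (ha : 0 < a) (hab : a < b) (hb : b < 1) (hdisk : ∀ t ∈ Icc a b, InDisk e (D.curve t)) :
    ∃ d τ, D.IsStrand e a b f d τ := by
  have hI : ∀ t ∈ Icc a b, t ∈ Icc (0 : ℝ) 1 := fun t ht =>
    ⟨ha.le.trans ht.1, ht.2.trans hb.le⟩
  have hsm : ∀ t ∈ Icc a b, ContDiffAt ℝ ∞ (fun s => e (D.curve s)) t := fun t ht =>
    (D.contDiffWithinAt_chart he (hI t ht) (hdisk t ht).1).contDiffAt
      (Icc_mem_nhds (ha.trans_le ht.1) (ht.2.trans_lt hb))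
  have hvel : ∀ t ∈ Icc a b, HasDerivAt (fun s => e (D.curve s)) (D.chartVelocity e t) t := by
    intro t ht
    have h1 := ((hsm t ht).differentiableAt (by simp)).hasDerivAt
    rwa [← derivWithin_of_mem_nhds (Icc_mem_nhds (ha.trans_le ht.1) (ht.2.trans_lt hb))] at h1
  have hvel' : ∀ t ∈ Icc a b, ∀ i, HasDerivAt (fun s => e (D.curve s) i)
      (D.chartVelocity e t i) t := fun t ht i =>
    (EuclideanSpace.proj (𝕜 := ℝ) i).hasFDerivAt.comp_hasDerivAt t (hvel t ht)
  obtain ⟨d, hd, hmono, hXa, hXb⟩ : ∃ d : ℝ, (d = 1 ∨ d = -1) ∧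
      StrictMonoOn (fun t => d * e (D.curve t) 0) (Icc a b) ∧ e (D.curve a) 0 = -d ∧
      e (D.curve b) 0 = d := by
    rcases h.direction with ⟨h1, h2, h3⟩ | ⟨h1, h2, h3⟩
    · exact ⟨1, Or.inl rfl, by simpa using h1, h2, h3⟩
    · exact ⟨-1, Or.inr rfl, by simpa using h1.neg, by simpa using h2, h3⟩
  have hdd : d * d = 1 := by rcases hd with rfl | rfl <;> norm_num
  have hcont : ContinuousOn (fun t => d * e (D.curve t) 0) (Icc a b) := fun t ht =>
    ((hvel' t ht 0).continuousAt.const_mul d).continuousWithinAt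
  have hdx : ∀ x ∈ Icc (-1 : ℝ) 1, d * x ∈ Icc (-1 : ℝ) 1 := by
    rintro x ⟨h1, h2⟩
    rcases hd with rfl | rfl <;> constructor <;> linarith
  have hex : ∀ x ∈ Icc (-1 : ℝ) 1, ∃ t ∈ Icc a b, e (D.curve t) 0 = x := by
    intro x hx
    have h1 : d * x ∈ Icc (d * e (D.curve a) 0) (d * e (D.curve b) 0) := by
      rw [hXa, hXb, mul_neg, hdd]
      exact hdx x hx
    obtain ⟨t, ht, htx⟩ := intermediate_value_Icc hab.le hcont h1
    exact ⟨t, ht, mul_left_cancel₀ (by rcases hd with rfl | rfl <;> norm_num) htx⟩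
  choose! τ hτ hτx using hex
  have hmem : ∀ t ∈ Icc a b, e (D.curve t) 0 ∈ Icc (-1 : ℝ) 1 := fun t ht => (hdisk t ht).2 0
  have hfd : ∀ x ∈ Ioo (-1 : ℝ) 1, DifferentiableAt ℝ f x := fun x hx =>
    ((h.smooth x (Ioo_subset_Icc_self hx)).differentiableWithinAt (by simp)).differentiableAt
      (Icc_mem_nhds hx.1 hx.2)
  refine ⟨d, τ, hd, hXa, hXb, hτ, hτx, fun x hx => ?_, hmem, fun t ht => ?_, fun x hx y hy => ?_,
    fun x hx => ?_, h.smooth.continuousOn, hfd⟩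
  · rw [h.graph _ (hτ x hx), hτx x hx]
  · refine hmono.injOn (hτ _ (hmem t ht)) ht ?_
    simp only [hτx _ (hmem t ht)]
  · rw [← hmono.lt_iff_lt (hτ x hx) (hτ y hy)]
    simp only [hτx x hx, hτx y hy]
  · have hx' := Ioo_subset_Icc_self hx
    have ht := hτ x hx'
    have htx := hτx x hx'
    have hxd : x ≠ -d ∧ x ≠ d := by
      rcases hd with rfl | rfl
      · exact ⟨hx.1.ne', hx.2.ne⟩
      · exact ⟨by simpa using hx.2.ne, hx.1.ne'⟩
    have htI : τ x ∈ Ioo a b := by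
      refine ⟨lt_of_le_of_ne ht.1 fun heq => hxd.1 ?_, lt_of_le_of_ne ht.2 fun heq => hxd.2 ?_⟩
      · rw [← htx, ← heq, hXa]
      · rw [← htx, heq, hXb]
    have hnhds : Icc a b ∈ 𝓝 (τ x) := Icc_mem_nhds htI.1 htI.2
    have hY : D.chartVelocity e (τ x) 1 = deriv f x * D.chartVelocity e (τ x) 0 := by
      have h1 : HasDerivAt f (deriv f x) (e (D.curve (τ x)) 0) := by
        rw [htx]
        exact (hfd x hx).hasDerivAt
      have h2 : HasDerivAt (fun s => f (e (D.curve s) 0))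
          (deriv f x * D.chartVelocity e (τ x) 0) (τ x) := h1.comp (τ x) (hvel' _ ht 0)
      have h3 : (fun s => e (D.curve s) 1) =ᶠ[𝓝 (τ x)] fun s => f (e (D.curve s) 0) := by
        filter_upwards [hnhds] with s hs
        exact h.graph s hs
      exact (hvel' _ ht 1).unique (h2.congr_of_eventuallyEq h3)
    have hX0 : D.chartVelocity e (τ x) 0 ≠ 0 := by
      intro h0
      refine D.chartVelocity_ne_zero he (hI _ ht) (hdisk _ ht).1 ?_
      ext i
      fin_cases i
      · exact h0
      · simp only [Fin.mk_one, hY, h0, mul_zero]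
        rfl
    have hnn : 0 ≤ d * D.chartVelocity e (τ x) 0 := by
      have h1 := hmono.monotoneOn.derivWithin_nonneg (x := τ x)
      rwa [derivWithin_of_mem_nhds hnhds, ((hvel' _ ht 0).const_mul d).deriv] at h1
    refine ⟨d * D.chartVelocity e (τ x) 0, lt_of_le_of_ne hnn (Ne.symm (mul_ne_zero ?_ hX0)), ?_, ?_⟩
    · rintro rfl
      norm_num at hdd
    · rw [← mul_assoc, hdd, one_mul]
    · rw [← mul_assoc, hdd, one_mul, hY, mul_comm]

omit [IsManifold (𝓡 2) ∞ M] in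
theorem IsStrand.eq_of_curve_eq {D : KnotoidDiagram M} {e : OpenPartialHomeomorph M ℝ²}
    {a b a' b' d d' : ℝ} {f f' τ τ' : ℝ → ℝ} (h : D.IsStrand e a b f d τ)
    (h' : D.IsStrand e a' b' f' d' τ') {s t : ℝ} (hs : s ∈ Icc a b) (ht : t ∈ Icc a' b')
    (hst : D.curve s = D.curve t) :
    ∃ x ∈ Icc (-1 : ℝ) 1, f x = f' x ∧ s = τ x ∧ t = τ' x := by
  refine ⟨_, h.coord_mem s hs, ?_, (h.inv s hs).symm, ?_⟩
  · rw [← h.coord_one _ (h.coord_mem s hs), h.inv s hs, hst,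
      ← h'.coord_one _ (h'.coord_mem t ht), h'.inv t ht]
  · rw [hst, h'.inv t ht]

omit [IsManifold (𝓡 2) ∞ M] in
theorem IsStrand.curve_eq {D : KnotoidDiagram M} {e : OpenPartialHomeomorph M ℝ²}
    {a b a' b' d d' : ℝ} {f f' τ τ' : ℝ → ℝ} (h : D.IsStrand e a b f d τ)
    (h' : D.IsStrand e a' b' f' d' τ') (hdisk : ∀ t ∈ Icc a b, InDisk e (D.curve t))
    (hdisk' : ∀ t ∈ Icc a' b', InDisk e (D.curve t)) {x : ℝ} (hx : x ∈ Icc (-1 : ℝ) 1)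
    (hf : f x = f' x) : D.curve (τ x) = D.curve (τ' x) := by
  refine e.injOn (hdisk _ (h.mem x hx)).1 (hdisk' _ (h'.mem x hx)).1 ?_
  ext i
  fin_cases i
  · exact (h.coord_zero x hx).trans (h'.coord_zero x hx).symm
  · exact (h.coord_one x hx).trans (hf.trans (h'.coord_one x hx).symm)

theorem signedArea_ne_zero {u v : ℝ²} (h : LinearIndependent ℝ ![u, v]) : signedArea u v ≠ 0 := by
  intro h0
  rw [LinearIndependent.pair_iff] at h
  rw [signedArea] at h0
  have h1 := h (v 0) (-u 0) (by ext i; fin_cases i <;> simp <;> linarith)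
  have h2 := h (v 1) (-u 1) (by ext i; fin_cases i <;> simp <;> linarith)
  have hu : u = 0 := by
    ext i
    fin_cases i
    · simpa using h1.2
    · simpa using h2.2
  exact one_ne_zero (h 1 0 (by simp [hu])).1

/-- The sign of a crossing inside a disk, in terms of the coordinates of the chart. -/
theorem exists_isPositive_iff_chart (o : SurfaceOrientation M) {e : OpenPartialHomeomorph M ℝ²}
    (he : e ∈ IsManifold.maximalAtlas (𝓡 2) ∞ M)
    (hsq : {v : ℝ² | ∀ i, v i ∈ Icc (-1 : ℝ) 1} ⊆ e.target) :
    ∃ E : ℝ, E ≠ 0 ∧ ∀ D : KnotoidDiagram M, ∀ c ∈ D.crossings, InDisk e (D.curve c.1) →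
      (D.IsPositive o c ↔
        0 < E * signedArea (D.chartVelocity e c.1) (D.chartVelocity e c.2)) ∧
      signedArea (D.chartVelocity e c.1) (D.chartVelocity e c.2) ≠ 0 := by
  -- Convexity makes the square connected. The constant `E` is chosen before the diagram, so it
  -- serves both sides of a move.
  have hconv : Convex ℝ {v : ℝ² | ∀ i, v i ∈ Icc (-1 : ℝ) 1} := by
    intro u hu v hv s t hs ht hst i
    exact (convex_Icc (-1 : ℝ) 1) (hu i) (hv i) hs ht hst
  obtain ⟨E, hE, h⟩ := o.exists_sign_chart he hconv.isPreconnected hsq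
  refine ⟨E, hE, fun D c hc hdisk => ?_⟩
  obtain ⟨h1, h2⟩ := D.crossings_subset c hc
  obtain ⟨-, heq⟩ := curve_eq_of_mem hc
  have e1 := D.curveVelocity_eq_of_chart he h1 hdisk.1
  have e2 := D.curveVelocity_eq_of_chart he h2 (heq ▸ hdisk.1)
  rw [← heq] at e2
  have hpos := h (e (D.curve c.1)) hdisk.2
  rw [e.left_inv hdisk.1] at hpos
  have hli := signedArea_ne_zero (D.transversal c hc)
  rw [isPositive_iff]
  change curveVelocity D.curve c.1 = surfaceDeriv e.symm (e (D.curve c.1)) (D.chartVelocity e c.1)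
    at e1
  change curveVelocity D.curve c.2 = surfaceDeriv e.symm (e (D.curve c.1)) (D.chartVelocity e c.2)
    at e2
  rw [e1, e2, signedArea_map] at hli ⊢
  refine ⟨?_, right_ne_zero_of_mul hli⟩
  set A := signedArea (D.chartVelocity e c.1) (D.chartVelocity e c.2)
  rw [← mul_assoc]
  set S := ((o.sign (D.curve c.1) : ℤ) : ℝ) * (surfaceDeriv e.symm (e (D.curve c.1))).det
  have h3 : (S * A) * (E * A) = (E * S) * A ^ 2 := by ring
  have h4 : 0 < (S * A) * (E * A) := by
    rw [h3]
    exact mul_pos hpos (sq_pos_iff.2 (right_ne_zero_of_mul hli))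
  exact pos_iff_pos_of_mul_pos h4

end KnotoidDiagram

end Strands

/-! ### Diagrams that agree outside a disk -/

section Disks

local notation "ℝ²" => EuclideanSpace ℝ (Fin 2)

variable {M : Type*} [TopologicalSpace M] [ChartedSpace (EuclideanSpace ℝ (Fin 2)) M] {n : ℕ}

namespace KnotoidDiagram

theorem AgreeOutside.eventually_eq {D D' : KnotoidDiagram M} {e : OpenPartialHomeomorph M ℝ²}
    {a b : Fin n → ℝ} (h : AgreeOutside D D' e a b) {t : ℝ} (ht : ∀ i, t ∉ Icc (a i) (b i)) :
    D.curve =ᶠ[𝓝[Icc 0 1] t] D'.curve := by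
  have h1 : ∀ᶠ s in 𝓝 t, ∀ i, s ∉ Icc (a i) (b i) :=
    eventually_all.2 fun i => isClosed_Icc.isOpen_compl.mem_nhds (ht i)
  filter_upwards [self_mem_nhdsWithin, nhdsWithin_le_nhds h1] with s hs hs'
  exact h.curve_eq s hs hs'

/-- Agreement is only assumed off the closed intervals; at `a i` it follows from continuity on the
left, limits being unique in a Hausdorff space. -/
theorem AgreeOutside.curve_left_eq [T2Space M] {D D' : KnotoidDiagram M}
    {e : OpenPartialHomeomorph M ℝ²} {a b : Fin n → ℝ} (h : AgreeOutside D D' e a b) (i : Fin n) :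
    D.curve (a i) = D'.curve (a i) := by
  obtain ⟨h1, h2, h3⟩ := h.interval i
  have hIoo : Ioo 0 (a i) ∈ 𝓝[<] (a i) := Ioo_mem_nhdsLT h1
  have hle : 𝓝[<] (a i) ≤ 𝓝[Icc 0 1] (a i) :=
    nhdsWithin_le_iff.2 (mem_of_superset hIoo fun t ht => ⟨ht.1.le, (ht.2.trans (h2.trans h3)).le⟩)
  have hmem : a i ∈ Icc (0 : ℝ) 1 := ⟨h1.le, (h2.trans h3).le⟩
  have hout : ∀ᶠ t in 𝓝[<] (a i), ∀ j, t ∉ Icc (a j) (b j) := by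
    refine eventually_all.2 fun j => ?_
    by_cases hij : i = j
    · subst hij
      filter_upwards [self_mem_nhdsWithin] with t ht ht'
      exact absurd ht'.1 (not_le.2 ht)
    · exact nhdsWithin_le_nhds (isClosed_Icc.isOpen_compl.mem_nhds fun hj =>
        Set.disjoint_left.1 (h.disjoint i j hij) (left_mem_Icc.2 h2.le) hj)
  refine tendsto_nhds_unique_of_eventuallyEq
    ((D.smooth _ hmem).continuousWithinAt.mono_left hle)
    ((D'.smooth _ hmem).continuousWithinAt.mono_left hle) ?_
  filter_upwards [hIoo, hout] with t ht ht'
  exact h.curve_eq t ⟨ht.1.le, (ht.2.trans (h2.trans h3)).le⟩ ht'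

theorem AgreeOutside.curve_right_eq [T2Space M] {D D' : KnotoidDiagram M}
    {e : OpenPartialHomeomorph M ℝ²} {a b : Fin n → ℝ} (h : AgreeOutside D D' e a b) (i : Fin n) :
    D.curve (b i) = D'.curve (b i) := by
  obtain ⟨h1, h2, h3⟩ := h.interval i
  have hIoo : Ioo (b i) 1 ∈ 𝓝[>] (b i) := Ioo_mem_nhdsGT h3
  have hle : 𝓝[>] (b i) ≤ 𝓝[Icc 0 1] (b i) :=
    nhdsWithin_le_iff.2 (mem_of_superset hIoo fun t ht => ⟨((h1.trans h2).trans ht.1).le, ht.2.le⟩)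
  have hmem : b i ∈ Icc (0 : ℝ) 1 := ⟨(h1.trans h2).le, h3.le⟩
  have hout : ∀ᶠ t in 𝓝[>] (b i), ∀ j, t ∉ Icc (a j) (b j) := by
    refine eventually_all.2 fun j => ?_
    by_cases hij : i = j
    · subst hij
      filter_upwards [self_mem_nhdsWithin] with t ht ht'
      exact absurd ht'.2 (not_le.2 ht)
    · exact nhdsWithin_le_nhds (isClosed_Icc.isOpen_compl.mem_nhds fun hj =>
        Set.disjoint_left.1 (h.disjoint i j hij) (right_mem_Icc.2 h2.le) hj)
  refine tendsto_nhds_unique_of_eventuallyEq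
    ((D.smooth _ hmem).continuousWithinAt.mono_left hle)
    ((D'.smooth _ hmem).continuousWithinAt.mono_left hle) ?_
  filter_upwards [hIoo, hout] with t ht ht'
  exact h.curve_eq t ⟨((h1.trans h2).trans ht.1).le, ht.2.le⟩ ht'

/-- The disk of the chart `e` meets the diagram `D` exactly in the intervals `[a i, b i]`. -/
structure MeetsDisk (D : KnotoidDiagram M) (e : OpenPartialHomeomorph M (EuclideanSpace ℝ (Fin 2)))
    (a b : Fin n → ℝ) : Prop where
  interval : ∀ i, 0 < a i ∧ a i < b i ∧ b i < 1
  disjoint : ∀ i j, i ≠ j → Disjoint (Icc (a i) (b i)) (Icc (a j) (b j))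
  inDisk : ∀ t ∈ Icc (0 : ℝ) 1, InDisk e (D.curve t) ↔ ∃ i, t ∈ Icc (a i) (b i)

theorem AgreeOutside.meetsDisk_left {D D' : KnotoidDiagram M} {e : OpenPartialHomeomorph M ℝ²}
    {a b : Fin n → ℝ} (h : AgreeOutside D D' e a b) : D.MeetsDisk e a b :=
  ⟨h.interval, h.disjoint, h.inDisk_left⟩

theorem AgreeOutside.meetsDisk_right {D D' : KnotoidDiagram M} {e : OpenPartialHomeomorph M ℝ²}
    {a b : Fin n → ℝ} (h : AgreeOutside D D' e a b) : D'.MeetsDisk e a b :=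
  ⟨h.interval, h.disjoint, h.inDisk_right⟩

namespace MeetsDisk

variable {D : KnotoidDiagram M} {e : OpenPartialHomeomorph M ℝ²} {a b : Fin n → ℝ}

theorem mem_Icc (h : D.MeetsDisk e a b) {i : Fin n} {t : ℝ} (ht : t ∈ Icc (a i) (b i)) :
    t ∈ Icc (0 : ℝ) 1 :=
  ⟨(h.interval i).1.le.trans ht.1, ht.2.trans (h.interval i).2.2.le⟩

theorem inDisk_of_mem (h : D.MeetsDisk e a b) {i : Fin n} {t : ℝ} (ht : t ∈ Icc (a i) (b i)) :
    InDisk e (D.curve t) := (h.inDisk t (h.mem_Icc ht)).2 ⟨i, ht⟩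

theorem exists_mem_iff (h : D.MeetsDisk e a b) {c : ℝ × ℝ} (hc : c ∈ D.crossings) :
    (∃ i, c.1 ∈ Icc (a i) (b i)) ↔ ∃ i, c.2 ∈ Icc (a i) (b i) := by
  obtain ⟨h1, h2⟩ := D.crossings_subset c hc
  rw [← h.inDisk _ h1, ← h.inDisk _ h2, (curve_eq_of_mem hc).2]

/-- A strand is a graph and does not meet itself, so a crossing in the disk involves two strands at
the same horizontal coordinate. -/
theorem exists_of_crossing {f : Fin n → ℝ → ℝ} {d : Fin n → ℝ} {τ : Fin n → ℝ → ℝ}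
    (h : D.MeetsDisk e a b) (hS : ∀ i, D.IsStrand e (a i) (b i) (f i) (d i) (τ i)) {c : ℝ × ℝ}
    (hc : c ∈ D.crossings) {i : Fin n} (hi : c.1 ∈ Icc (a i) (b i)) :
    ∃ j, i ≠ j ∧ ∃ x ∈ Icc (-1 : ℝ) 1, f i x = f j x ∧ c = (τ i x, τ j x) := by
  obtain ⟨j, hj⟩ := (h.exists_mem_iff hc).1 ⟨i, hi⟩
  obtain ⟨hne, heq⟩ := curve_eq_of_mem hc
  obtain ⟨x, hx, hf, h1, h2⟩ := (hS i).eq_of_curve_eq (hS j) hi hj heq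
  refine ⟨j, ?_, x, hx, hf, Prod.ext h1 h2⟩
  rintro rfl
  exact hne (h1.trans h2.symm)

theorem mem_or_mem {f : Fin n → ℝ → ℝ} {d : Fin n → ℝ} {τ : Fin n → ℝ → ℝ}
    (h : D.MeetsDisk e a b) (hS : ∀ i, D.IsStrand e (a i) (b i) (f i) (d i) (τ i)) {i j : Fin n}
    (hij : i ≠ j) {x : ℝ} (hx : x ∈ Icc (-1 : ℝ) 1) (hf : f i x = f j x) :
    (τ i x, τ j x) ∈ D.crossings ∨ (τ j x, τ i x) ∈ D.crossings := by
  have h1 := (hS i).mem x hx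
  have h2 := (hS j).mem x hx
  refine (D.double_iff _ (h.mem_Icc h1) _ (h.mem_Icc h2)).1 ⟨fun heq => ?_, ?_⟩
  · rw [← heq] at h2
    exact Set.disjoint_left.1 (h.disjoint i j hij) h1 h2
  · exact (hS i).curve_eq (hS j) (fun t => h.inDisk_of_mem) (fun t => h.inDisk_of_mem) hx hf

theorem no_triple {f : Fin n → ℝ → ℝ} {d : Fin n → ℝ} {τ : Fin n → ℝ → ℝ}
    (h : D.MeetsDisk e a b) (hS : ∀ i, D.IsStrand e (a i) (b i) (f i) (d i) (τ i)) {i j k : Fin n}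
    (hij : i ≠ j) (hjk : j ≠ k) (hik : i ≠ k) {x : ℝ} (hx : x ∈ Icc (-1 : ℝ) 1)
    (hf : f i x = f j x) (hf' : f j x = f k x) : False := by
  have h1 := (hS i).mem x hx
  have h2 := (hS j).mem x hx
  have h3 := (hS k).mem x hx
  have e1 := (hS i).curve_eq (hS j) (fun t => h.inDisk_of_mem) (fun t => h.inDisk_of_mem) hx hf
  have e2 := (hS j).curve_eq (hS k) (fun t => h.inDisk_of_mem) (fun t => h.inDisk_of_mem) hx hf'
  rcases D.no_triple _ (h.mem_Icc h1) _ (h.mem_Icc h2) _ (h.mem_Icc h3) e1 e2 with h4 | h4 | h4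
  · exact Set.disjoint_left.1 (h.disjoint i j hij) h1 (h4 ▸ h2)
  · exact Set.disjoint_left.1 (h.disjoint j k hjk) h2 (h4 ▸ h3)
  · exact Set.disjoint_left.1 (h.disjoint i k hik) h1 (h4 ▸ h3)

/-- The crossings inside the disk, when strands with smaller index run above. -/
theorem mem_crossings_iff {f : Fin n → ℝ → ℝ} {d : Fin n → ℝ} {τ : Fin n → ℝ → ℝ}
    (h : D.MeetsDisk e a b) (hS : ∀ i, D.IsStrand e (a i) (b i) (f i) (d i) (τ i))
    (hover : ∀ i j, i < j →
      ∀ c ∈ D.crossings, ¬ (c.1 ∈ Icc (a j) (b j) ∧ c.2 ∈ Icc (a i) (b i))) (c : ℝ × ℝ) :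
    (c ∈ D.crossings ∧ ∃ i, c.1 ∈ Icc (a i) (b i)) ↔
      ∃ i j, i < j ∧ ∃ x ∈ Icc (-1 : ℝ) 1, f i x = f j x ∧ c = (τ i x, τ j x) := by
  constructor
  · rintro ⟨hc, i, hi⟩
    obtain ⟨j, hij, x, hx, hf, rfl⟩ := h.exists_of_crossing hS hc hi
    rcases lt_or_gt_of_ne hij with hlt | hgt
    · exact ⟨i, j, hlt, x, hx, hf, rfl⟩
    · exact absurd ⟨(hS i).mem x hx, (hS j).mem x hx⟩ (hover j i hgt _ hc)
  · rintro ⟨i, j, hij, x, hx, hf, rfl⟩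
    refine ⟨(h.mem_or_mem hS hij.ne hx hf).resolve_right fun hc => ?_, i, (hS i).mem x hx⟩
    exact hover i j hij _ hc ⟨(hS j).mem x hx, (hS i).mem x hx⟩

end MeetsDisk

variable [IsManifold (𝓡 2) ∞ M]

/-- Off the closed intervals the curves agree in a neighborhood, so velocities and signs agree too,
and one outer circuit serves both diagrams. -/
theorem AgreeOutside.exists_isOuter (o : SurfaceOrientation M) {D D' : KnotoidDiagram M}
    {e : OpenPartialHomeomorph M ℝ²} {a b : Fin n → ℝ} (h : AgreeOutside D D' e a b) :
    ∃ O ε, D.IsOuter o O ε a b ∧ D'.IsOuter o O ε a b := by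
  classical
  set O := D.crossings.filter fun c => ∀ i, c.1 ∉ Icc (a i) (b i) with hO
  have hmem : ∀ c, c ∈ O ↔ c ∈ D.crossings ∧ ∀ i, c.1 ∉ Icc (a i) (b i) := fun c => by
    rw [hO, Finset.mem_filter]
  have hmem' : ∀ c, c ∈ O ↔ c ∈ D'.crossings ∧ ∀ i, c.1 ∉ Icc (a i) (b i) := fun c => by
    rw [hmem]
    exact and_congr_left fun hc => h.crossings_iff c hc
  have hsnd : ∀ c ∈ O, ∀ i, c.2 ∉ Icc (a i) (b i) := by
    intro c hc i hi
    obtain ⟨h1, h2⟩ := (hmem c).1 hc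
    obtain ⟨j, hj⟩ := (h.meetsDisk_left.exists_mem_iff h1).2 ⟨i, hi⟩
    exact h2 j hj
  have hole : IsHole O a b := ⟨fun i => (h.interval i).2.1, h.disjoint,
    fun c hc => ((hmem c).1 hc).2, hsnd⟩
  refine ⟨O, fun c => decide (D.IsPositive o c), ⟨hole, hmem, fun c _ => decide_eq_true_iff⟩,
    ⟨hole, hmem', fun c hc => ?_⟩⟩
  obtain ⟨hcD, hc1⟩ := (hmem c).1 hc
  obtain ⟨h1, h2⟩ := D.crossings_subset c hcD
  rw [decide_eq_true_iff, isPositive_iff, isPositive_iff, h.curve_eq _ h1 hc1,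
    curveVelocity_congr (h.eventually_eq hc1) h1,
    curveVelocity_congr (h.eventually_eq (hsnd c hc)) h2]

/-- The sign of a crossing of two strands. -/
theorem isPositive_strands_iff {o : SurfaceOrientation M} {D : KnotoidDiagram M}
    {e : OpenPartialHomeomorph M ℝ²} {E : ℝ} (hE : ∀ c ∈ D.crossings, InDisk e (D.curve c.1) →
      (D.IsPositive o c ↔ 0 < E * signedArea (D.chartVelocity e c.1) (D.chartVelocity e c.2)) ∧
      signedArea (D.chartVelocity e c.1) (D.chartVelocity e c.2) ≠ 0)
    {a b a' b' d d' : ℝ} {f f' τ τ' : ℝ → ℝ} (h : D.IsStrand e a b f d τ)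
    (h' : D.IsStrand e a' b' f' d' τ') {x : ℝ} (hx : x ∈ Ioo (-1 : ℝ) 1)
    (hc : (τ x, τ' x) ∈ D.crossings) (hdisk : InDisk e (D.curve (τ x))) :
    (D.IsPositive o (τ x, τ' x) ↔ 0 < E * d * d' * (deriv f' x - deriv f x)) ∧
      deriv f' x - deriv f x ≠ 0 := by
  obtain ⟨h1, h2⟩ := hE _ hc hdisk
  obtain ⟨r, hr, e1, e2⟩ := h.velocity x hx
  obtain ⟨r', hr', e3, e4⟩ := h'.velocity x hx
  have e5 : signedArea (D.chartVelocity e (τ x)) (D.chartVelocity e (τ' x)) =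
      (r * r') * (d * d' * (deriv f' x - deriv f x)) := by
    rw [signedArea, e1, e2, e3, e4]
    ring
  dsimp only at h1 h2
  rw [e5] at h1 h2
  refine ⟨?_, right_ne_zero_of_mul (right_ne_zero_of_mul h2)⟩
  have e6 : E * (r * r' * (d * d' * (deriv f' x - deriv f x))) =
      (r * r') * (E * d * d' * (deriv f' x - deriv f x)) := by ring
  rw [h1, e6, mul_pos_iff_of_pos_left (mul_pos hr hr')]

end KnotoidDiagram

end Disks

/-! ### Sign changes of functions on an interval -/

section SignChange

variable {g : ℝ → ℝ} {u v p : ℝ}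

theorem mul_pos_of_forall_ne_zero (hg : ContinuousOn g (Icc u v)) (huv : u ≤ v)
    (h0 : ∀ x ∈ Icc u v, g x ≠ 0) : 0 < g u * g v := by
  by_contra hneg
  rw [not_lt] at hneg
  have h1 : (0 : ℝ) ∈ g '' Icc u v := by
    rcases lt_or_gt_of_ne (h0 u (left_mem_Icc.2 huv)) with h | h
    · exact intermediate_value_Icc huv hg ⟨h.le, nonneg_of_mul_nonpos_right hneg h⟩
    · exact intermediate_value_Icc' huv hg ⟨nonpos_of_mul_nonpos_right hneg h, h.le⟩
  obtain ⟨x, hx, hx0⟩ := h1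
  exact h0 x hx hx0

/-- To the left of `p` the function keeps the sign of `g u`, so the difference quotients at `p` have
the opposite sign, and so does their limit. -/
theorem mul_deriv_neg_of_left {g' : ℝ} (hg : ContinuousOn g (Icc u p)) (hup : u < p)
    (h0 : ∀ x ∈ Ico u p, g x ≠ 0) (hp : g p = 0) (hd : HasDerivAt g g' p) (hg' : g' ≠ 0) :
    g u * g' < 0 := by
  have h1 : ∀ x ∈ Ico u p, 0 < g u * g x := fun x hx =>
    mul_pos_of_forall_ne_zero (hg.mono (Icc_subset_Icc_right hx.2.le)) hx.1 fun y hy =>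
      h0 y ⟨hy.1, hy.2.trans_lt hx.2⟩
  have h2 : Tendsto (fun x => g u * slope g p x) (𝓝[<] p) (𝓝 (g u * g')) :=
    (hd.tendsto_slope.mono_left (nhdsWithin_mono _ fun x hx => ne_of_lt hx)).const_mul _
  have h3 : g u * g' ≤ 0 := by
    refine le_of_tendsto h2 ?_
    filter_upwards [Ico_mem_nhdsLT hup] with x hx
    rw [slope_def_field, hp, sub_zero, ← mul_div_assoc]
    exact (div_neg_of_pos_of_neg (h1 x hx) (sub_neg.2 hx.2)).le
  exact lt_of_le_of_ne h3 (mul_ne_zero (h0 u ⟨le_rfl, hup⟩) hg')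

theorem mul_deriv_pos_of_right {g' : ℝ} (hg : ContinuousOn g (Icc p v)) (hpv : p < v)
    (h0 : ∀ x ∈ Ioc p v, g x ≠ 0) (hp : g p = 0) (hd : HasDerivAt g g' p) (hg' : g' ≠ 0) :
    0 < g v * g' := by
  have h1 := mul_deriv_neg_of_left (g := fun x => g (-x)) (u := -v) (p := -p) (g' := -g')
    (hg.comp continuousOn_neg fun x hx => ⟨le_neg.1 hx.2, neg_le.1 hx.1⟩) (neg_lt_neg hpv)
    (fun x hx => h0 _ ⟨lt_neg.1 hx.2, neg_le.1 hx.1⟩) (by simpa using hp)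
    (by simpa [Function.comp_def] using (HasDerivAt.comp (-p) (h := fun x : ℝ => -x) (h₂ := g) (h₂' := g')
      (by simpa using hd) (hasDerivAt_neg (-p)))) (neg_ne_zero.2 hg')
  simp only [neg_neg, mul_neg, neg_lt_zero] at h1
  exact h1

/-- A function with a single transversal zero changes its sign there. -/
theorem mul_mul_sub_pos_of_unique_zero {g' x : ℝ} (hg : ContinuousOn g (Icc u v))
    (hp : p ∈ Ioo u v) (h0 : ∀ x ∈ Icc u v, g x = 0 ↔ x = p) (hd : HasDerivAt g g' p)
    (hg' : g' ≠ 0) (hx : x ∈ Icc u v) (hxp : x ≠ p) : 0 < g x * g u * (p - x) := by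
  rcases lt_or_gt_of_ne hxp with h | h
  · refine mul_pos ?_ (sub_pos.2 h)
    rw [mul_comm]
    exact mul_pos_of_forall_ne_zero (hg.mono (Icc_subset_Icc_right hx.2)) hx.1 fun y hy hy0 =>
      ((h0 y ⟨hy.1, hy.2.trans hx.2⟩).1 hy0 ▸ hy.2).not_gt h
  · have h1 := mul_deriv_neg_of_left (hg.mono (Icc_subset_Icc_right hp.2.le)) hp.1
      (fun y hy hy0 => hy.2.ne ((h0 y ⟨hy.1, (hy.2.trans hp.2).le⟩).1 hy0))
      ((h0 p (Ioo_subset_Icc_self hp)).2 rfl) hd hg'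
    have h2 := mul_deriv_pos_of_right (hg.mono (Icc_subset_Icc hp.1.le hx.2)) h
      (fun y hy hy0 => hy.1.ne' ((h0 y ⟨(hp.1.trans hy.1).le, hy.2.trans hx.2⟩).1 hy0))
      ((h0 p (Ioo_subset_Icc_self hp)).2 rfl) hd hg'
    have h3 : (g x * g u) * g' ^ 2 < 0 := by
      calc (g x * g u) * g' ^ 2 = (g x * g') * (g u * g') := by ring
        _ < 0 := mul_neg_of_pos_of_neg h2 h1
    exact mul_pos_of_neg_of_neg (neg_of_mul_neg_left h3 (sq_nonneg _)) (sub_neg.2 h)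

end SignChange

/-! ### Reidemeister moves -/

namespace KnotoidDiagram

variable {M : Type*} [TopologicalSpace M] [ChartedSpace (EuclideanSpace ℝ (Fin 2)) M]

theorem AgreeOutside.exists_isStrand {n : ℕ} [IsManifold (𝓡 2) ∞ M] {D D' : KnotoidDiagram M}
    {e : OpenPartialHomeomorph M (EuclideanSpace ℝ (Fin 2))} {a b : Fin n → ℝ}
    (h : AgreeOutside D D' e a b) {f : Fin n → ℝ → ℝ} (hf : ∀ i, IsGraph D e (a i) (b i) (f i)) :
    ∃ (d : Fin n → ℝ) (τ : Fin n → ℝ → ℝ), ∀ i, D.IsStrand e (a i) (b i) (f i) (d i) (τ i) := by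
  choose d τ hS using fun i => (hf i).exists_isStrand h.chart (h.interval i).1 (h.interval i).2.1
    (h.interval i).2.2 fun t ht => h.meetsDisk_left.inDisk_of_mem ht
  exact ⟨d, τ, hS⟩

theorem AgreeOutside.exists_isStrand' {n : ℕ} [IsManifold (𝓡 2) ∞ M] {D D' : KnotoidDiagram M}
    {e : OpenPartialHomeomorph M (EuclideanSpace ℝ (Fin 2))} {a b : Fin n → ℝ}
    (h : AgreeOutside D D' e a b) {f : Fin n → ℝ → ℝ} (hf : ∀ i, IsGraph D' e (a i) (b i) (f i)) :
    ∃ (d : Fin n → ℝ) (τ : Fin n → ℝ → ℝ), ∀ i, D'.IsStrand e (a i) (b i) (f i) (d i) (τ i) := by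
  choose d τ hS using fun i => (hf i).exists_isStrand h.chart (h.interval i).1 (h.interval i).2.1
    (h.interval i).2.2 fun t ht => h.meetsDisk_right.inDisk_of_mem ht
  exact ⟨d, τ, hS⟩

/-- Strands that replace each other have the same direction. -/
theorem AgreeOutside.direction_eq [T2Space M] {n : ℕ} {D D' : KnotoidDiagram M}
    {e : OpenPartialHomeomorph M (EuclideanSpace ℝ (Fin 2))} {a b : Fin n → ℝ}
    (h : AgreeOutside D D' e a b) {i : Fin n} {f f' τ τ' : ℝ → ℝ} {d d' : ℝ}
    (hS : D.IsStrand e (a i) (b i) f d τ) (hS' : D'.IsStrand e (a i) (b i) f' d' τ') : d = d' := by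
  have h1 := hS.right
  rw [h.curve_right_eq i, hS'.right] at h1
  exact h1.symm

/-- Strands that replace each other have the same ends. -/
theorem AgreeOutside.boundary_eq [T2Space M] {n : ℕ} {D D' : KnotoidDiagram M}
    {e : OpenPartialHomeomorph M (EuclideanSpace ℝ (Fin 2))} {a b : Fin n → ℝ}
    (h : AgreeOutside D D' e a b) {i : Fin n} {f f' τ τ' : ℝ → ℝ} {d d' : ℝ}
    (hS : D.IsStrand e (a i) (b i) f d τ) (hS' : D'.IsStrand e (a i) (b i) f' d' τ') :
    f (-1) = f' (-1) ∧ f 1 = f' 1 := by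
  have hab := (h.interval i).2.1.le
  have ha : f (-d) = f' (-d) := by
    have h1 := hS.coord_one _ (hS.coord_mem _ (left_mem_Icc.2 hab))
    have h2 := hS'.coord_one _ (hS'.coord_mem _ (left_mem_Icc.2 hab))
    rw [hS.inv _ (left_mem_Icc.2 hab), hS.left] at h1
    rw [hS'.inv _ (left_mem_Icc.2 hab), hS'.left, ← h.direction_eq hS hS'] at h2
    rw [← h1, ← h2, h.curve_left_eq]
  have hb : f d = f' d := by
    have h1 := hS.coord_one _ (hS.coord_mem _ (right_mem_Icc.2 hab))
    have h2 := hS'.coord_one _ (hS'.coord_mem _ (right_mem_Icc.2 hab))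
    rw [hS.inv _ (right_mem_Icc.2 hab), hS.right] at h1
    rw [hS'.inv _ (right_mem_Icc.2 hab), hS'.right, ← h.direction_eq hS hS'] at h2
    rw [← h1, ← h2, h.curve_right_eq]
  rcases hS.sign with rfl | rfl
  · exact ⟨ha, hb⟩
  · rw [neg_neg] at ha
    exact ⟨hb, ha⟩

variable [IsManifold (𝓡 2) ∞ M] {X R : Type*} [Biquandle X] [CommRing R]

theorem bracketMatrix_eq_of_reidemeisterOne [Fintype X] (o : SurfaceOrientation M)
    (β : BiquandleBracket X R) {D D' : KnotoidDiagram M} (h : ReidemeisterOne D D') :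
    D.bracketMatrix o β = D'.bracketMatrix o β := by
  classical
  obtain ⟨e, a, b, f, hag, hf, -, c, ⟨hc, hc1⟩, huniq⟩ := h
  obtain ⟨O, ε, hO, hO'⟩ := hag.exists_isOuter o
  obtain ⟨d, τ, hS⟩ := hag.exists_isStrand (f := fun _ => f) (Fin.forall_fin_one.2 hf)
  -- A crossing would involve two different strands, but there is only one.
  rw [hO.bracketMatrix_eq_addBond β fun c hc i hi => by
    obtain ⟨j, hij, -⟩ := hag.meetsDisk_left.exists_of_crossing hS hc hi
    exact hij (Subsingleton.elim i j)]
  obtain ⟨j, hc2⟩ := (hag.meetsDisk_right.exists_mem_iff hc).1 ⟨0, hc1⟩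
  obtain rfl : j = 0 := Subsingleton.elim _ _
  have hne := (curve_eq_of_mem hc).1
  -- The overpass occupies the second slot exactly when `c.2 < c.1`.
  have hslot : (slotTime (fun _ : Fin 1 => min c.1 c.2) (fun _ => max c.1 c.2)
        (0, decide (c.2 < c.1)), slotTime (fun _ : Fin 1 => min c.1 c.2) (fun _ => max c.1 c.2)
        (0, !decide (c.2 < c.1))) = c := by
    rcases lt_or_gt_of_ne hne with hlt | hlt
    · simp [slotTime, hlt.le, hlt.not_gt]
    · simp [slotTime, hlt, hlt.le]
  rw [hO'.bracketMatrix_eq_add β (u := fun _ => min c.1 c.2) (v := fun _ => max c.1 c.2)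
    (Fin.forall_fin_one.2 ⟨le_min hc1.1 hc2.1, min_lt_max.2 hne, max_le hc1.2 hc2.2⟩)
    (fun _ : Unit => (0, decide (c.2 < c.1))) (fun _ => (0, !decide (c.2 < c.1)))
    (fun _ _ _ => rfl) (fun s => ⟨(), ?_⟩) (fun c' => ?_) (fun _ => decide (D'.IsPositive o c))
    (fun _ => by rw [hslot, decide_eq_true_iff])]
  · exact matrix_addBond_eq_add_slot_self hO.hole β ε _ _
  · obtain ⟨i, x⟩ := s
    obtain rfl : i = 0 := Subsingleton.elim _ _
    cases x <;> cases decide (c.2 < c.1) <;> simp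
  · simp only [hslot, exists_const]
    constructor
    · rintro ⟨h1, h2⟩
      exact huniq c' ⟨h1, by simpa using h2⟩
    · rintro rfl
      exact ⟨hc, 0, hc1⟩

/-- Disjoint arcs keep their vertical order, and the replacing arcs have the same ends. So their
difference has the same sign at both ends of the interval, its slopes at the two zeros are opposite,
and the crossings have opposite signs. -/
theorem bracketMatrix_eq_of_reidemeisterTwo [T2Space M] [Fintype X] (o : SurfaceOrientation M)
    (β : BiquandleBracket X R) {D D' : KnotoidDiagram M} (h : ReidemeisterTwo D D') :
    D.bracketMatrix o β = D'.bracketMatrix o β := by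
  classical
  obtain ⟨e, a, b, f, f', hag, hf, hf', hne, hcard, hover⟩ := h
  obtain ⟨O, ε, hO, hO'⟩ := hag.exists_isOuter o
  obtain ⟨d, τ, hS⟩ := hag.exists_isStrand hf
  obtain ⟨d', τ', hS'⟩ := hag.exists_isStrand' hf'
  obtain ⟨E, hE0, hE⟩ := exists_isPositive_iff_chart o hag.chart hag.square
  have hmd := hag.meetsDisk_right
  have hover' : ∀ i j : Fin 2, i < j →
      ∀ c ∈ D'.crossings, ¬ (c.1 ∈ Icc (a j) (b j) ∧ c.2 ∈ Icc (a i) (b i)) := by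
    intro i j hij
    obtain ⟨rfl, rfl⟩ : i = 0 ∧ j = 1 := by omega
    exact hover
  rw [hO.bracketMatrix_eq_addBond β fun c hc i hi => by
    obtain ⟨j, hij, x, hx, hfx, -⟩ := hag.meetsDisk_left.exists_of_crossing hS hc hi
    obtain ⟨rfl, rfl⟩ | ⟨rfl, rfl⟩ : (i = 0 ∧ j = 1) ∨ (i = 1 ∧ j = 0) := by omega
    · exact hne x hx hfx
    · exact hne x hx hfx.symm]
  have hends := fun i => hag.boundary_eq (hS i) (hS' i)
  -- the difference of the two strands of `D'`
  set g : ℝ → ℝ := fun x => f' 1 x - f' 0 x with hg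
  have hgc : ContinuousOn g (Icc (-1) 1) := (hS' 1).continuous.sub (hS' 0).continuous
  have hgd : ∀ x ∈ Ioo (-1 : ℝ) 1, HasDerivAt g (deriv (f' 1) x - deriv (f' 0) x) x := fun x hx =>
    ((hS' 1).differentiable x hx).hasDerivAt.sub ((hS' 0).differentiable x hx).hasDerivAt
  have hend : 0 < g (-1) * g 1 := by
    have h1 := mul_pos_of_forall_ne_zero (g := fun x => f 1 x - f 0 x) (u := -1) (v := 1)
      ((hS 1).continuous.sub (hS 0).continuous) (by norm_num)
      fun x hx => sub_ne_zero.2 (hne x hx).symm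
    simpa only [hg, ← (hends 0).1, ← (hends 1).1, ← (hends 0).2, ← (hends 1).2] using h1
  obtain ⟨x, y, hxy, hset⟩ : ∃ x y, x < y ∧
      {x | x ∈ Icc (-1 : ℝ) 1 ∧ f' 0 x = f' 1 x} = {x, y} := by
    obtain ⟨x, y, hxy, hset⟩ := Set.ncard_eq_two.1 hcard
    rcases lt_or_gt_of_ne hxy with h1 | h1
    · exact ⟨x, y, h1, hset⟩
    · exact ⟨y, x, h1, by rw [hset, Set.pair_comm]⟩
  have hzero : ∀ z ∈ Icc (-1 : ℝ) 1, g z = 0 ↔ z = x ∨ z = y := by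
    intro z hz
    have h1 : z ∈ {x | x ∈ Icc (-1 : ℝ) 1 ∧ f' 0 x = f' 1 x} ↔ z = x ∨ z = y := by
      rw [hset]
      rfl
    rw [← h1, hg, sub_eq_zero]
    exact ⟨fun h2 => ⟨hz, h2.symm⟩, fun h2 => h2.2.symm⟩
  have hx : x ∈ Icc (-1 : ℝ) 1 ∧ f' 0 x = f' 1 x := by
    have : x ∈ ({x, y} : Set ℝ) := Or.inl rfl
    rwa [← hset] at this
  have hy : y ∈ Icc (-1 : ℝ) 1 ∧ f' 0 y = f' 1 y := by
    have : y ∈ ({x, y} : Set ℝ) := Or.inr rfl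
    rwa [← hset] at this
  have hxI : -1 < x := lt_of_le_of_ne hx.1.1 fun h1 => by
    rw [h1, (hzero x hx.1).2 (Or.inl rfl), zero_mul] at hend
    exact lt_irrefl _ hend
  have hyI : y < 1 := lt_of_le_of_ne hy.1.2 fun h1 => by
    rw [← h1, (hzero y hy.1).2 (Or.inr rfl), mul_zero] at hend
    exact lt_irrefl _ hend
  have hxm : x ∈ Ioo (-1 : ℝ) 1 := ⟨hxI, hxy.trans hyI⟩
  have hym : y ∈ Ioo (-1 : ℝ) 1 := ⟨hxI.trans hxy, hyI⟩
  have hcr := hmd.mem_crossings_iff hS' hover'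
  have hmemc : ∀ z ∈ Icc (-1 : ℝ) 1, f' 0 z = f' 1 z → (τ' 0 z, τ' 1 z) ∈ D'.crossings :=
    fun z hz hfz => ((hcr _).2 ⟨0, 1, by decide, z, hz, hfz, rfl⟩).1
  have hsign : ∀ z ∈ Ioo (-1 : ℝ) 1, f' 0 z = f' 1 z →
      (D'.IsPositive o (τ' 0 z, τ' 1 z) ↔
        0 < E * d' 0 * d' 1 * (deriv (f' 1) z - deriv (f' 0) z)) ∧
      deriv (f' 1) z - deriv (f' 0) z ≠ 0 := fun z hz hfz =>
    isPositive_strands_iff (hE D') (hS' 0) (hS' 1) hz (hmemc z (Ioo_subset_Icc_self hz) hfz)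
      (hmd.inDisk_of_mem ((hS' 0).mem z (Ioo_subset_Icc_self hz)))
  obtain ⟨hsx, hdx⟩ := hsign x hxm hx.2
  obtain ⟨hsy, hdy⟩ := hsign y hym hy.2
  have h1 := mul_deriv_neg_of_left (hgc.mono (Icc_subset_Icc_right hx.1.2)) hxI
    (fun z hz hz0 => by
      rcases (hzero z ⟨hz.1, hz.2.le.trans hx.1.2⟩).1 hz0 with rfl | rfl
      · exact lt_irrefl _ hz.2
      · exact hxy.not_gt hz.2) ((hzero x hx.1).2 (Or.inl rfl)) (hgd x hxm) hdx
  have h2 := mul_deriv_pos_of_right (hgc.mono (Icc_subset_Icc_left hy.1.1)) hyI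
    (fun z hz hz0 => by
      rcases (hzero z ⟨hy.1.1.trans hz.1.le, hz.2⟩).1 hz0 with rfl | rfl
      · exact hxy.not_gt hz.1
      · exact lt_irrefl _ hz.1) ((hzero y hy.1).2 (Or.inr rfl)) (hgd y hym) hdy
  have hd0 : ∀ i, d' i ≠ 0 := fun i => by rcases (hS' i).sign with h | h <;> rw [h] <;> norm_num
  have hopp : D'.IsPositive o (τ' 0 x, τ' 1 x) ↔ ¬ D'.IsPositive o (τ' 0 y, τ' 1 y) := by
    rw [hsx, hsy]
    set p := deriv (f' 1) x - deriv (f' 0) x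
    set q := deriv (f' 1) y - deriv (f' 0) y
    set K := E * d' 0 * d' 1
    have hK : K ≠ 0 := mul_ne_zero (mul_ne_zero hE0 (hd0 0)) (hd0 1)
    have h3 : p * q < 0 := by
      have h4 : (p * q) * (g (-1) * g 1) < 0 := by
        calc (p * q) * (g (-1) * g 1) = (g (-1) * p) * (g 1 * q) := by ring
          _ < 0 := mul_neg_of_neg_of_pos h1 h2
      exact neg_of_mul_neg_left h4 hend.le
    have h5 : (K * p) * (K * q) < 0 := by
      calc (K * p) * (K * q) = K ^ 2 * (p * q) := by ring
        _ < 0 := mul_neg_of_pos_of_neg (sq_pos_iff.2 hK) h3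
    rcases mul_neg_iff.1 h5 with ⟨h6, h7⟩ | ⟨h6, h7⟩
    · exact iff_of_true h6 h7.not_gt
    · exact iff_of_false h6.not_gt (not_not.2 h7)
  -- order the crossings along the upper strand
  obtain ⟨x, y, hx, hy, hopp, hlt, hset⟩ : ∃ x y, (x ∈ Icc (-1 : ℝ) 1 ∧ f' 0 x = f' 1 x) ∧
      (y ∈ Icc (-1 : ℝ) 1 ∧ f' 0 y = f' 1 y) ∧
      (D'.IsPositive o (τ' 0 x, τ' 1 x) ↔ ¬ D'.IsPositive o (τ' 0 y, τ' 1 y)) ∧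
      τ' 0 x < τ' 0 y ∧ {x | x ∈ Icc (-1 : ℝ) 1 ∧ f' 0 x = f' 1 x} = {x, y} := by
    rcases (hS' 0).sign with h3 | h3
    · refine ⟨x, y, hx, hy, hopp, ?_, hset⟩
      rw [(hS' 0).mono x hx.1 y hy.1, h3]
      linarith
    · refine ⟨y, x, hy, hx, by rw [hopp, not_not], ?_, by rw [hset, Set.pair_comm]⟩
      rw [(hS' 0).mono y hy.1 x hx.1, h3]
      linarith
  have hne1 : τ' 1 x ≠ τ' 1 y := by
    intro h3
    have h4 := (hS' 1).coord_zero x hx.1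
    rw [h3, (hS' 1).coord_zero y hy.1] at h4
    rw [h4] at hlt
    exact lt_irrefl _ hlt
  -- This bit records whether the lower strand meets the two crossings in the opposite order.
  set z : Bool := decide (τ' 1 y < τ' 1 x) with hz
  set u : Fin 2 → ℝ := ![τ' 0 x, min (τ' 1 x) (τ' 1 y)] with hu
  set v : Fin 2 → ℝ := ![τ' 0 y, max (τ' 1 x) (τ' 1 y)] with hv
  have hslot : ∀ k : Fin 2, (slotTime u v (![(0, false), (0, true)] k),
      slotTime u v (![(1, z), (1, !z)] k)) = (τ' 0 (![x, y] k), τ' 1 (![x, y] k)) := by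
    intro k
    rcases lt_or_gt_of_ne hne1 with h3 | h3 <;> fin_cases k <;>
      simp [slotTime, hu, hv, hz, h3, h3.le, h3.not_gt]
  set P : Bool := decide (D'.IsPositive o (τ' 0 x, τ' 1 x)) with hP
  rw [hO'.bracketMatrix_eq_add β (u := u) (v := v) ?_ ![(0, false), (0, true)]
    ![(1, z), (1, !z)] ?_ ?_ (fun c => ?_) ![P, !P] (fun k => ?_)]
  · exact matrix_addBond_eq_add_slot_pair hO.hole β ε z P
  · refine Fin.forall_fin_two.2 ⟨⟨((hS' 0).mem x hx.1).1, hlt, ((hS' 0).mem y hy.1).2⟩, ?_⟩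
    exact ⟨le_min ((hS' 1).mem x hx.1).1 ((hS' 1).mem y hy.1).1, min_lt_max.2 hne1,
      max_le ((hS' 1).mem x hx.1).2 ((hS' 1).mem y hy.1).2⟩
  · intro k l hkl
    fin_cases k <;> fin_cases l <;> simp at hkl ⊢
  · rintro ⟨i, w⟩
    fin_cases i <;> cases w <;> cases z <;> decide
  · rw [hcr]
    simp only [hslot]
    constructor
    · rintro ⟨i, j, hij, t, ht, hft, rfl⟩
      obtain ⟨rfl, rfl⟩ : i = 0 ∧ j = 1 := by omega
      have h3 : t ∈ ({x, y} : Set ℝ) := by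
        rw [← hset]
        exact ⟨ht, hft⟩
      rcases h3 with rfl | rfl
      · exact ⟨0, rfl⟩
      · exact ⟨1, rfl⟩
    · rintro ⟨k, rfl⟩
      refine ⟨0, 1, by decide, ![x, y] k, ?_⟩
      fin_cases k
      · exact ⟨hx.1, hx.2, rfl⟩
      · exact ⟨hy.1, hy.2, rfl⟩
  · rw [hslot]
    fin_cases k
    · simp [hP]
    · simp [hP, hopp]

end KnotoidDiagram

/-! ### The third Reidemeister move for diagrams, and the theorem -/

namespace KnotoidDiagram

variable {M : Type*} [TopologicalSpace M] [ChartedSpace (EuclideanSpace ℝ (Fin 2)) M]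
  [IsManifold (𝓡 2) ∞ M] {X R : Type*} [Biquandle X] [CommRing R]

/-- Three strands, of which any two cross once, in general position. The bits say which of the
other two strands is met first. -/
theorem IsOuter.bracketMatrix_eq_triangle [Fintype X] {o : SurfaceOrientation M}
    {D : KnotoidDiagram M} {O : Finset (ℝ × ℝ)} {ε : ℝ × ℝ → Bool} {a b : Fin 3 → ℝ}
    (hO : D.IsOuter o O ε a b) (β : BiquandleBracket X R)
    {e : OpenPartialHomeomorph M (EuclideanSpace ℝ (Fin 2))} (hmd : D.MeetsDisk e a b)
    {f : Fin 3 → ℝ → ℝ} {d : Fin 3 → ℝ} {τ : Fin 3 → ℝ → ℝ}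
    (hS : ∀ i, D.IsStrand e (a i) (b i) (f i) (d i) (τ i))
    (hover : ∀ i j, i < j →
      ∀ c ∈ D.crossings, ¬ (c.1 ∈ Icc (a j) (b j) ∧ c.2 ∈ Icc (a i) (b i)))
    {p : Fin 3 → Fin 3 → ℝ} (hp : ∀ i j, i ≠ j → ∀ x ∈ Icc (-1 : ℝ) 1, f i x = f j x ↔ x = p i j)
    (hpm : ∀ i j, i ≠ j → p i j ∈ Icc (-1 : ℝ) 1) (hps : ∀ i j, i ≠ j → p i j = p j i)
    (hpne : ∀ i j k, i ≠ j → j ≠ k → i ≠ k → p i j ≠ p i k)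
    (g bB bM bT : Bool) (hB : bB = true ↔ d 2 * p 1 2 < d 2 * p 0 2)
    (hM : bM = true ↔ d 1 * p 1 2 < d 1 * p 0 1) (hT : bT = true ↔ d 0 * p 0 2 < d 0 * p 0 1)
    (h12 : (g == bT) = true ↔ D.IsPositive o (τ 1 (p 1 2), τ 2 (p 1 2)))
    (h01 : (g == bB) = true ↔ D.IsPositive o (τ 0 (p 0 1), τ 1 (p 0 1)))
    (h02 : (g == bM) = true ↔ D.IsPositive o (τ 0 (p 0 2), τ 2 (p 0 2))) :
    D.bracketMatrix o β = ((outerCircuit O ε a b).add fun k => slotXing O a b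
      (triangleOver bM bT k) (triangleUnder bB bM k) (triangleSign g bB bM bT k)).matrix β := by
  classical
  have hcr := hmd.mem_crossings_iff hS hover
  have n01 : (0 : Fin 3) ≠ 1 := by decide
  have n02 : (0 : Fin 3) ≠ 2 := by decide
  have n12 : (1 : Fin 3) ≠ 2 := by decide
  have m01 := hpm 0 1 n01
  have m02 := hpm 0 2 n02
  have m12 := hpm 1 2 n12
  have d0 : p 0 1 ≠ p 0 2 := hpne 0 1 2 n01 n12 n02
  have d1 : p 1 2 ≠ p 0 1 := by
    rw [hps 0 1 n01]
    exact hpne 1 2 0 n12 n02.symm n01.symm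
  have d2 : p 1 2 ≠ p 0 2 := by
    rw [hps 0 2 n02, hps 1 2 n12]
    exact hpne 2 1 0 n12.symm n01.symm n02.symm
  have hτ : ∀ i, ∀ x ∈ Icc (-1 : ℝ) 1, ∀ y ∈ Icc (-1 : ℝ) 1, x ≠ y → ∀ bit : Bool,
      (bit = true ↔ d i * x < d i * y) →
      (bif bit then τ i x else τ i y) < (bif bit then τ i y else τ i x) := by
    intro i x hx y hy hxy bit hbit
    have hd : d i ≠ 0 := by rcases (hS i).sign with h | h <;> rw [h] <;> norm_num
    cases bit
    · rw [cond_false, cond_false, (hS i).mono y hy x hx]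
      exact lt_of_le_of_ne (not_lt.1 fun h => Bool.false_ne_true (hbit.2 h))
        fun h => hxy (mul_left_cancel₀ hd h.symm)
    · rw [cond_true, cond_true, (hS i).mono x hx y hy]
      exact hbit.1 rfl
  have hmemb : ∀ i, ∀ x ∈ Icc (-1 : ℝ) 1, ∀ y ∈ Icc (-1 : ℝ) 1, ∀ bit : Bool,
      (bif bit then τ i x else τ i y) ∈ Icc (a i) (b i) := by
    intro i x hx y hy bit
    cases bit
    · exact (hS i).mem y hy
    · exact (hS i).mem x hx
  -- The first and, below, the second passage of each strand, as dictated by the bits.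
  let u : Fin 3 → ℝ := ![bif bT then τ 0 (p 0 2) else τ 0 (p 0 1),
    bif bM then τ 1 (p 1 2) else τ 1 (p 0 1), bif bB then τ 2 (p 1 2) else τ 2 (p 0 2)]
  let v : Fin 3 → ℝ := ![bif bT then τ 0 (p 0 1) else τ 0 (p 0 2),
    bif bM then τ 1 (p 0 1) else τ 1 (p 1 2), bif bB then τ 2 (p 0 2) else τ 2 (p 1 2)]
  have hmemb' : ∀ i, ∀ x ∈ Icc (-1 : ℝ) 1, ∀ y ∈ Icc (-1 : ℝ) 1, ∀ bit : Bool,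
      (bif bit then τ i y else τ i x) ∈ Icc (a i) (b i) := by
    intro i x hx y hy bit
    have := hmemb i x hx y hy (!bit)
    cases bit <;> exact this
  have huv : ∀ i, a i ≤ u i ∧ u i < v i ∧ v i ≤ b i := by
    intro i
    fin_cases i
    · exact ⟨(hmemb 0 _ m02 _ m01 bT).1, hτ 0 _ m02 _ m01 d0.symm bT hT,
        (hmemb' 0 _ m02 _ m01 bT).2⟩
    · exact ⟨(hmemb 1 _ m12 _ m01 bM).1, hτ 1 _ m12 _ m01 d1 bM hM, (hmemb' 1 _ m12 _ m01 bM).2⟩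
    · exact ⟨(hmemb 2 _ m12 _ m02 bB).1, hτ 2 _ m12 _ m02 d2 bB hB, (hmemb' 2 _ m12 _ m02 bB).2⟩
  have hslot : ∀ k : Fin 3, (slotTime u v (triangleOver bM bT k),
      slotTime u v (triangleUnder bB bM k)) = ![(τ 1 (p 1 2), τ 2 (p 1 2)),
        (τ 0 (p 0 1), τ 1 (p 0 1)), (τ 0 (p 0 2), τ 2 (p 0 2))] k := by
    intro k
    fin_cases k <;> cases bB <;> cases bM <;> cases bT <;> rfl
  refine hO.bracketMatrix_eq_add β huv (triangleOver bM bT) (triangleUnder bB bM) ?_ ?_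
    (fun c => ?_) (triangleSign g bB bM bT) (fun k => ?_)
  · cases bB <;> cases bM <;> cases bT <;> decide
  · cases bB <;> cases bM <;> cases bT <;> decide
  · rw [hcr]
    simp only [hslot]
    constructor
    · rintro ⟨i, j, hij, t, ht, hft, rfl⟩
      obtain rfl := (hp i j hij.ne t ht).1 hft
      obtain ⟨rfl, rfl⟩ | ⟨rfl, rfl⟩ | ⟨rfl, rfl⟩ :
          (i = 1 ∧ j = 2) ∨ (i = 0 ∧ j = 1) ∨ (i = 0 ∧ j = 2) := by omega
      · exact ⟨0, rfl⟩
      · exact ⟨1, rfl⟩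
      · exact ⟨2, rfl⟩
    · rintro ⟨k, rfl⟩
      fin_cases k
      · exact ⟨1, 2, by decide, p 1 2, m12, (hp 1 2 n12 _ m12).2 rfl, rfl⟩
      · exact ⟨0, 1, by decide, p 0 1, m01, (hp 0 1 n01 _ m01).2 rfl, rfl⟩
      · exact ⟨0, 2, by decide, p 0 2, m02, (hp 0 2 n02 _ m02).2 rfl, rfl⟩
  · rw [hslot]
    fin_cases k
    · exact h12
    · exact h01
    · exact h02

theorem beq_decide_beq_iff (s : Bool) (P : Prop) [Decidable P] :
    ((s == decide P) == s) = true ↔ P := by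
  cases s <;> simp

theorem decide_pos_beq_congr {x y z w : ℝ} (h : 0 < (x * y) * (z * w)) :
    (decide (0 < x) == decide (0 < y)) = (decide (0 < z) == decide (0 < w)) := by
  have key : ∀ {x y : ℝ}, x * y ≠ 0 →
      ((decide (0 < x) == decide (0 < y)) = true ↔ 0 < x * y) := by
    intro x y hxy
    rw [beq_iff_eq, decide_eq_decide]
    rcases lt_or_gt_of_ne (left_ne_zero_of_mul hxy) with h1 | h1
    · rcases lt_or_gt_of_ne (right_ne_zero_of_mul hxy) with h2 | h2
      · exact iff_of_true (iff_of_false h1.not_gt h2.not_gt) (mul_pos_of_neg_of_neg h1 h2)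
      · exact iff_of_false (fun h3 => h1.not_gt (h3.2 h2)) (mul_neg_of_neg_of_pos h1 h2).not_gt
    · rw [mul_pos_iff_of_pos_left h1]
      exact ⟨fun h2 => h2.1 h1, fun h2 => iff_of_true h1 h2⟩
  rw [Bool.eq_iff_iff, key (left_ne_zero_of_mul h.ne'), key (right_ne_zero_of_mul h.ne')]
  exact pos_iff_pos_of_mul_pos h

/-- The position of the crossings of three curves is governed by their order at the left end. -/
theorem triangle_order {f : Fin 3 → ℝ → ℝ} {p : Fin 3 → Fin 3 → ℝ}
    (hpm : ∀ i j, i ≠ j → p i j ∈ Icc (-1 : ℝ) 1)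
    (hp : ∀ i j, i ≠ j → f i (p i j) = f j (p i j))
    (hpne : ∀ i j k, i ≠ j → j ≠ k → i ≠ k → p i j ≠ p i k) (hps : ∀ i j, i ≠ j → p i j = p j i)
    (hsgn : ∀ i j, i ≠ j → ∀ x ∈ Icc (-1 : ℝ) 1, x ≠ p i j →
      0 < (f i x - f j x) * (f i (-1) - f j (-1)) * (p i j - x))
    {i j k : Fin 3} (hij : i ≠ j) (hjk : j ≠ k) (hik : i ≠ k) :
    0 < (f i (-1) - f j (-1)) * (f j (-1) - f k (-1)) * ((p i j - p i k) * (p i k - p j k)) := by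
  have h1 := hsgn i j hij (p i k) (hpm i k hik) (hpne i j k hij hjk hik).symm
  have h2 := hsgn j k hjk (p i k) (hpm i k hik) (by
    rw [hps i k hik, hps j k hjk]
    exact hpne k i j hik.symm hij hjk.symm)
  -- Where the strands `i` and `k` meet, both factors compare `j` with one and the same height.
  have h3 : f j (p i k) - f k (p i k) = -(f i (p i k) - f j (p i k)) := by
    rw [hp i k hik]
    ring
  rw [h3] at h2
  have h4 : 0 < (f i (p i k) - f j (p i k)) ^ 2 * ((f i (-1) - f j (-1)) *
      (f j (-1) - f k (-1)) * ((p i j - p i k) * (p i k - p j k))) := by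
    calc 0 < _ := mul_pos h1 h2
      _ = _ := by ring
  exact pos_of_mul_pos_right h4 (sq_nonneg _)

/-- The signs of the crossings depend only on the directions of the strands and on their vertical
order at the left edge, and neither changes. The order of the crossings along each strand is
reversed. These are the two sides of `matrix_add_triangle`. -/
theorem bracketMatrix_eq_of_reidemeisterThree [T2Space M] [Fintype X] (o : SurfaceOrientation M)
    (β : BiquandleBracket X R) {D D' : KnotoidDiagram M} (h : ReidemeisterThree D D') :
    D.bracketMatrix o β = D'.bracketMatrix o β := by
  classical
  obtain ⟨e, a, b, f, f', p, p', hag, hf, hf', hset, hset', hord, hover, hover'⟩ := h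
  obtain ⟨O, ε, hO, hO'⟩ := hag.exists_isOuter o
  obtain ⟨d, τ, hS⟩ := hag.exists_isStrand hf
  obtain ⟨d', τ', hS'⟩ := hag.exists_isStrand' hf'
  obtain ⟨E, hE0, hE⟩ := exists_isPositive_iff_chart o hag.chart hag.square
  obtain rfl : d = d' := funext fun i => hag.direction_eq (hS i) (hS' i)
  have hends := fun i => hag.boundary_eq (hS i) (hS' i)
  have hmd := hag.meetsDisk_left
  have hmd' := hag.meetsDisk_right
  have main : ∀ {f : Fin 3 → ℝ → ℝ} {p : Fin 3 → Fin 3 → ℝ},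
      (∀ i j, i ≠ j → {x | x ∈ Icc (-1 : ℝ) 1 ∧ f i x = f j x} = {p i j}) →
      (∀ i j, i ≠ j → ∀ x ∈ Icc (-1 : ℝ) 1, f i x = f j x ↔ x = p i j) ∧
      (∀ i j, i ≠ j → p i j ∈ Icc (-1 : ℝ) 1 ∧ f i (p i j) = f j (p i j)) ∧
      (∀ i j, i ≠ j → p i j = p j i) := by
    intro f p hset
    have h1 : ∀ i j, i ≠ j → ∀ x, (x ∈ Icc (-1 : ℝ) 1 ∧ f i x = f j x) ↔ x = p i j :=
      fun i j hij x => Set.ext_iff.1 (hset i j hij) x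
    refine ⟨fun i j hij x hx => ⟨fun h2 => (h1 i j hij x).1 ⟨hx, h2⟩, fun h2 =>
      ((h1 i j hij x).2 h2).2⟩, fun i j hij => (h1 i j hij _).2 rfl, fun i j hij => ?_⟩
    obtain ⟨h2, h3⟩ := (h1 i j hij _).2 rfl
    exact (h1 j i hij.symm _).1 ⟨h2, h3.symm⟩
  obtain ⟨hp, hpm, hps⟩ := main hset
  obtain ⟨hp', hpm', hps'⟩ := main hset'
  have hpne : ∀ i j k, i ≠ j → j ≠ k → i ≠ k → p i j ≠ p i k := by
    intro i j k hij hjk hik heq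
    refine hmd.no_triple hS hij.symm hik hjk (hpm i j hij).1 (hpm i j hij).2.symm ?_
    rw [heq]
    exact (hpm i k hik).2
  have hpne' : ∀ i j k, i ≠ j → j ≠ k → i ≠ k → p' i j ≠ p' i k := by
    intro i j k hij hjk hik heq
    refine hmd'.no_triple hS' hij.symm hik hjk (hpm' i j hij).1 (hpm' i j hij).2.symm ?_
    rw [heq]
    exact (hpm' i k hik).2
  have hthird : ∀ i j : Fin 3, i ≠ j → ∃ k, j ≠ k ∧ i ≠ k := by decide
  -- no crossing lies on the boundary
  have hleft : ∀ i j, i ≠ j → f i (-1) ≠ f j (-1) := by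
    intro i j hij heq
    obtain ⟨k, hjk, hik⟩ := hthird i j hij
    have hm : (-1 : ℝ) ∈ Icc (-1 : ℝ) 1 := by norm_num
    have e1 := (hp i j hij _ hm).1 heq
    rw [(hends i).1, (hends j).1] at heq
    have e2 := (hp' i j hij _ hm).1 heq
    -- A crossing on the left edge would come before the other crossing of its strand in both
    -- diagrams, against the reversal of the order.
    have h1 : p i j < p i k := lt_of_le_of_ne (e1 ▸ (hpm i k hik).1.1) (hpne i j k hij hjk hik)
    have h2 := (hord i j k hij hjk hik).1 h1
    rw [← e2] at h2
    exact h2.not_ge (hpm' i k hik).1.1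
  have hright : ∀ i j, i ≠ j → f i 1 ≠ f j 1 := by
    intro i j hij heq
    obtain ⟨k, hjk, hik⟩ := hthird i j hij
    have hm : (1 : ℝ) ∈ Icc (-1 : ℝ) 1 := by norm_num
    have e1 := (hp i j hij _ hm).1 heq
    rw [(hends i).2, (hends j).2] at heq
    have e2 := (hp' i j hij _ hm).1 heq
    have h1 : p i k < p i j :=
      lt_of_le_of_ne (e1 ▸ (hpm i k hik).1.2) (hpne i j k hij hjk hik).symm
    have h2 := (hord i k j hik hjk.symm hij).1 h1
    rw [← e2] at h2
    exact h2.not_ge (hpm' i k hik).1.2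
  have hd0 : ∀ i, d i ≠ 0 := fun i => by rcases (hS i).sign with h | h <;> rw [h] <;> norm_num
  -- signs and positions of the crossings
  have hlocal : ∀ {D : KnotoidDiagram M} {f : Fin 3 → ℝ → ℝ} {p : Fin 3 → Fin 3 → ℝ}
      {τ : Fin 3 → ℝ → ℝ}, D.MeetsDisk e a b →
      (∀ i, D.IsStrand e (a i) (b i) (f i) (d i) (τ i)) →
      (∀ i j, i < j → ∀ c ∈ D.crossings, ¬ (c.1 ∈ Icc (a j) (b j) ∧ c.2 ∈ Icc (a i) (b i))) →
      (∀ i j, i ≠ j → ∀ x ∈ Icc (-1 : ℝ) 1, f i x = f j x ↔ x = p i j) →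
      (∀ i j, i ≠ j → p i j ∈ Icc (-1 : ℝ) 1 ∧ f i (p i j) = f j (p i j)) →
      (∀ i j, i ≠ j → p i j = p j i) →
      (∀ i j, i ≠ j → f i (-1) ≠ f j (-1)) → (∀ i j, i ≠ j → f i 1 ≠ f j 1) →
      (∀ i j, i < j → (D.IsPositive o (τ i (p i j), τ j (p i j)) ↔
        0 < E * d i * d j * (f i (-1) - f j (-1)))) ∧
      ∀ i j, i ≠ j → ∀ x ∈ Icc (-1 : ℝ) 1, x ≠ p i j →
        0 < (f i x - f j x) * (f i (-1) - f j (-1)) * (p i j - x) := by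
    intro D f p τ hmd hS hover hp hpm hps hl hr
    have hIoo : ∀ i j, i ≠ j → p i j ∈ Ioo (-1 : ℝ) 1 := by
      intro i j hij
      obtain ⟨⟨h1, h2⟩, h3⟩ := hpm i j hij
      refine ⟨lt_of_le_of_ne h1 fun h => hl i j hij ?_, lt_of_le_of_ne h2 fun h => hr i j hij ?_⟩
      · rw [h]
        exact h3
      · rw [← h]
        exact h3
    have hcont : ∀ i j, ContinuousOn (fun x => f i x - f j x) (Icc (-1) 1) := fun i j =>
      (hS i).continuous.sub (hS j).continuous
    have hder : ∀ i j, i ≠ j → HasDerivAt (fun x => f i x - f j x)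
        (deriv (f i) (p i j) - deriv (f j) (p i j)) (p i j) := fun i j hij =>
      ((hS i).differentiable _ (hIoo i j hij)).hasDerivAt.sub
        ((hS j).differentiable _ (hIoo i j hij)).hasDerivAt
    have hsg : ∀ i j, i < j → (D.IsPositive o (τ i (p i j), τ j (p i j)) ↔
        0 < E * d i * d j * (deriv (f j) (p i j) - deriv (f i) (p i j))) ∧
        deriv (f j) (p i j) - deriv (f i) (p i j) ≠ 0 := by
      intro i j hij
      obtain ⟨h1, h2⟩ := hpm i j hij.ne
      exact isPositive_strands_iff (hE D) (hS i) (hS j) (hIoo i j hij.ne)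
        ((hmd.mem_crossings_iff hS hover _).2 ⟨i, j, hij, _, h1, h2, rfl⟩).1
        (hmd.inDisk_of_mem ((hS i).mem _ h1))
    have htr : ∀ i j, i ≠ j → deriv (f i) (p i j) - deriv (f j) (p i j) ≠ 0 := by
      intro i j hij
      rcases lt_or_gt_of_ne hij with h | h
      · have := (hsg i j h).2
        rwa [← neg_sub, neg_ne_zero] at this
      · have := (hsg j i h).2
        rwa [hps j i hij.symm] at this
    have hzero : ∀ i j, i ≠ j → ∀ x ∈ Icc (-1 : ℝ) 1, f i x - f j x = 0 ↔ x = p i j :=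
      fun i j hij x hx => by rw [sub_eq_zero, hp i j hij x hx]
    refine ⟨fun i j hij => ?_, fun i j hij x hx hxp => mul_mul_sub_pos_of_unique_zero (hcont i j)
      (hIoo i j hij) (hzero i j hij) (hder i j hij) (htr i j hij) hx hxp⟩
    rw [(hsg i j hij).1]
    have hI := hIoo i j hij.ne
    have h1 := mul_deriv_neg_of_left ((hcont i j).mono (Icc_subset_Icc_right hI.2.le)) hI.1
      (fun x hx hx0 => hx.2.ne ((hzero i j hij.ne x ⟨hx.1, (hx.2.trans hI.2).le⟩).1 hx0))
      ((hzero i j hij.ne _ (hpm i j hij.ne).1).2 rfl) (hder i j hij.ne) (htr i j hij.ne)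
    refine pos_iff_pos_of_mul_pos ?_
    calc 0 < (E * d i * d j) ^ 2 *
          -((f i (-1) - f j (-1)) * (deriv (f i) (p i j) - deriv (f j) (p i j))) :=
          mul_pos (sq_pos_iff.2 (mul_ne_zero (mul_ne_zero hE0 (hd0 i)) (hd0 j))) (neg_pos.2 h1)
      _ = _ := by ring
  have hleft' : ∀ i j, i ≠ j → f' i (-1) ≠ f' j (-1) := by
    intro i j hij
    rw [← (hends i).1, ← (hends j).1]
    exact hleft i j hij
  have hright' : ∀ i j, i ≠ j → f' i 1 ≠ f' j 1 := by
    intro i j hij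
    rw [← (hends i).2, ← (hends j).2]
    exact hright i j hij
  obtain ⟨hsg, hsgn⟩ := hlocal hmd hS hover hp hpm hps hleft hright
  obtain ⟨hsg', -⟩ := hlocal hmd' hS' hover' hp' hpm' hps' hleft' hright'
  have hsg'' : ∀ i j, i < j → (D'.IsPositive o (τ' i (p' i j), τ' j (p' i j)) ↔
      D.IsPositive o (τ i (p i j), τ j (p i j))) := by
    intro i j hij
    rw [hsg i j hij, hsg' i j hij, (hends i).1, (hends j).1]
  have n01 : (0 : Fin 3) ≠ 1 := by decide
  have n02 : (0 : Fin 3) ≠ 2 := by decide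
  have n12 : (1 : Fin 3) ≠ 2 := by decide
  have o1 := triangle_order (fun i j hij => (hpm i j hij).1) (fun i j hij => (hpm i j hij).2)
    hpne hps hsgn n01 n12 n02
  have o2 := triangle_order (fun i j hij => (hpm i j hij).1) (fun i j hij => (hpm i j hij).2)
    hpne hps hsgn n01.symm n02 n12
  rw [hps 1 0 n01.symm] at o2
  set bB : Bool := decide (d 2 * p 1 2 < d 2 * p 0 2) with hbB
  set bM : Bool := decide (d 1 * p 1 2 < d 1 * p 0 1) with hbM
  set bT : Bool := decide (d 0 * p 0 2 < d 0 * p 0 1) with hbT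
  have hrev : ∀ i j k, i ≠ j → j ≠ k → i ≠ k → ∀ bit : Bool,
      bit = decide (d i * p i j < d i * p i k) →
      ((!bit) = true ↔ d i * p' i j < d i * p' i k) := by
    rintro i j k hij hjk hik bit rfl
    have h1 := hord i j k hij hjk hik
    have h2 := hord i k j hik hjk.symm hij
    have h3 := hpne' i j k hij hjk hik
    rw [Bool.not_eq_true', decide_eq_false_iff_not]
    rcases (hS i).sign with h | h <;> rw [h]
    · rw [one_mul, one_mul, one_mul, one_mul, h1, not_lt]
      exact ⟨fun h4 => lt_of_le_of_ne h4 h3, le_of_lt⟩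
    · rw [neg_one_mul, neg_one_mul, neg_one_mul, neg_one_mul, neg_lt_neg_iff, neg_lt_neg_iff, h2,
        not_lt]
      exact ⟨fun h4 => lt_of_le_of_ne h4 h3.symm, le_of_lt⟩
  -- Comparing the sign of each crossing with the bit of the strand opposite to it gives three bits;
  -- by `o1` and `o2` they coincide, and the common value is `g`.
  obtain ⟨g, hg12, hg01, hg02⟩ : ∃ g : Bool,
      ((g == bT) = true ↔ D.IsPositive o (τ 1 (p 1 2), τ 2 (p 1 2))) ∧
      ((g == bB) = true ↔ D.IsPositive o (τ 0 (p 0 1), τ 1 (p 0 1))) ∧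
      ((g == bM) = true ↔ D.IsPositive o (τ 0 (p 0 2), τ 2 (p 0 2))) := by
    rw [hsg 1 2 (by decide), hsg 0 1 (by decide), hsg 0 2 (by decide)]
    have hK : 0 < (E * d 0 * d 1 * d 2) ^ 2 := sq_pos_iff.2
      (mul_ne_zero (mul_ne_zero (mul_ne_zero hE0 (hd0 0)) (hd0 1)) (hd0 2))
    have eB : bB = decide (0 < d 2 * (p 0 2 - p 1 2)) := by rw [hbB, mul_sub]; simp only [sub_pos]
    have eM : bM = decide (0 < d 1 * (p 0 1 - p 1 2)) := by rw [hbM, mul_sub]; simp only [sub_pos]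
    have eT : bT = decide (0 < d 0 * (p 0 1 - p 0 2)) := by rw [hbT, mul_sub]; simp only [sub_pos]
    have h1 : 0 < (d 0 * (p 0 1 - p 0 2) * (E * d 1 * d 2 * (f 1 (-1) - f 2 (-1)))) *
        (d 2 * (p 0 2 - p 1 2) * (E * d 0 * d 1 * (f 0 (-1) - f 1 (-1)))) := by
      calc 0 < _ := mul_pos hK o1
        _ = _ := by ring
    have h2 : 0 < (d 2 * (p 0 2 - p 1 2) * (E * d 0 * d 1 * (f 0 (-1) - f 1 (-1)))) *
        (d 1 * (p 0 1 - p 1 2) * (E * d 0 * d 2 * (f 0 (-1) - f 2 (-1)))) := by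
      calc 0 < _ := mul_pos hK o2
        _ = _ := by ring
    have h3 := decide_pos_beq_congr h1
    have h4 := decide_pos_beq_congr h2
    rw [← eT, ← eB] at h3
    rw [← eM, ← eB] at h4
    refine ⟨bT == decide (0 < E * d 1 * d 2 * (f 1 (-1) - f 2 (-1))), ?_, ?_, ?_⟩
    · exact beq_decide_beq_iff _ _
    · rw [h3]
      exact beq_decide_beq_iff _ _
    · rw [h3, h4]
      exact beq_decide_beq_iff _ _
  rw [hO.bracketMatrix_eq_triangle β hmd hS hover hp (fun i j hij => (hpm i j hij).1) hps hpne
    g bB bM bT (by rw [hbB, decide_eq_true_iff]) (by rw [hbM, decide_eq_true_iff])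
    (by rw [hbT, decide_eq_true_iff]) hg12 hg01 hg02,
    hO'.bracketMatrix_eq_triangle β hmd' hS' hover' hp' (fun i j hij => (hpm' i j hij).1) hps' hpne'
    (!g) (!bB) (!bM) (!bT)
    (by rw [hrev 2 1 0 n12.symm n01.symm n02.symm bB (by rw [hbB, hps 2 1 n12.symm,
      hps 2 0 n02.symm]), hps' 2 1 n12.symm, hps' 2 0 n02.symm])
    (by rw [hrev 1 2 0 n12 n02.symm n01.symm bM (by rw [hbM, hps 1 0 n01.symm]),
      hps' 1 0 n01.symm])
    (by rw [hrev 0 2 1 n02 n12.symm n01 bT hbT])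
    (by rw [hsg'' 1 2 (by decide), ← hg12]; cases g <;> cases bT <;> decide)
    (by rw [hsg'' 0 1 (by decide), ← hg01]; cases g <;> cases bB <;> decide)
    (by rw [hsg'' 0 2 (by decide), ← hg02]; cases g <;> cases bM <;> decide),
    matrix_add_triangle hO.hole β ε g bB bM bT]
  congr 2
  funext k
  fin_cases k <;> cases g <;> cases bB <;> cases bM <;> cases bT <;> rfl

theorem Step.bracketMatrix_eq [T2Space M] [Fintype X] (o : SurfaceOrientation M)
    (β : BiquandleBracket X R) {D D' : KnotoidDiagram M} (h : Step D D') :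
    D.bracketMatrix o β = D'.bracketMatrix o β := by
  rcases h with h | h | h | h | h
  · exact bracketMatrix_eq_of_reparametrization o β h
  · exact bracketMatrix_eq_of_isotopy o β h
  · exact bracketMatrix_eq_of_reidemeisterOne o β h
  · exact bracketMatrix_eq_of_reidemeisterTwo o β h
  · exact bracketMatrix_eq_of_reidemeisterThree o β h

end KnotoidDiagram

theorem mainTheorem1 {M : Type*} [TopologicalSpace M] [T2Space M]
    [ChartedSpace (EuclideanSpace ℝ (Fin 2)) M] [IsManifold (𝓡 2) ∞ M]
    (o : SurfaceOrientation M)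
    {X : Type*} [Fintype X] [Biquandle X] {R : Type*} [CommRing R]
    (β : BiquandleBracket X R)
    (D D' : KnotoidDiagram M) (h : D.Equivalent D') :
    D.bracketMatrix o β = D'.bracketMatrix o β := by
  induction h with
  | rel D D' h => exact h.bracketMatrix_eq o β
  | refl D => rfl
  | symm D D' _ ih => exact ih.symm
  | trans D D' D'' _ _ ih ih' => exact ih.trans ih'
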